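/- **Conventions.** For a partially defined map of finite sets $f:X\rightharpoonup Y$ and a family of sets $A_X$ indexed by finite sets, put $A_f=\prod_{y\in Y}A_{f^{-1}(y)}$; $[1]$ is a one-element set. A *generalized ring* is a functor $X\mapsto A_X$ from finite sets and partial bijections to pointed sets, with $A_\emptyset=\{0\}$, an element $1\in A_{[1]}$, and, for all partially defined maps $f:X\rightharpoonup Y$, natural operations $\lhd:A_Y\times A_f\to A_X$ (multiplication) and $\sslash:A_X\times A_f\to A_Y$ (contraction). These extend fibrewise to families, and satisfy: associativity and unit laws of $\lhd$, the unit law $a\sslash 1=a$, the adjunctions $(d\sslash c)\sslash a=d\sslash(a\lhd c)$ and $d\sslash(a\sslash c)=(d\lhd c)\sslash a$, left linearity $d\lhd(a\sslash c)=(d\lhd a)\sslash c$, and right linearity $(d\sslash c)\lhd a=(d\lhd \tilde a)\sslash\tilde c$, where for $f:X\rightharpoonup Y$, $g:W\rightharpoonup Y$ the families $\tilde a,\tilde c$ are the pullbacks of $a\in A_g$, $c\in A_f$ to the projections of $X\times_YW$ to $X$ and to $W$. For $a\in A_X$, $d\in A_Y$ let $a\otimes d\in A_{X\times Y}$ be $a\lhd(d)_{x\in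 X}$, with $X\times Y$ and $Y\times X$ identified. $A$ is *commutative* if, for all finite $X,Y$, $a,b\in A_X$, $c,d\in A_Y$ and $x\in (A_{[1]})^{X\times Y}$, $$((a\otimes d)\lhd x)\sslash(b\otimes c)=((d\otimes a)\lhd x)\sslash(c\otimes b).$$ An *$A$-set* is a pointed set $M$ with operations $\langle b,m,d\rangle:A_X\times M^X\times A_X\to M$ for finite $X$, with value the base point for $X=\emptyset$, that are associative ($\langle b\lhd b',m,d\lhd d'\rangle=\langle b,(\langle b'_y,m|_{f^{-1}(y)},d'_y\rangle)_y,d\rangle$), unital ($\langle 1,m,1\rangle=m$), natural ($\langle b,f^*m,d\lhd a\rangle=\langle b\sslash a,m,d\rangle$ and $\langle d\lhd a,f^*m,b\rangle=\langle d,m,b\sslash a\rangle$, where $f^*m$ is the base point off the domain of $f$) and commutative ($\langle d\otimes d',m,b\otimes b'\rangle=\langle d'\otimes d,m,b'\otimes b\rangle$, with $X\times Y$ and $Y\times X$ identified). Let $A^+_{[1]}=\{s\in A_{[1]}: 1\sslash s=s\}$, a commutative monoid acting on every $A_X$ and on every $A$-set; for a submonoid $S$, $S^{-1}$ denotes localization.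 An *ideal* is a sub-$A$-set of $A_{[1]}$, a *$+$ideal* is an ideal generated by elements of $A^+_{[1]}$, and $\mathrm{spec}^+(A)$ is the set of $+$ideals $\mathfrak p$ such that $S_{\mathfrak p}=A^+_{[1]}\setminus\mathfrak p$ is a submonoid of $A^+_{[1]}$. It has the topology with basis the sets $D^+(s)=\{\mathfrak p: s\notin\mathfrak p\}$, $s\in A^+_{[1]}$. The structure sheaf $\mathcal O_A$, a sheaf of generalized rings, and for an $A$-set $M$ the sheaf of $\mathcal O_A$-sets $M^\natural$, have as sections over $U$ the functions $\mathfrak p\mapsto\sigma(\mathfrak p)$ on $U$, with values in $S_{\mathfrak p}^{-1}A_X$ (for each finite $X$), respectively in $S_{\mathfrak p}^{-1}M$, that are locally constant: each point of $U$ has a neighbourhood $D^+(s)\subseteq U$ on which $\sigma(\mathfrak q)=m/s$ for a fixed $m$. For a category $\mathcal C$ with zero maps, $\mathcal C^{\Delta^{op}}$ is the category of simplicial objects; $\Sigma(\mathcal C)$ is the category of functors from $\Sigma_{\cdot}=\coprod_n\Sigma_n$ (the groupoid of the sets $\{1,\dots,n\}$ and bijections) to $\mathcal C^{\Delta^{op}}$;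 and $\mathrm{Sp}(\mathcal C)$ is the category of symmetric spectra: objects $M^\cdot$ of $\Sigma(\mathcal C)$ with an associative, unital, $\Sigma_p\times\Sigma_q$-equivariant action $S^p\wedge M^q\to M^{p+q}$ of the simplicial spheres $S^p=(\Delta[1]/\partial\Delta[1])^{\wedge p}$, with the maps that preserve the action. With $\mathcal C=A\text{-Set}$ these are the categories $A\text{-Set}^\Delta$, $\Sigma(A)$, $S_A\text{-mod}$; with $\mathcal C=\text{pre-}\mathcal O_X\text{-Set}$, the presheaves of $\mathcal O_X$-sets, they are the presheaf versions of $\mathcal O_X\text{-Set}^\Delta$, $\Sigma(\mathcal O_X)$, $S_{\mathcal O_X}\text{-mod}$. An object $M$ of $\text{pre-}\mathcal O_X\text{-Set}$ (respectively, of one of the other three) is *quasi-coherent* if it is a sheaf (respectively, a sheaf in each degree and level) and $X$ is covered by open affines $\mathrm{spec}^+(A_i)$, $A_i$ commutative, for which there are $M_i\in A_i\text{-Set}$ (respectively, in $A_i\text{-Set}^\Delta$, $\Sigma(A_i)$, $S_{A_i}\text{-mod}$) with $M|_{\mathrm{spec}^+(A_i)}\cong M_i^\natural$. The quasi-coherent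 objects form full subcategories, denoted by q.c. **Theorem.** Let $A$ be a commutative generalized ring and $X=\mathrm{spec}^+(A)$. The functor $M\mapsto M^\natural$ takes values in quasi-coherent objects and is an equivalence of categories, with the global sections functor $M\mapsto M(X)$ (where $A$ acts through $A\to\mathcal O_X(X)$) as an inverse, in each of the four cases $$A\text{-Set}\simeq \text{q.c.}\,\mathcal O_X\text{-Set},\qquad A\text{-Set}^{\Delta}\simeq \text{q.c.}\,\mathcal O_X\text{-Set}^{\Delta},$$ $$\Sigma(A)\simeq \text{q.c.}\,\Sigma(\mathcal O_X),\qquad S_A\text{-mod}\simeq \text{q.c.}\,S_{\mathcal O_X}\text{-mod},$$ where in the last three cases both functors are applied degreewise and levelwise. -/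

import Mathlib

open CategoryTheory Opposite TopologicalSpace

universe u

set_option linter.unusedSectionVars false
set_option linter.unusedVariables false

/-! ### Partially defined maps of finite sets and their fibres -/

/-- The fibre `f⁻¹(y)` of a partially defined map `f : X ⇀ Y`. -/
abbrev fib {X Y : Type} (f : X → Option Y) (y : Y) : Type := {x : X // f x = some y}

/-- Composition of partially defined maps. -/
def pcomp {X Y Z : Type} (g : Y → Option Z) (f : X → Option Y) : X → Option Z :=
  fun x => (f x).bind g

open Classical in
/-- The restriction of `f : X ⇀ Y` to the fibres `(g ∘ f)⁻¹(z) → g⁻¹(z)` over `z`. -/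
noncomputable def fibMap {X Y Z : Type} (g : Y → Option Z) (f : X → Option Y) (z : Z) :
    fib (pcomp g f) z → Option (fib g z) :=
  fun x => (f x.1).bind fun y => if h : g y = some z then some ⟨y, h⟩ else none

theorem fibMap_eq_some {X Y Z : Type} {g : Y → Option Z} {f : X → Option Y} {z : Z}
    (x : fib (pcomp g f) z) (y : fib g z) : fibMap g f z x = some y ↔ f x.1 = some y.1 := by
  obtain ⟨y, hy⟩ := y
  simp only [fibMap, Option.bind_eq_some_iff]
  constructor
  · rintro ⟨y', h1, h2⟩
    split_ifs at h2 with h3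
    simp only [Option.some.injEq, Subtype.mk.injEq] at h2
    subst h2
    exact h1
  · intro h
    exact ⟨y, h, by simp [hy]⟩

/-- For `y ∈ g⁻¹(z)`, the fibre over `y` of the restriction of `f` is the fibre of `f`. -/
def fibEquiv {X Y Z : Type} (g : Y → Option Z) (f : X → Option Y) (z : Z) (y : fib g z) :
    fib f y.1 ≃ fib (fibMap g f z) y where
  toFun x := ⟨⟨x.1, by simp [pcomp, x.2, y.2]⟩, (fibMap_eq_some _ _).2 x.2⟩
  invFun x := ⟨x.1.1, (fibMap_eq_some _ _).1 x.2⟩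
  left_inv _ := rfl
  right_inv _ := rfl

/-- The unique total map `X → [1]`; here `[1]` is `Unit`. -/
abbrev toPt (X : Type) : X → Option Unit := fun _ => some ()

/-- `X` is the fibre of `X → [1]`. -/
def ptEquiv (X : Type) (i : Unit) : X ≃ fib (toPt X) i where
  toFun x := ⟨x, rfl⟩
  invFun x := x.1
  left_inv _ := rfl
  right_inv _ := rfl

/-- `Y` is the fibre of the first projection `X × Y → X`. -/
def fstEquiv (X Y : Type) (x : X) : Y ≃ fib (fun p : X × Y => some p.1) x where
  toFun y := ⟨(x, y), rfl⟩
  invFun p := p.1.2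
  left_inv _ := rfl
  right_inv p := by
    obtain ⟨⟨x', y⟩, h⟩ := p
    simp only [Option.some.injEq] at h
    subst h
    rfl

/-- A bijection of partially defined maps induces bijections of the fibres. -/
def fibCongr {X X' Y Y' : Type} {f : X → Option Y} {f' : X' → Option Y'} (e : X ≃ X')
    (k : Y ≃ Y') (h : ∀ x, f' (e x) = (f x).map k) (y : Y) : fib f y ≃ fib f' (k y) where
  toFun x := ⟨e x.1, by simp [h, x.2]⟩
  invFun x := ⟨e.symm x.1, by
    have h1 := h (e.symm x.1)
    rw [Equiv.apply_symm_apply, x.2] at h1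
    obtain ⟨y', h2, h3⟩ := Option.map_eq_some_iff.1 h1.symm
    rw [h2, k.injective h3]⟩
  left_inv x := by simp
  right_inv x := by simp

/-- The fibre product `X ∏_Y W` of two partially defined maps. -/
abbrev FProd {X Y W : Type} (f : X → Option Y) (g : W → Option Y) : Type :=
  {p : X × W // ∃ y, f p.1 = some y ∧ g p.2 = some y}

/-- The projection of the fibre product to `X`. -/
abbrev pfst {X Y W : Type} (f : X → Option Y) (g : W → Option Y) : FProd f g → Option X :=
  fun p => some p.1.1

/-- The projection of the fibre product to `W`. -/
abbrev psnd {X Y W : Type} (f : X → Option Y) (g : W → Option Y) : FProd f g → Option W :=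
  fun p => some p.1.2

/-- For `f x = y` the fibre of `X ∏_Y W → X` over `x` is `g⁻¹(y)`. -/
def pfstEquiv {X Y W : Type} {f : X → Option Y} {g : W → Option Y} {x : X} {y : Y}
    (h : f x = some y) : fib g y ≃ fib (pfst f g) x where
  toFun w := ⟨⟨(x, w.1), y, h, w.2⟩, rfl⟩
  invFun p := ⟨p.1.1.2, by
    obtain ⟨⟨⟨x', w⟩, y', h1, h2⟩, h3⟩ := p
    simp only [Option.some.injEq] at h3 h1 h2 h ⊢
    subst h3
    rw [h1, Option.some.injEq] at h
    rw [h2, h]⟩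
  left_inv _ := rfl
  right_inv p := by
    obtain ⟨⟨⟨x', w⟩, y', h1, h2⟩, h3⟩ := p
    simp only [Option.some.injEq] at h3
    subst h3
    rfl

/-- For `g w = y` the fibre of `X ∏_Y W → W` over `w` is `f⁻¹(y)`. -/
def psndEquiv {X Y W : Type} {f : X → Option Y} {g : W → Option Y} {w : W} {y : Y}
    (h : g w = some y) : fib f y ≃ fib (psnd f g) w where
  toFun x := ⟨⟨(x.1, w), y, x.2, h⟩, rfl⟩
  invFun p := ⟨p.1.1.1, by
    obtain ⟨⟨⟨x, w'⟩, y', h1, h2⟩, h3⟩ := p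
    simp only [Option.some.injEq] at h3 h1 h2 h ⊢
    subst h3
    rw [h2, Option.some.injEq] at h
    rw [h1, h]⟩
  left_inv _ := rfl
  right_inv p := by
    obtain ⟨⟨⟨x, w'⟩, y', h1, h2⟩, h3⟩ := p
    simp only [Option.some.injEq] at h3
    subst h3
    rfl

/-! ### Generalized rings -/

/-- The data of a generalized ring: a functor `A : 𝓕 → Set₀` on finite sets and partial
bijections (`≃.`), a unit `1 ∈ A_[1]`, and for every partially defined map `f : X ⇀ Y` the
multiplication `A_Y × A_f → A_X` and the contraction `A_X × A_f → A_Y`, where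
`A_f = ∏_{y ∈ Y} A_{f⁻¹(y)}`. -/
structure GRingData where
  obj (X : Type) [Finite X] : Type u
  map {X Y : Type} [Finite X] [Finite Y] (e : X ≃. Y) : obj X → obj Y
  zero (X : Type) [Finite X] : obj X
  one : obj Unit
  mul {X Y : Type} [Finite X] [Finite Y] (f : X → Option Y) (a : obj Y)
    (b : ∀ y, obj (fib f y)) : obj X
  con {X Y : Type} [Finite X] [Finite Y] (f : X → Option Y) (c : obj X)
    (b : ∀ y, obj (fib f y)) : obj Y

namespace GRingData

variable (A : GRingData.{u}) {X Y Z : Type} [Finite X] [Finite Y] [Finite Z]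

/-- Transport along a bijection of finite sets. -/
def tr (e : X ≃ Y) (a : A.obj X) : A.obj Y := A.map e.toPEquiv a

open Classical in
/-- The copy of an element of `A_[1]` in `A_X` at the place `x ∈ X` (for `X = {x}`, this is
the transport along `[1] ≅ X`). -/
noncomputable def pt (x : X) (s : A.obj Unit) : A.obj X := A.map (PEquiv.single () x) s

/-- The multiplication `A_g × A_f → A_{g ∘ f}`, formed fibre by fibre. -/
noncomputable def mulF (g : Y → Option Z) (f : X → Option Y) (a : ∀ z, A.obj (fib g z))
    (b : ∀ y, A.obj (fib f y)) (z : Z) : A.obj (fib (pcomp g f) z) :=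
  A.mul (fibMap g f z) (a z) fun y => A.tr (fibEquiv g f z y) (b y.1)

/-- The contraction `A_{g ∘ f} × A_f → A_g`, formed fibre by fibre. -/
noncomputable def conF (g : Y → Option Z) (f : X → Option Y)
    (c : ∀ z, A.obj (fib (pcomp g f) z)) (b : ∀ y, A.obj (fib f y)) (z : Z) : A.obj (fib g z) :=
  A.con (fibMap g f z) (c z) fun y => A.tr (fibEquiv g f z y) (b y.1)

/-- A family in `A_f`, for `f` with fibres of at most one element, that consists of units. -/
def IsOnes (f : X → Option Y) (b : ∀ y, A.obj (fib f y)) : Prop :=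
  ∀ (y : Y) (x : fib f y), b y = A.pt x A.one

end GRingData

/-- Generalized rings. The equivariance axioms `mul_tr` and `con_tr` say that the operations do
not depend on the names of the elements of the finite sets, and the axioms `con_ones` and `mul_ones`
(for `e` the identity: the unit laws `a ⫽ (1) = a = a ◁ (1)`) say that the functor structure
is the one given by the operations; together they say that the operations are natural. -/
structure GRing extends GRingData.{u} where
  map_refl {X : Type} [Finite X] (a : obj X) : map (PEquiv.refl X) a = a
  map_trans {X Y Z : Type} [Finite X] [Finite Y] [Finite Z] (e : X ≃. Y) (k : Y ≃. Z)
    (a : obj X) : map (e.trans k) a = map k (map e a)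
  map_zero {X Y : Type} [Finite X] [Finite Y] (e : X ≃. Y) : map e (zero X) = zero Y
  eq_zero {X : Type} [Finite X] [IsEmpty X] (a : obj X) : a = zero X
  mul_tr {X X' Y Y' : Type} [Finite X] [Finite X'] [Finite Y] [Finite Y'] {f : X → Option Y}
    {f' : X' → Option Y'} (e : X ≃ X') (k : Y ≃ Y') (h : ∀ x, f' (e x) = (f x).map k)
    (a : obj Y) (b : ∀ y, obj (fib f y)) (b' : ∀ y, obj (fib f' y))
    (hb : ∀ y, b' (k y) = toGRingData.tr (fibCongr e k h y) (b y)) :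
    mul f' (toGRingData.tr k a) b' = toGRingData.tr e (mul f a b)
  con_tr {X X' Y Y' : Type} [Finite X] [Finite X'] [Finite Y] [Finite Y'] {f : X → Option Y}
    {f' : X' → Option Y'} (e : X ≃ X') (k : Y ≃ Y') (h : ∀ x, f' (e x) = (f x).map k)
    (c : obj X) (b : ∀ y, obj (fib f y)) (b' : ∀ y, obj (fib f' y))
    (hb : ∀ y, b' (k y) = toGRingData.tr (fibCongr e k h y) (b y)) :
    con f' (toGRingData.tr e c) b' = toGRingData.tr k (con f c b)
  assoc {X Y Z : Type} [Finite X] [Finite Y] [Finite Z] (g : Y → Option Z) (f : X → Option Y)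
    (a : obj Z) (b : ∀ z, obj (fib g z)) (e : ∀ y, obj (fib f y)) :
    mul f (mul g a b) e = mul (pcomp g f) a (toGRingData.mulF g f b e)
  one_mul {X : Type} [Finite X] (a : obj X) :
    mul (toPt X) one (fun i => toGRingData.tr (ptEquiv X i) a) = a
  con_ones {X Y : Type} [Finite X] [Finite Y] (e : X ≃. Y) (a : obj X)
    (b : ∀ y, obj (fib e y)) (hb : toGRingData.IsOnes e b) : con e a b = map e a
  mul_ones {X Y : Type} [Finite X] [Finite Y] (e : X ≃. Y) (a : obj Y)
    (b : ∀ y, obj (fib e y)) (hb : toGRingData.IsOnes e b) : mul e a b = map e.symm a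
  left_adj {X Y Z : Type} [Finite X] [Finite Y] [Finite Z] (g : Y → Option Z) (f : X → Option Y)
    (d : obj X) (c : ∀ y, obj (fib f y)) (a : ∀ z, obj (fib g z)) :
    con g (con f d c) a = con (pcomp g f) d (toGRingData.mulF g f a c)
  right_adj {X Y Z : Type} [Finite X] [Finite Y] [Finite Z] (g : Y → Option Z)
    (f : X → Option Y) (d : obj Y) (c : ∀ y, obj (fib f y)) (a : ∀ z, obj (fib (pcomp g f) z)) :
    con g d (toGRingData.conF g f a c) = con (pcomp g f) (mul f d c) a
  left_linear {X Y Z : Type} [Finite X] [Finite Y] [Finite Z] (g : Y → Option Z)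
    (f : X → Option Y) (d : obj Z) (c : ∀ y, obj (fib f y)) (a : ∀ z, obj (fib (pcomp g f) z)) :
    mul g d (toGRingData.conF g f a c) = con f (mul (pcomp g f) d a) c
  /-- `a'` and `c'` are the families `ã` and `c̃` obtained from `a` and `c` by identifying
  fibres. -/
  right_linear {X Y W : Type} [Finite X] [Finite Y] [Finite W] (f : X → Option Y)
    (g : W → Option Y) (d : obj X) (c : ∀ y, obj (fib f y)) (a : ∀ y, obj (fib g y))
    (a' : ∀ x, obj (fib (pfst f g) x)) (c' : ∀ w, obj (fib (psnd f g) w))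
    (ha : ∀ x y (h : f x = some y), a' x = toGRingData.tr (pfstEquiv h) (a y))
    (hc : ∀ w y (h : g w = some y), c' w = toGRingData.tr (psndEquiv h) (c y)) :
    mul g (con f d c) a = con (psnd f g) (mul (pfst f g) d a') c'

namespace GRing

/-- Homomorphisms of generalized rings. -/
@[ext]
structure Hom (A B : GRing.{u}) where
  app (X : Type) [Finite X] : A.obj X → B.obj X
  app_map {X Y : Type} [Finite X] [Finite Y] (e : X ≃. Y) (a : A.obj X) :
    app Y (A.map e a) = B.map e (app X a)
  app_zero (X : Type) [Finite X] : app X (A.zero X) = B.zero X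
  app_one : app Unit A.one = B.one
  app_mul {X Y : Type} [Finite X] [Finite Y] (f : X → Option Y) (a : A.obj Y)
    (b : ∀ y, A.obj (fib f y)) : app X (A.mul f a b) = B.mul f (app Y a) fun y => app _ (b y)
  app_con {X Y : Type} [Finite X] [Finite Y] (f : X → Option Y) (c : A.obj X)
    (b : ∀ y, A.obj (fib f y)) : app Y (A.con f c b) = B.con f (app X c) fun y => app _ (b y)

/-- The category of generalized rings. -/
instance : Category GRing.{u} where
  Hom := Hom
  id A := ⟨fun _ _ a => a, fun _ _ => rfl, fun _ _ => rfl, rfl, fun _ _ _ => rfl, fun _ _ _ => rfl⟩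
  comp φ ψ := ⟨fun X _ a => ψ.app X (φ.app X a),
    fun e a => by rw [φ.app_map, ψ.app_map],
    fun X _ => by rw [φ.app_zero, ψ.app_zero],
    by rw [φ.app_one, ψ.app_one],
    fun f a b => by rw [φ.app_mul, ψ.app_mul],
    fun f a b => by rw [φ.app_con, ψ.app_con]⟩

variable (A : GRing.{u}) {X Y Z : Type} [Finite X] [Finite Y] [Finite Z]

/-- The product of `A_X` and `A_Y` in `A_{X × Y}`: the element `a ◁ d̃`. -/
noncomputable def box (a : A.obj X) (d : A.obj Y) : A.obj (X × Y) :=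
  A.mul (fun p : X × Y => some p.1) a fun x => A.tr (fstEquiv X Y x) d

/-- `(b ◁ (x_i)) ⫽ d` in `A_[1]`, for `b, d ∈ A_X` and a family `(x_i)` in `A_[1]`. -/
noncomputable def act (b : A.obj X) (x : X → A.obj Unit) (d : A.obj X) : A.obj Unit :=
  A.con (toPt X) (A.mul some b fun i => A.pt ⟨i, rfl⟩ (x i)) fun i => A.tr (ptEquiv X i) d

/-- Commutative generalized rings. -/
def IsComm : Prop :=
  ∀ (X Y : Type) [Finite X] [Finite Y] (a b : A.obj X) (c d : A.obj Y) (x : X × Y → A.obj Unit),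
    A.act (A.box a d) x (A.box b c) = A.act (A.box d a) (fun p => x p.swap) (A.box c b)

end GRing

namespace GRing

section Scalars

variable (A : GRing.{u}) {X Y Z : Type} [Finite X] [Finite Y] [Finite Z]

theorem tr_refl (a : A.obj X) : A.tr (Equiv.refl X) a = a := by
  rw [GRingData.tr, Equiv.toPEquiv_refl, A.map_refl]

theorem tr_tr (e : X ≃ Y) (k : Y ≃ Z) (a : A.obj X) :
    A.tr k (A.tr e a) = A.tr (e.trans k) a := by
  simp only [GRingData.tr, ← A.map_trans, Equiv.toPEquiv_trans]

theorem tr_pt (e : X ≃ Y) (x : X) (s : A.obj Unit) : A.tr e (A.pt x s) = A.pt (e x) s := by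
  classical
  simp only [GRingData.tr, GRingData.pt, ← A.map_trans]
  congr 1
  rw [PEquiv.single_trans_of_mem]
  simp [Equiv.toPEquiv_apply]

theorem pt_unit (i : Unit) (s : A.obj Unit) : A.pt i s = s := by
  have h : ∀ (d d' : DecidableEq Unit), @PEquiv.single _ _ d d' () i = PEquiv.refl Unit := by
    intro d d'
    obtain rfl := Subsingleton.elim d d'
    exact PEquiv.ext fun _ => PEquiv.single_apply _ _
  rw [GRingData.pt, h, A.map_refl]

theorem tr_unit (e : Unit ≃ X) (s : A.obj Unit) : A.tr e s = A.pt (e ()) s := by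
  rw [← tr_pt, pt_unit]

theorem tr_eq (e e' : X ≃ Y) (h : ∀ x, e x = e' x) (a : A.obj X) : A.tr e a = A.tr e' a := by
  rw [Equiv.ext h]

/-- Change of the name of a partial map. -/
def fibCast {X Y : Type} {f f' : X → Option Y} (h : f = f') (y : Y) : fib f y ≃ fib f' y :=
  Equiv.subtypeEquivRight fun x => by rw [h]

theorem mul_congr {f f' : X → Option Y} (h : f = f') (a : A.obj Y) (b : ∀ y, A.obj (fib f y))
    (b' : ∀ y, A.obj (fib f' y)) (hb : ∀ y, b' y = A.tr (fibCast h y) (b y)) :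
    A.mul f a b = A.mul f' a b' := by
  subst h
  congr 1
  funext y
  rw [hb]
  exact ((tr_eq A _ (Equiv.refl _) (fun _ => rfl) (b y)).trans (tr_refl A _)).symm

theorem con_congr {f f' : X → Option Y} (h : f = f') (a : A.obj X) (b : ∀ y, A.obj (fib f y))
    (b' : ∀ y, A.obj (fib f' y)) (hb : ∀ y, b' y = A.tr (fibCast h y) (b y)) :
    A.con f a b = A.con f' a b' := by
  subst h
  congr 1
  funext y
  rw [hb]
  exact ((tr_eq A _ (Equiv.refl _) (fun _ => rfl) (b y)).trans (tr_refl A _)).symm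

/-- The multiplication `A_[1] × A_X → A_X`. -/
noncomputable def sc (s : A.obj Unit) (a : A.obj X) : A.obj X :=
  A.mul (toPt X) s fun i => A.tr (ptEquiv X i) a

/-- The involution `s ↦ sᵗ = 1 ⫽ s` of `A_[1]`. -/
noncomputable def star (s : A.obj Unit) : A.obj Unit :=
  A.con (toPt Unit) A.one fun i => A.tr (ptEquiv Unit i) s

/-- `a ◁ (s)_{x ∈ X}`. -/
noncomputable def rs (a : A.obj X) (s : A.obj Unit) : A.obj X :=
  A.mul some a fun x => A.pt ⟨x, rfl⟩ s

/-- `a ⫽ (s)_{x ∈ X}`. -/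
noncomputable def rc (a : A.obj X) (s : A.obj Unit) : A.obj X :=
  A.con some a fun x => A.pt ⟨x, rfl⟩ s

theorem fibMap_some (g : Y → Option Z) (z : Z) : fibMap g some z = some := by
  funext x
  exact (fibMap_eq_some _ _).2 rfl

theorem mulF_pt (g : Y → Option Z) (b : ∀ z, A.obj (fib g z)) (s : A.obj Unit) (z : Z) :
    A.mulF g some b (fun y => A.pt ⟨y, rfl⟩ s) z = A.rs (b z) s := by
  refine A.mul_congr (fibMap_some g z) _ _ _ fun y => ?_
  rw [tr_pt, tr_pt]
  rfl

theorem conF_pt (g : Y → Option Z) (b : ∀ z, A.obj (fib g z)) (s : A.obj Unit) (z : Z) :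
    A.conF g some b (fun y => A.pt ⟨y, rfl⟩ s) z = A.rc (b z) s := by
  refine A.con_congr (fibMap_some g z) _ _ _ fun y => ?_
  rw [tr_pt, tr_pt]
  rfl

theorem pcomp_some (f : X → Option Y) : pcomp some f = f := by
  funext x
  simp [pcomp]

/-- The one point set `some ⁻¹ (y)`. -/
def someEquiv (y : Y) : fib (some : Y → Option Y) y ≃ Unit where
  toFun _ := ()
  invFun _ := ⟨y, rfl⟩
  left_inv y' := by
    obtain ⟨y', h⟩ := y'
    simp only [Option.some.injEq] at h
    subst h
    rfl
  right_inv _ := rfl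

theorem mulF_some (f : X → Option Y) (s : A.obj Unit) (b : ∀ y, A.obj (fib f y)) (y : Y) :
    A.sc s (b y) =
      A.tr (fibCast (pcomp_some f) y) (A.mulF some f (fun y => A.pt ⟨y, rfl⟩ s) b y) := by
  unfold GRingData.mulF
  rw [← A.mul_tr (f' := toPt (fib f y)) (fibCast (pcomp_some f) y) (someEquiv y)
    (b' := fun i => A.tr (ptEquiv _ i) (b y))]
  · rw [tr_pt, pt_unit]; rfl
  · intro x
    rw [(fibMap_eq_some x ⟨y, rfl⟩).2]
    · rfl
    · exact (congrFun (pcomp_some f) x.1).symm.trans x.2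
  · rintro ⟨y', h⟩
    simp only [Option.some.injEq] at h
    subst h
    rw [tr_tr]
    exact A.tr_eq _ _ (fun _ => rfl) _

theorem mul_rs_right (f : X → Option Y) (a : A.obj Y) (b : ∀ y, A.obj (fib f y))
    (s : A.obj Unit) : A.mul f a (fun y => A.rs (b y) s) = A.rs (A.mul f a b) s := by
  conv_rhs => rw [rs, A.assoc]
  congr 1
  funext y
  exact (A.mulF_pt f b s y).symm

theorem mul_rs_left (f : X → Option Y) (a : A.obj Y) (b : ∀ y, A.obj (fib f y))
    (s : A.obj Unit) : A.mul f (A.rs a s) b = A.mul f a (fun y => A.sc s (b y)) := by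
  rw [rs, A.assoc]
  exact A.mul_congr (pcomp_some f) _ _ _ (A.mulF_some f s b)

theorem con_rc_left (f : X → Option Y) (c : A.obj X) (b : ∀ y, A.obj (fib f y))
    (s : A.obj Unit) : A.con f (A.rc c s) b = A.con f c (fun y => A.rs (b y) s) := by
  rw [rc, A.left_adj]
  congr 1
  funext y
  exact (A.mulF_pt f b s y)

theorem rc_con (f : X → Option Y) (c : A.obj X) (b : ∀ y, A.obj (fib f y))
    (s : A.obj Unit) : A.rc (A.con f c b) s = A.con f c (fun y => A.sc s (b y)) := by
  rw [rc, A.left_adj]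
  exact A.con_congr (pcomp_some f) _ _ _ (A.mulF_some f s b)

theorem mul_pt_one (a : A.obj X) : A.rs a A.one = a := by
  have h := A.mul_ones (PEquiv.refl X) a (fun x => A.pt ⟨x, rfl⟩ A.one) (by
    rintro y ⟨x, hx⟩
    have : x = y := by simpa using hx
    subst this
    rfl)
  rw [PEquiv.symm_refl, A.map_refl] at h
  exact h

theorem con_pt_one (a : A.obj X) : A.rc a A.one = a := by
  have h := A.con_ones (PEquiv.refl X) a (fun x => A.pt ⟨x, rfl⟩ A.one) (by
    rintro y ⟨x, hx⟩
    have : x = y := by simpa using hx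
    subst this
    rfl)
  rw [A.map_refl] at h
  exact h

theorem tr_ptEquiv (i : Unit) (s : A.obj Unit) : A.tr (ptEquiv Unit i) s = A.pt ⟨(), rfl⟩ s :=
  A.tr_unit _ _

theorem star_eq_rc (s : A.obj Unit) : A.star s = A.rc A.one s := by
  rw [star, rc]
  congr 1
  funext i
  exact A.tr_ptEquiv i s

theorem sc_eq_rs_unit (s t : A.obj Unit) : A.sc s t = A.rs s t := by
  rw [sc, rs]
  congr 1
  funext i
  exact A.tr_ptEquiv i t

theorem pt_rc (i : X) (s : A.obj Unit) :
    A.pt (X := fib (some : X → Option X) i) ⟨i, rfl⟩ (A.rc A.one s) =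
      A.rc (A.pt ⟨i, rfl⟩ A.one) s := by
  have h := A.con_tr (f := some) (f' := some) (someEquiv i).symm (someEquiv i).symm
    (fun _ => rfl) A.one (fun x => A.pt ⟨x, rfl⟩ s) (fun x => A.pt ⟨x, rfl⟩ s)
    (fun y => by rw [tr_pt]; rfl)
  rw [tr_unit, tr_unit] at h
  exact h.symm

theorem star_star (s : A.obj Unit) : A.star (A.star s) = s := by
  have h := A.right_adj (X := Unit) (Y := Unit) (Z := Unit) some some A.one
    (fun i => A.pt ⟨i, rfl⟩ s) (fun i => A.pt ⟨i, rfl⟩ A.one)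
  have h1 : A.con (pcomp some some) (A.mul some A.one fun i => A.pt ⟨i, rfl⟩ s)
      (fun i => A.pt ⟨i, rfl⟩ A.one) = s := by
    have h2 : A.mul some A.one (fun i => A.pt ⟨i, rfl⟩ s) = s := by
      have := A.one_mul s
      conv_rhs => rw [← this]
      congr 1
      funext i
      exact (A.tr_ptEquiv i s).symm
    rw [h2]
    exact A.con_pt_one s
  rw [h1] at h
  refine Eq.trans ?_ h
  rw [star_eq_rc, rc]
  congr 1
  funext i
  refine Eq.trans ?_ (A.conF_pt some (fun i => A.pt ⟨i, rfl⟩ A.one) s i).symm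
  rw [star_eq_rc]
  exact A.pt_rc i s

theorem sc_star (s : A.obj Unit) (a : A.obj X) : A.sc (A.star s) a = A.rc a s := by
  rw [sc, star]
  rw [A.right_linear (toPt Unit) (toPt X) A.one _ _ 
    (fun i => A.tr (pfstEquiv (rfl : toPt Unit i = some ())) (A.tr (ptEquiv X ()) a))
    (fun x => A.tr (psndEquiv (rfl : toPt X x = some ())) (A.tr (ptEquiv Unit ()) s))
    (fun _ _ _ => rfl) (fun _ _ _ => rfl)]
  let e : FProd (toPt Unit) (toPt X) ≃ X :=
    { toFun := fun p => p.1.2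
      invFun := fun x => ⟨((), x), (), rfl, rfl⟩
      left_inv := fun _ => rfl
      right_inv := fun _ => rfl }
  have h1 : A.tr e (A.mul (pfst (toPt Unit) (toPt X)) A.one
      (fun i => A.tr (pfstEquiv (rfl : toPt Unit i = some ())) (A.tr (ptEquiv X ()) a))) = a := by
    conv_rhs => rw [← A.one_mul a]
    rw [← A.mul_tr (f' := toPt X) e (Equiv.refl _) (fun _ => rfl) _ _
      (fun i => A.tr (ptEquiv X i) a)]
    · rw [tr_refl]
    · intro y
      rw [tr_tr, tr_tr]
      exact A.tr_eq _ _ (fun _ => rfl) _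
  have h2 := A.con_tr (f := psnd (toPt Unit) (toPt X)) (f' := some) e (Equiv.refl X)
    (fun _ => rfl) (A.mul (pfst (toPt Unit) (toPt X)) A.one
      (fun i => A.tr (pfstEquiv (rfl : toPt Unit i = some ())) (A.tr (ptEquiv X ()) a)))
    (fun x => A.tr (psndEquiv (rfl : toPt X x = some ())) (A.tr (ptEquiv Unit ()) s))
    (fun x => A.pt ⟨x, rfl⟩ s) (by
      intro x
      rw [tr_ptEquiv, tr_pt, tr_pt]
      rfl)
  rw [h1, tr_refl] at h2
  exact h2.symm

theorem rs_star (s : A.obj Unit) (a : A.obj X) : A.rs a (A.star s) = A.rc a s := by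
  have h := A.left_linear (X := X) (Y := X) (Z := X) some some a
    (fun i => A.pt ⟨i, rfl⟩ s) (fun i => A.pt ⟨i, rfl⟩ A.one)
  have h1 : A.mul (pcomp some some) a (fun i => A.pt ⟨i, rfl⟩ A.one) = a := A.mul_pt_one a
  rw [h1] at h
  rw [rc, ← h, rs]
  congr 1
  funext i
  refine Eq.trans ?_ (A.conF_pt some (fun i => A.pt ⟨i, rfl⟩ A.one) s i).symm
  rw [star_eq_rc]
  exact A.pt_rc i s

theorem sc_eq_rs (s : A.obj Unit) (a : A.obj X) : A.sc s a = A.rs a s := by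
  rw [← A.star_star s, sc_star, rs_star]

theorem mul_sc_left (f : X → Option Y) (s : A.obj Unit) (a : A.obj Y)
    (b : ∀ y, A.obj (fib f y)) : A.mul f (A.sc s a) b = A.sc s (A.mul f a b) := by
  rw [sc_eq_rs, mul_rs_left, sc_eq_rs, ← mul_rs_right]
  simp only [sc_eq_rs]

theorem mul_sc_right (f : X → Option Y) (s : A.obj Unit) (a : A.obj Y)
    (b : ∀ y, A.obj (fib f y)) : A.mul f a (fun y => A.sc s (b y)) = A.sc s (A.mul f a b) := by
  simp only [sc_eq_rs, mul_rs_right]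

theorem con_sc_left (f : X → Option Y) (s : A.obj Unit) (c : A.obj X)
    (b : ∀ y, A.obj (fib f y)) : A.con f (A.sc s c) b = A.sc s (A.con f c b) := by
  rw [← A.star_star s, sc_star, con_rc_left, sc_star, rc_con]
  simp only [sc_eq_rs]

theorem con_sc_right (f : X → Option Y) (s : A.obj Unit) (c : A.obj X)
    (b : ∀ y, A.obj (fib f y)) :
    A.con f c (fun y => A.sc s (b y)) = A.sc (A.star s) (A.con f c b) := by
  rw [sc_star, rc_con]

theorem map_sc (e : X ≃. Y) (s : A.obj Unit) (a : A.obj X) :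
    A.map e (A.sc s a) = A.sc s (A.map e a) := by
  obtain ⟨b, hb⟩ : ∃ b : ∀ x, A.obj (fib e.symm x), A.IsOnes e.symm b := by
    classical
    refine ⟨fun x => if h : Nonempty (fib e.symm x) then A.pt h.some A.one else A.zero _, ?_⟩
    intro x y
    have h : Nonempty (fib e.symm x) := ⟨y⟩
    refine (dif_pos h).trans ?_
    congr 1
    exact Subtype.ext (e.symm.inj h.some.2 y.2)
  have h1 := A.mul_ones e.symm (A.sc s a) b hb
  have h2 := A.mul_ones e.symm a b hb
  rw [PEquiv.symm_symm] at h1 h2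
  rw [← h1, ← h2, mul_sc_left]

theorem sc_comm (s t : A.obj Unit) : A.sc s t = A.sc t s := by
  rw [sc_eq_rs_unit, sc_eq_rs]

theorem one_sc (a : A.obj X) : A.sc A.one a = a := A.one_mul a

theorem sc_sc (s t : A.obj Unit) (a : A.obj X) : A.sc (A.sc s t) a = A.sc s (A.sc t a) := by
  rw [sc, mul_sc_left]
  rfl

theorem sc_zero (s : A.obj Unit) : A.sc s (A.zero X) = A.zero X := by
  have h := A.map_zero (⊥ : Empty ≃. X)
  rw [← h, ← map_sc]
  congr 1
  exact A.eq_zero _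

theorem star_sc (s t : A.obj Unit) : A.star (A.sc s t) = A.sc (A.star s) (A.star t) := by
  have h : ∀ r : A.obj Unit, A.star r = A.con (toPt Unit) A.one fun i => A.tr (ptEquiv Unit i) r :=
    fun _ => rfl
  rw [h (A.sc s t), h t, ← A.con_sc_right]
  congr 1
  funext i
  exact A.map_sc _ _ _

theorem star_one : A.star A.one = A.one := by
  rw [star_eq_rc, con_pt_one]

end Scalars

/-- The commutative monoid `A⁺_[1]` of symmetric elements of `A_[1]`. -/
def Sym (A : GRing.{u}) : Type u := {s : A.obj Unit // A.star s = s}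

noncomputable instance (A : GRing.{u}) : CommMonoid A.Sym where
  mul s t := ⟨A.sc s.1 t.1, by rw [star_sc, s.2, t.2]⟩
  one := ⟨A.one, A.star_one⟩
  mul_assoc _ _ _ := Subtype.ext (A.sc_sc _ _ _)
  one_mul _ := Subtype.ext (A.one_sc _)
  mul_one _ := Subtype.ext ((A.sc_comm _ _).trans (A.one_sc _))
  mul_comm _ _ := Subtype.ext (A.sc_comm _ _)

noncomputable instance (A : GRing.{u}) (X : Type) [Finite X] : MulAction A.Sym (A.obj X) where
  smul s a := A.sc s.1 a
  one_smul _ := A.one_sc _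
  mul_smul _ _ _ := A.sc_sc _ _ _

end GRing

/-! ### Localization -/

section Loc

variable {R : Type u} [CommMonoid R]

/-- The relation `(m₁, s₁) ≃ (m₂, s₂)` iff `s s₂ m₁ = s s₁ m₂` for some `s ∈ S`. -/
def locSetoid (S : Submonoid R) (E : Type u) [MulAction R E] : Setoid (E × S) where
  r p q := ∃ s : S, (s : R) • (q.2 : R) • p.1 = (s : R) • (p.2 : R) • q.1
  iseqv :=
    { refl := fun _ => ⟨1, rfl⟩
      symm := fun ⟨s, h⟩ => ⟨s, h.symm⟩
      trans := by
        rintro ⟨m, s⟩ ⟨n, t⟩ ⟨k, r⟩ ⟨a, h⟩ ⟨b, h'⟩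
        refine ⟨a * b * t, ?_⟩
        simp only [Submonoid.coe_mul, smul_smul] at h h' ⊢
        calc ((a : R) * b * t * r) • m = ((b : R) * r) • ((a : R) * t) • m := by
              rw [smul_smul]; congr 1; simp only [mul_comm, mul_left_comm]
          _ = ((a : R) * s) • ((b : R) * r) • n := by
              rw [h, smul_smul, smul_smul]; congr 1; simp only [mul_comm, mul_left_comm]
          _ = ((a : R) * b * t * s) • k := by
              rw [h', smul_smul]; congr 1; simp only [mul_comm, mul_left_comm] }

/-- The localization `S⁻¹E` of a set `E` on which a commutative monoid acts. -/
def Loc (S : Submonoid R) (E : Type u) [MulAction R E] : Type u := Quotient (locSetoid S E)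

namespace Loc

variable {S : Submonoid R} {E : Type u} [MulAction R E]

/-- The fraction `m / s`. -/
def mk (m : E) (s : S) : Loc S E := Quotient.mk (locSetoid S E) (m, s)

theorem mk_eq_mk {m n : E} {s t : S} :
    (mk m s : Loc S E) = mk n t ↔ ∃ r : S, (r : R) • (t : R) • m = (r : R) • (s : R) • n :=
  Quotient.eq (r := locSetoid S E)

theorem exists_rep (x : Loc S E) : ∃ m s, x = mk m s := by
  obtain ⟨⟨m, s⟩, h⟩ := Quotient.exists_rep x
  exact ⟨m, s, h.symm⟩

theorem mk_smul (m : E) (s t : S) (u : R) (h : (t : R) = u * s) : (mk (u • m) t : Loc S E) = mk m s :=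
  mk_eq_mk.2 ⟨1, by rw [h, smul_smul (s : R), mul_comm (s : R)]⟩

theorem exists_common {ι : Type} [Finite ι] {E : ι → Type u} [∀ i, MulAction R (E i)]
    (x : ∀ i, Loc S (E i)) : ∃ (m : ∀ i, E i) (s : S), ∀ i, x i = mk (m i) s := by
  classical
  have := Fintype.ofFinite ι
  choose m s h using fun i => exists_rep (x i)
  choose u hu using fun i => Finset.dvd_prod_of_mem s (Finset.mem_univ i)
  refine ⟨fun i => (u i : R) • m i, ∏ i, s i, fun i => ?_⟩
  rw [h i, mk_smul]
  rw [hu i, Submonoid.coe_mul, mul_comm]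

theorem exists_uniform {ι : Type} [Finite ι] {E : ι → Type u} [∀ i, MulAction R (E i)]
    {m n : ∀ i, E i} {s t : S} (h : ∀ i, (mk (m i) s : Loc S (E i)) = mk (n i) t) :
    ∃ r : S, ∀ i, ((r : R) * t) • m i = ((r : R) * s) • n i := by
  classical
  have := Fintype.ofFinite ι
  choose r hr using fun i => mk_eq_mk.1 (h i)
  choose u hu using fun i => Finset.dvd_prod_of_mem r (Finset.mem_univ i)
  refine ⟨∏ i, r i, fun i => ?_⟩
  have h1 := congrArg (fun x => (u i : R) • x) (hr i)
  simp only [smul_smul] at h1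
  rw [hu i]
  simp only [Submonoid.coe_mul]
  rw [mul_comm (r i : R), mul_assoc, mul_assoc]
  simpa only [mul_assoc] using h1

end Loc

end Loc

namespace GRing

section Localization

variable (A : GRing.{u}) (S : Submonoid A.Sym) {X Y Z : Type} [Finite X] [Finite Y] [Finite Z]

theorem smul_def (s : A.Sym) (a : A.obj X) : s • a = A.sc s.1 a := rfl

theorem mul_smul_left (f : X → Option Y) (s : A.Sym) (a : A.obj Y)
    (b : ∀ y, A.obj (fib f y)) : A.mul f (s • a) b = s • A.mul f a b :=
  A.mul_sc_left _ _ _ _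

theorem mul_smul_right (f : X → Option Y) (s : A.Sym) (a : A.obj Y)
    (b : ∀ y, A.obj (fib f y)) : A.mul f a (fun y => s • b y) = s • A.mul f a b :=
  A.mul_sc_right _ _ _ _

theorem con_smul_left (f : X → Option Y) (s : A.Sym) (c : A.obj X)
    (b : ∀ y, A.obj (fib f y)) : A.con f (s • c) b = s • A.con f c b :=
  A.con_sc_left _ _ _ _

theorem con_smul_right (f : X → Option Y) (s : A.Sym) (c : A.obj X)
    (b : ∀ y, A.obj (fib f y)) : A.con f c (fun y => s • b y) = s • A.con f c b := by
  have h := A.con_sc_right f s.1 c b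
  rw [s.2] at h
  exact h

theorem map_smul (e : X ≃. Y) (s : A.Sym) (a : A.obj X) : A.map e (s • a) = s • A.map e a :=
  A.map_sc _ _ _

theorem smul_zero (s : A.Sym) : s • A.zero X = A.zero X := A.sc_zero _

/-- The operation on fractions given by multiplication. -/
noncomputable def locMul (f : X → Option Y) (a : Loc S (A.obj Y))
    (b : ∀ y, Loc S (A.obj (fib f y))) : Loc S (A.obj X) :=
  Loc.mk (A.mul f (Loc.exists_rep a).choose (Loc.exists_common b).choose)
    ((Loc.exists_rep a).choose_spec.choose * (Loc.exists_common b).choose_spec.choose)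

/-- The operation on fractions given by contraction. -/
noncomputable def locCon (f : X → Option Y) (c : Loc S (A.obj X))
    (b : ∀ y, Loc S (A.obj (fib f y))) : Loc S (A.obj Y) :=
  Loc.mk (A.con f (Loc.exists_rep c).choose (Loc.exists_common b).choose)
    ((Loc.exists_rep c).choose_spec.choose * (Loc.exists_common b).choose_spec.choose)

variable {S}

theorem locMul_mk (f : X → Option Y) (a : A.obj Y) (b : ∀ y, A.obj (fib f y)) (s t : S) :
    A.locMul S f (Loc.mk a s) (fun y => Loc.mk (b y) t) = Loc.mk (A.mul f a b) (s * t) := by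
  have h := (Loc.exists_rep (Loc.mk a s)).choose_spec.choose_spec
  have h' := (Loc.exists_common fun y => (Loc.mk (b y) t : Loc S _)).choose_spec.choose_spec
  rw [locMul]
  generalize (Loc.exists_rep (Loc.mk a s)).choose_spec.choose = s' at *
  generalize (Loc.exists_rep (Loc.mk a s)).choose = a' at *
  generalize (Loc.exists_common fun y => (Loc.mk (b y) t : Loc S _)).choose_spec.choose = t' at *
  generalize (Loc.exists_common fun y => (Loc.mk (b y) t : Loc S _)).choose = b' at *
  obtain ⟨r, hr⟩ := Loc.mk_eq_mk.1 h
  obtain ⟨q, hq⟩ := Loc.exists_uniform h'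
  rw [Loc.mk_eq_mk]
  refine ⟨r * q, ?_⟩
  have h1 : A.mul f (((r : A.Sym) * s) • a') (fun y => ((q : A.Sym) * t) • b' y) =
      A.mul f (((r : A.Sym) * s') • a) (fun y => ((q : A.Sym) * t') • b y) := by
    simp only [smul_smul] at hr
    simp only [hr, hq]
  simp only [mul_smul_left, mul_smul_right, smul_smul] at h1
  simp only [Submonoid.coe_mul, smul_smul]
  rw [mul_mul_mul_comm, mul_comm ((r : A.Sym) * s), h1, mul_comm ((q : A.Sym) * t'),
    mul_mul_mul_comm]

theorem locCon_mk (f : X → Option Y) (c : A.obj X) (b : ∀ y, A.obj (fib f y)) (s t : S) :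
    A.locCon S f (Loc.mk c s) (fun y => Loc.mk (b y) t) = Loc.mk (A.con f c b) (s * t) := by
  have h := (Loc.exists_rep (Loc.mk c s)).choose_spec.choose_spec
  have h' := (Loc.exists_common fun y => (Loc.mk (b y) t : Loc S _)).choose_spec.choose_spec
  rw [locCon]
  generalize (Loc.exists_rep (Loc.mk c s)).choose_spec.choose = s' at *
  generalize (Loc.exists_rep (Loc.mk c s)).choose = c' at *
  generalize (Loc.exists_common fun y => (Loc.mk (b y) t : Loc S _)).choose_spec.choose = t' at *
  generalize (Loc.exists_common fun y => (Loc.mk (b y) t : Loc S _)).choose = b' at *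
  obtain ⟨r, hr⟩ := Loc.mk_eq_mk.1 h
  obtain ⟨q, hq⟩ := Loc.exists_uniform h'
  rw [Loc.mk_eq_mk]
  refine ⟨r * q, ?_⟩
  have h1 : A.con f (((r : A.Sym) * s) • c') (fun y => ((q : A.Sym) * t) • b' y) =
      A.con f (((r : A.Sym) * s') • c) (fun y => ((q : A.Sym) * t') • b y) := by
    simp only [smul_smul] at hr
    simp only [hr, hq]
  simp only [con_smul_left, con_smul_right, smul_smul] at h1
  simp only [Submonoid.coe_mul, smul_smul]
  rw [mul_mul_mul_comm, mul_comm ((r : A.Sym) * s), h1, mul_comm ((q : A.Sym) * t'),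
    mul_mul_mul_comm]

variable (S)

/-- The operation on fractions given by functoriality. -/
noncomputable def locMap (e : X ≃. Y) : Loc S (A.obj X) → Loc S (A.obj Y) :=
  Quotient.map' (s₁ := locSetoid S _) (s₂ := locSetoid S _) (fun p => (A.map e p.1, p.2)) (by
    rintro ⟨a, s⟩ ⟨b, t⟩ ⟨r, h⟩
    refine ⟨r, ?_⟩
    have h1 := congrArg (A.map e) h
    simpa only [map_smul] using h1)

variable {S}

theorem locMap_mk (e : X ≃. Y) (a : A.obj X) (s : S) :
    A.locMap S e (Loc.mk a s) = Loc.mk (A.map e a) s := rfl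

variable (S)

/-- The operations of `S⁻¹A`. -/
noncomputable def locData : GRingData.{u} where
  obj X _ := Loc S (A.obj X)
  map e := A.locMap S e
  zero X _ := Loc.mk (A.zero X) 1
  one := Loc.mk A.one 1
  mul f a b := A.locMul S f a b
  con f c b := A.locCon S f c b

variable {S}

theorem loc_mulF (g : Y → Option Z) (f : X → Option Y) (a : ∀ z, A.obj (fib g z))
    (b : ∀ y, A.obj (fib f y)) (s t : S) :
    (A.locData S).mulF g f (fun z => Loc.mk (a z) s) (fun y => Loc.mk (b y) t) =
      fun z => Loc.mk (A.mulF g f a b z) (s * t) := by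
  funext z
  exact A.locMul_mk _ _ (fun y => A.tr (fibEquiv g f z y) (b y.1)) _ _

theorem loc_conF (g : Y → Option Z) (f : X → Option Y) (c : ∀ z, A.obj (fib (pcomp g f) z))
    (b : ∀ y, A.obj (fib f y)) (s t : S) :
    (A.locData S).conF g f (fun z => Loc.mk (c z) s) (fun y => Loc.mk (b y) t) =
      fun z => Loc.mk (A.conF g f c b z) (s * t) := by
  funext z
  exact A.locCon_mk _ _ (fun y => A.tr (fibEquiv g f z y) (b y.1)) _ _

theorem loc_tr (e : X ≃ Y) (a : A.obj X) (s : S) :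
    (A.locData S).tr e (Loc.mk a s : Loc S (A.obj X)) = (Loc.mk (A.tr e a) s : Loc S (A.obj Y)) :=
  rfl

theorem loc_exists (a : (A.locData S).obj X) : ∃ (m : A.obj X) (s : S), a = Loc.mk m s :=
  Loc.exists_rep a

theorem loc_exists_fam {f : X → Option Y} (b : ∀ y, (A.locData S).obj (fib f y)) :
    ∃ (m : ∀ y, A.obj (fib f y)) (s : S), b = fun y => Loc.mk (m y) s := by
  obtain ⟨m, s, h⟩ := Loc.exists_common (E := fun y => A.obj (fib f y)) b
  exact ⟨m, s, funext h⟩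

theorem loc_mul (f : X → Option Y) (a : A.obj Y) (b : ∀ y, A.obj (fib f y)) (s t : S) :
    (A.locData S).mul f (Loc.mk a s : Loc S (A.obj Y)) (fun y => Loc.mk (b y) t) =
      (Loc.mk (A.mul f a b) (s * t) : Loc S (A.obj X)) := A.locMul_mk f a b s t

theorem loc_con (f : X → Option Y) (c : A.obj X) (b : ∀ y, A.obj (fib f y)) (s t : S) :
    (A.locData S).con f (Loc.mk c s : Loc S (A.obj X)) (fun y => Loc.mk (b y) t) =
      (Loc.mk (A.con f c b) (s * t) : Loc S (A.obj Y)) := A.locCon_mk f c b s t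

theorem exists_isOnes (e : X ≃. Y) : ∃ b : ∀ y, A.obj (fib e y), A.IsOnes e b := by
  classical
  refine ⟨fun x => if h : Nonempty (fib e x) then A.pt h.some A.one else A.zero _, ?_⟩
  intro x y
  have h : Nonempty (fib e x) := ⟨y⟩
  refine (dif_pos h).trans ?_
  congr 1
  exact Subtype.ext (e.inj h.some.2 y.2)

theorem loc_isOnes (e : X ≃. Y) (b : ∀ y, (A.locData S).obj (fib e y))
    (hb : (A.locData S).IsOnes e b) :
    ∃ b' : ∀ y, A.obj (fib e y), A.IsOnes e b' ∧ b = fun y => Loc.mk (b' y) (1 : S) := by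
  obtain ⟨b', hb'⟩ := A.exists_isOnes e
  refine ⟨b', hb', ?_⟩
  funext y
  by_cases h : Nonempty (fib e y)
  · obtain ⟨x⟩ := h
    rw [hb y x, hb' y x]
    rfl
  · have : IsEmpty (fib e y) := not_nonempty_iff.1 h
    obtain ⟨m, s, h⟩ := A.loc_exists (b y)
    rw [h, A.eq_zero m, A.eq_zero (b' y)]
    refine Loc.mk_eq_mk.2 ⟨1, ?_⟩
    simp only [smul_zero]

theorem loc_subsingleton [IsEmpty X] (a b : (A.locData S).obj X) : a = b := by
  obtain ⟨m, s, rfl⟩ := A.loc_exists a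
  obtain ⟨n, t, rfl⟩ := A.loc_exists b
  rw [A.eq_zero m, A.eq_zero n]
  exact Loc.mk_eq_mk.2 ⟨1, by simp only [smul_zero]⟩

theorem exists_fam {Y Y' : Type} (k : Y ≃ Y') {P : Y' → Type u} (c : ∀ y, P (k y)) :
    ∃ c' : ∀ y', P y', ∀ y, c' (k y) = c y :=
  ⟨Equiv.piCongrLeft P k c, fun y => Equiv.piCongrLeft_apply_apply P k c y⟩

theorem exists_pfst {W : Type} [Finite W] (f : X → Option Y) (g : W → Option Y)
    (a : ∀ y, A.obj (fib g y)) : ∃ a' : ∀ x, A.obj (fib (pfst f g) x),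
      ∀ x y (h : f x = some y), a' x = A.tr (pfstEquiv h) (a y) := by
  have h : ∀ x, ∃ z : A.obj (fib (pfst f g) x),
      ∀ y (h : f x = some y), z = A.tr (pfstEquiv h) (a y) := by
    intro x
    obtain hx | ⟨y, hx⟩ : f x = none ∨ ∃ y, f x = some y := by cases f x <;> simp
    · exact ⟨A.zero _, fun y h => by simp [hx] at h⟩
    · refine ⟨A.tr (pfstEquiv hx) (a y), fun y' h => ?_⟩
      obtain rfl : y = y' := by simpa [hx] using h
      rfl
  choose a' ha using h
  exact ⟨a', ha⟩

theorem exists_psnd {W : Type} [Finite W] (f : X → Option Y) (g : W → Option Y)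
    (c : ∀ y, A.obj (fib f y)) : ∃ c' : ∀ w, A.obj (fib (psnd f g) w),
      ∀ w y (h : g w = some y), c' w = A.tr (psndEquiv h) (c y) := by
  have h : ∀ w, ∃ z : A.obj (fib (psnd f g) w),
      ∀ y (h : g w = some y), z = A.tr (psndEquiv h) (c y) := by
    intro w
    obtain hw | ⟨y, hw⟩ : g w = none ∨ ∃ y, g w = some y := by cases g w <;> simp
    · exact ⟨A.zero _, fun y h => by simp [hw] at h⟩
    · refine ⟨A.tr (psndEquiv hw) (c y), fun y' h => ?_⟩
      obtain rfl : y = y' := by simpa [hw] using h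
      rfl
  choose c' hc using h
  exact ⟨c', hc⟩

variable (S)

/-- The localization `S⁻¹A` of a generalized ring at a multiplicative set `S ⊆ A⁺_[1]`. -/
noncomputable def loc : GRing.{u} where
  toGRingData := A.locData S
  map_refl a := by
    obtain ⟨m, s, rfl⟩ := A.loc_exists a
    exact congrArg (Loc.mk · s) (A.map_refl m)
  map_trans e k a := by
    obtain ⟨m, s, rfl⟩ := A.loc_exists a
    exact congrArg (Loc.mk · s) (A.map_trans e k m)
  map_zero e := congrArg (Loc.mk · 1) (A.map_zero e)
  eq_zero a := by
    obtain ⟨m, s, rfl⟩ := A.loc_exists a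
    rw [A.eq_zero m]
    exact Loc.mk_eq_mk.2 ⟨1, by simp only [smul_zero]⟩
  mul_tr e k h a b b' hb := by
    obtain ⟨a, s, rfl⟩ := A.loc_exists a
    obtain ⟨b, t, rfl⟩ := A.loc_exists_fam b
    obtain ⟨c, hc⟩ := exists_fam (P := fun y' => A.obj (fib _ y')) k fun y => A.tr (fibCongr e k h y) (b y)
    have hb' : b' = fun y' => Loc.mk (c y') t := by
      funext y'
      obtain ⟨y, rfl⟩ := k.surjective y'
      rw [hb y, A.loc_tr, hc]
    rw [hb', A.loc_tr, A.loc_mul, A.loc_mul, A.loc_tr, A.mul_tr e k h a b c hc]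
  con_tr e k h a b b' hb := by
    obtain ⟨a, s, rfl⟩ := A.loc_exists a
    obtain ⟨b, t, rfl⟩ := A.loc_exists_fam b
    obtain ⟨c, hc⟩ := exists_fam (P := fun y' => A.obj (fib _ y')) k fun y => A.tr (fibCongr e k h y) (b y)
    have hb' : b' = fun y' => Loc.mk (c y') t := by
      funext y'
      obtain ⟨y, rfl⟩ := k.surjective y'
      rw [hb y, A.loc_tr, hc]
    rw [hb', A.loc_tr, A.loc_con, A.loc_con, A.loc_tr, A.con_tr e k h a b c hc]
  assoc g f a b e := by
    obtain ⟨a, s, rfl⟩ := A.loc_exists a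
    obtain ⟨b, t, rfl⟩ := A.loc_exists_fam b
    obtain ⟨e, r, rfl⟩ := A.loc_exists_fam e
    rw [A.loc_mulF, A.loc_mul, A.loc_mul, A.loc_mul, A.assoc, mul_assoc]
  one_mul a := by
    obtain ⟨a, s, rfl⟩ := A.loc_exists a
    refine (A.loc_mul (toPt _) A.one (fun i => A.tr (ptEquiv _ i) a) 1 s).trans ?_
    rw [A.one_mul, _root_.one_mul]
  con_ones e a b hb := by
    obtain ⟨a, s, rfl⟩ := A.loc_exists a
    obtain ⟨b, hb', rfl⟩ := A.loc_isOnes e b hb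
    rw [A.loc_con, A.con_ones e a b hb', _root_.mul_one]
    rfl
  mul_ones e a b hb := by
    obtain ⟨a, s, rfl⟩ := A.loc_exists a
    obtain ⟨b, hb', rfl⟩ := A.loc_isOnes e b hb
    rw [A.loc_mul, A.mul_ones e a b hb', _root_.mul_one]
    rfl
  left_adj g f d c a := by
    obtain ⟨d, s, rfl⟩ := A.loc_exists d
    obtain ⟨c, t, rfl⟩ := A.loc_exists_fam c
    obtain ⟨a, r, rfl⟩ := A.loc_exists_fam a
    rw [A.loc_mulF, A.loc_con, A.loc_con, A.loc_con, A.left_adj, mul_assoc, mul_comm t]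
  right_adj g f d c a := by
    obtain ⟨d, s, rfl⟩ := A.loc_exists d
    obtain ⟨c, t, rfl⟩ := A.loc_exists_fam c
    obtain ⟨a, r, rfl⟩ := A.loc_exists_fam a
    rw [A.loc_conF, A.loc_con, A.loc_mul, A.loc_con, A.right_adj, mul_assoc, mul_comm t]
  left_linear g f d c a := by
    obtain ⟨d, s, rfl⟩ := A.loc_exists d
    obtain ⟨c, t, rfl⟩ := A.loc_exists_fam c
    obtain ⟨a, r, rfl⟩ := A.loc_exists_fam a
    rw [A.loc_conF, A.loc_mul, A.loc_mul, A.loc_con, A.left_linear, mul_assoc]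
  right_linear f g d c a a' c' ha hc := by
    obtain ⟨d, s, rfl⟩ := A.loc_exists d
    obtain ⟨c, t, rfl⟩ := A.loc_exists_fam c
    obtain ⟨a, r, rfl⟩ := A.loc_exists_fam a
    obtain ⟨a₁, ha₁⟩ := A.exists_pfst f g a
    obtain ⟨c₁, hc₁⟩ := A.exists_psnd f g c
    have ha' : a' = fun x => Loc.mk (a₁ x) r := by
      funext x
      cases hx : f x with
      | none =>
        have : IsEmpty (fib (pfst f g) x) := ⟨fun p => by
          obtain ⟨⟨⟨x', w⟩, y, h1, h2⟩, h3⟩ := p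
          simp only [Option.some.injEq] at h3 h1
          rw [h3, hx] at h1
          simp at h1⟩
        exact A.loc_subsingleton _ _
      | some y =>
        rw [ha x y hx, A.loc_tr, ha₁ x y hx]
    have hc' : c' = fun w => Loc.mk (c₁ w) t := by
      funext w
      cases hw : g w with
      | none =>
        have : IsEmpty (fib (psnd f g) w) := ⟨fun p => by
          obtain ⟨⟨⟨x, w'⟩, y, h1, h2⟩, h3⟩ := p
          simp only [Option.some.injEq] at h3 h2
          rw [h3, hw] at h2
          simp at h2⟩
        exact A.loc_subsingleton _ _
      | some y =>
        rw [hc w y hw, A.loc_tr, hc₁ w y hw]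
    rw [ha', hc', A.loc_con, A.loc_mul, A.loc_mul, A.loc_con,
      A.right_linear f g d c a a₁ c₁ ha₁ hc₁, mul_assoc, mul_assoc, mul_comm t]

end Localization

end GRing

/-! ### `A`-sets -/

/-- `A`-sets: pointed sets `M` with an action `A_X × M^X × A_X → M` for each finite set `X`.
In the naturality axioms a family `m` on `Y` is pulled back along `f : X ⇀ Y`, with value the
distinguished point where `f` is not defined; `act_empty` is pointedness of the action. -/
structure ASet (A : GRing.{u}) where
  carrier : Type u
  zero : carrier
  act {X : Type} [Finite X] (b : A.obj X) (m : X → carrier) (d : A.obj X) : carrier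
  act_empty {X : Type} [Finite X] [IsEmpty X] (b : A.obj X) (m : X → carrier) (d : A.obj X) :
    act b m d = zero
  act_assoc {X Y : Type} [Finite X] [Finite Y] (f : X → Option Y) (b d : A.obj Y)
    (b' d' : ∀ y, A.obj (fib f y)) (m : X → carrier) :
    act (A.mul f b b') m (A.mul f d d') = act b (fun y => act (b' y) (fun i => m i.1) (d' y)) d
  act_unit (m : carrier) : act A.one (fun _ => m) A.one = m
  act_nat_right {X Y : Type} [Finite X] [Finite Y] (f : X → Option Y) (d : A.obj Y) (b : A.obj X)
    (a : ∀ y, A.obj (fib f y)) (m : Y → carrier) :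
    act b (fun i => (f i).elim zero m) (A.mul f d a) = act (A.con f b a) m d
  act_nat_left {X Y : Type} [Finite X] [Finite Y] (f : X → Option Y) (d : A.obj Y) (b : A.obj X)
    (a : ∀ y, A.obj (fib f y)) (m : Y → carrier) :
    act (A.mul f d a) (fun i => (f i).elim zero m) b = act d m (A.con f b a)
  act_comm {X Y : Type} [Finite X] [Finite Y] (b d : A.obj X) (b' d' : A.obj Y)
    (m : X × Y → carrier) :
    act (A.box d d') m (A.box b b') = act (A.box d' d) (fun p => m p.swap) (A.box b' b)

namespace ASet

variable {A : GRing.{u}}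

/-- Maps of `A`-sets. -/
@[ext]
structure Hom (M N : ASet A) where
  toFun : M.carrier → N.carrier
  map_zero : toFun M.zero = N.zero
  map_act {X : Type} [Finite X] (b : A.obj X) (m : X → M.carrier) (d : A.obj X) :
    toFun (M.act b m d) = N.act b (fun x => toFun (m x)) d

/-- The category of `A`-sets. -/
instance : Category (ASet A) where
  Hom := Hom
  id M := ⟨fun m => m, rfl, fun _ _ _ => rfl⟩
  comp φ ψ := ⟨fun m => ψ.toFun (φ.toFun m), by rw [φ.map_zero, ψ.map_zero],
    fun b m d => by rw [φ.map_act, ψ.map_act]⟩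

@[ext]
theorem hom_ext {M N : ASet A} (φ ψ : M ⟶ N) (h : ∀ m, φ.toFun m = ψ.toFun m) : φ = ψ :=
  Hom.ext (funext h)

@[simp] theorem id_toFun (M : ASet A) (m : M.carrier) : Hom.toFun (𝟙 M) m = m := rfl

@[simp] theorem comp_toFun {M N K : ASet A} (φ : M ⟶ N) (ψ : N ⟶ K) (m : M.carrier) :
    (φ ≫ ψ).toFun m = ψ.toFun (φ.toFun m) := rfl

theorem act_zero (M : ASet A) {X : Type} [Finite X] (b d : A.obj X) :
    M.act b (fun _ => M.zero) d = M.zero := by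
  let f : Empty → Option X := fun x => x.elim
  have h := M.act_assoc f b d (fun _ => A.zero _) (fun _ => A.zero _) (fun x => x.elim)
  rw [M.act_empty] at h
  refine Eq.trans ?_ h.symm
  congr 1
  funext y
  have : IsEmpty (fib f y) := ⟨fun x => x.1.elim⟩
  exact (M.act_empty (X := fib f y) _ _ _).symm

/-- The zero maps, constant with value the distinguished point. -/
instance : Limits.HasZeroMorphisms (ASet A) where
  zero _ N := ⟨⟨fun _ => N.zero, rfl, fun _ _ _ => (N.act_zero _ _).symm⟩⟩
  comp_zero _ _ := rfl
  zero_comp _ _ _ φ := hom_ext _ _ fun _ => φ.map_zero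

/-- Restriction of scalars `φ_*` along a homomorphism `φ : A → B`. -/
def restrictScalars {A B : GRing.{u}} (φ : A ⟶ B) : ASet B ⥤ ASet A where
  obj M :=
    { carrier := M.carrier
      zero := M.zero
      act := fun b m d => M.act (φ.app _ b) m (φ.app _ d)
      act_empty := fun _ _ _ => M.act_empty _ _ _
      act_assoc := fun f b d b' d' m => by rw [φ.app_mul, φ.app_mul, M.act_assoc]
      act_unit := fun m => by rw [φ.app_one, M.act_unit]
      act_nat_right := fun f d b a m => by rw [φ.app_mul, φ.app_con, M.act_nat_right]
      act_nat_left := fun f d b a m => by rw [φ.app_mul, φ.app_con, M.act_nat_left]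
      act_comm := fun b d b' d' m => by
        have h : ∀ {X Y : Type} [Finite X] [Finite Y] (a : A.obj X) (d : A.obj Y),
            φ.app _ (A.box a d) = B.box (φ.app _ a) (φ.app _ d) := by
          intro X Y _ _ a d
          refine (φ.app_mul _ _ _).trans ?_
          congr 1
          funext x
          exact φ.app_map _ _
        rw [h, h, h, h, M.act_comm] }
  map ψ := ⟨ψ.toFun, ψ.map_zero, fun _ _ _ => ψ.map_act _ _ _⟩

section Localization

variable (M : ASet A) {X Y : Type} [Finite X] [Finite Y]

theorem act_tr (e : X ≃ Y) (b d : A.obj X) (m : Y → M.carrier) :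
    M.act (A.tr e b) m (A.tr e d) = M.act b (fun x => m (e x)) d := by
  obtain ⟨u, hu⟩ := A.exists_isOnes e.toPEquiv
  have h := M.act_nat_right e.toPEquiv (A.tr e d) b u m
  rw [A.con_ones _ _ _ hu, A.mul_ones _ _ _ hu, ← Equiv.toPEquiv_symm] at h
  have h1 : A.map e.symm.toPEquiv (A.tr e d) = d := by
    refine (A.tr_tr e e.symm d).trans ?_
    rw [Equiv.self_trans_symm, A.tr_refl]
  rw [h1] at h
  exact h.symm

noncomputable instance : MulAction A.Sym M.carrier where
  smul s m := M.act s.1 (fun _ => m) A.one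
  one_smul m := M.act_unit m
  mul_smul s t m := by
    have h := M.act_assoc (toPt Unit) s.1 A.one (fun i => A.tr (ptEquiv Unit i) t.1)
      (fun i => A.tr (ptEquiv Unit i) A.one) (fun _ => m)
    simp only [act_tr] at h
    rw [A.one_mul] at h
    exact h

theorem smul_def (s : A.Sym) (m : M.carrier) : s • m = M.act s.1 (fun _ => m) A.one := rfl

theorem act_smul_left (s : A.Sym) (b d : A.obj X) (m : X → M.carrier) :
    M.act (s • b) m d = s • M.act b m d := by
  have h := M.act_assoc (toPt X) s.1 A.one (fun i => A.tr (ptEquiv X i) b)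
    (fun i => A.tr (ptEquiv X i) d) m
  simp only [act_tr] at h
  rw [A.one_mul] at h
  exact h

theorem act_smul_mid (s : A.Sym) (b d : A.obj X) (m : X → M.carrier) :
    M.act b (fun x => s • m x) d = s • M.act b m d := by
  rw [← act_smul_left]
  have h := M.act_assoc some b d (fun x => A.pt ⟨x, rfl⟩ s.1) (fun x => A.pt ⟨x, rfl⟩ A.one) m
  have h1 : A.mul some d (fun x => A.pt ⟨x, rfl⟩ A.one) = d := A.mul_pt_one d
  have h2 : A.mul some b (fun x => A.pt ⟨x, rfl⟩ s.1) = s • b := (A.sc_eq_rs s.1 b).symm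
  rw [h1, h2] at h
  rw [h]
  congr 1
  funext x
  have h3 : ∀ t : A.obj Unit, A.pt (X := fib (some : X → Option X) x) ⟨x, rfl⟩ t =
      A.tr (GRing.someEquiv x).symm t := fun t =>
    (A.tr_unit (GRing.someEquiv x).symm t).symm
  rw [h3, h3, act_tr]
  rfl

theorem act_smul_right (s : A.Sym) (b d : A.obj X) (m : X → M.carrier) :
    M.act b m (s • d) = s • M.act b m d := by
  rw [← act_smul_left]
  have h := M.act_nat_right some d b (fun x => A.pt ⟨x, rfl⟩ s.1) m
  have h1 : A.mul some d (fun x => A.pt ⟨x, rfl⟩ s.1) = s • d := (A.sc_eq_rs s.1 d).symm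
  have h2 : A.con some b (fun x => A.pt ⟨x, rfl⟩ s.1) = s • b := by
    refine (A.sc_star s.1 b).symm.trans ?_
    rw [s.2]
    rfl
  rw [h1, h2] at h
  exact h

theorem smul_zero (s : A.Sym) : s • M.zero = M.zero := M.act_zero _ _

variable (S : Submonoid A.Sym)

/-- The action on fractions. -/
noncomputable def locAct (b : Loc S (A.obj X)) (m : X → Loc S M.carrier)
    (d : Loc S (A.obj X)) : Loc S M.carrier :=
  Loc.mk (M.act (Loc.exists_rep b).choose (Loc.exists_common m).choose (Loc.exists_rep d).choose)
    ((Loc.exists_rep b).choose_spec.choose * (Loc.exists_common m).choose_spec.choose *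
      (Loc.exists_rep d).choose_spec.choose)

variable {S}

theorem locAct_mk (b d : A.obj X) (m : X → M.carrier) (s t r : S) :
    M.locAct S (Loc.mk b s) (fun x => Loc.mk (m x) t) (Loc.mk d r) =
      Loc.mk (M.act b m d) (s * t * r) := by
  have h := (Loc.exists_rep (Loc.mk b s)).choose_spec.choose_spec
  have h' := (Loc.exists_common fun x => (Loc.mk (m x) t : Loc S _)).choose_spec.choose_spec
  have h'' := (Loc.exists_rep (Loc.mk d r)).choose_spec.choose_spec
  rw [locAct]
  generalize (Loc.exists_rep (Loc.mk b s)).choose_spec.choose = s' at *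
  generalize (Loc.exists_rep (Loc.mk b s)).choose = b' at *
  generalize (Loc.exists_rep (Loc.mk d r)).choose_spec.choose = r' at *
  generalize (Loc.exists_rep (Loc.mk d r)).choose = d' at *
  generalize (Loc.exists_common fun x => (Loc.mk (m x) t : Loc S _)).choose_spec.choose = t' at *
  generalize (Loc.exists_common fun x => (Loc.mk (m x) t : Loc S _)).choose = m' at *
  obtain ⟨u, hu⟩ := Loc.mk_eq_mk.1 h
  obtain ⟨v, hv⟩ := Loc.exists_uniform h'
  obtain ⟨w, hw⟩ := Loc.mk_eq_mk.1 h''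
  rw [Loc.mk_eq_mk]
  refine ⟨u * v * w, ?_⟩
  have h1 : M.act (((u : A.Sym) * s) • b') (fun x => ((v : A.Sym) * t) • m' x)
      (((w : A.Sym) * r) • d') =
      M.act (((u : A.Sym) * s') • b) (fun x => ((v : A.Sym) * t') • m x)
        (((w : A.Sym) * r') • d) := by
    simp only [smul_smul] at hu hw
    simp only [hu, hv, hw]
  simp only [act_smul_left, act_smul_mid, act_smul_right, smul_smul] at h1
  simp only [Submonoid.coe_mul, smul_smul]
  have h2 : ∀ u v w s t r : A.Sym, u * v * w * (s * t * r) = w * r * (v * t * (u * s)) := by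
    intro u v w s t r
    simp only [mul_comm, mul_left_comm]
  have h3 : ∀ u v w s t r : A.Sym, w * r * (v * t * (u * s)) = u * s * (w * r) * (v * t) := by
    intro u v w s t r
    simp only [mul_comm, mul_left_comm]
  rw [h2, h2]
  simp only [mul_comm, mul_left_comm] at h1 ⊢
  exact h1

theorem loc_exists_fam {X : Type} [Finite X] (m : X → Loc S M.carrier) :
    ∃ (n : X → M.carrier) (s : S), m = fun x => Loc.mk (n x) s := by
  obtain ⟨n, s, h⟩ := Loc.exists_common (E := fun _ : X => M.carrier) m
  exact ⟨n, s, funext h⟩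

theorem loc_box (a : A.obj X) (d : A.obj Y) (s t : S) :
    (A.loc S).box (Loc.mk a s : Loc S (A.obj X)) (Loc.mk d t : Loc S (A.obj Y)) =
      (Loc.mk (A.box a d) (s * t) : Loc S (A.obj (X × Y))) :=
  A.loc_mul (fun p : X × Y => some p.1) a (fun x => A.tr (fstEquiv X Y x) d) s t

theorem loc_elim (f : X → Option Y) (m : Y → M.carrier) (s : S) :
    (fun i => (f i).elim (Loc.mk M.zero 1 : Loc S M.carrier) fun y => Loc.mk (m y) s) =
      fun i => Loc.mk ((f i).elim M.zero m) s := by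
  funext i
  cases f i with
  | none => exact Loc.mk_eq_mk.2 ⟨1, by simp only [Option.elim, smul_zero]⟩
  | some y => rfl

variable (S)

/-- The localization `S⁻¹M`, an `S⁻¹A`-set. -/
noncomputable def loc : ASet (A.loc S) where
  carrier := Loc S M.carrier
  zero := Loc.mk M.zero 1
  act b m d := M.locAct S b m d
  act_empty b m d := by
    obtain ⟨b, s, rfl⟩ := A.loc_exists b
    obtain ⟨d, t, rfl⟩ := A.loc_exists d
    obtain ⟨m, r, rfl⟩ := M.loc_exists_fam m
    rw [locAct_mk, M.act_empty]
    exact Loc.mk_eq_mk.2 ⟨1, by simp only [smul_zero]⟩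
  act_assoc f b d b' d' m := by
    obtain ⟨b, s, rfl⟩ := A.loc_exists b
    obtain ⟨d, t, rfl⟩ := A.loc_exists d
    obtain ⟨b', s', rfl⟩ := A.loc_exists_fam b'
    obtain ⟨d', t', rfl⟩ := A.loc_exists_fam d'
    obtain ⟨m, r, rfl⟩ := M.loc_exists_fam m
    have h1 := A.loc_mul f b b' s s'
    have h2 := A.loc_mul f d d' t t'
    refine Eq.trans (congrArg₂ (fun x y => M.locAct S x _ y) h1 h2) ?_
    simp only [locAct_mk, M.act_assoc]
    congr 1
    simp only [mul_comm, mul_left_comm]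
  act_unit m := by
    obtain ⟨m, s, rfl⟩ := Loc.exists_rep m
    refine (M.locAct_mk A.one A.one (fun _ => m) 1 s 1).trans ?_
    rw [M.act_unit, one_mul, mul_one]
  act_nat_right f d b a m := by
    obtain ⟨b, s, rfl⟩ := A.loc_exists b
    obtain ⟨d, t, rfl⟩ := A.loc_exists d
    obtain ⟨a, q, rfl⟩ := A.loc_exists_fam a
    obtain ⟨m, r, rfl⟩ := M.loc_exists_fam m
    have h1 := A.loc_mul f d a t q
    have h2 := A.loc_con f b a s q
    refine Eq.trans (congrArg₂ (fun x y => M.locAct S _ x y) (M.loc_elim f m r) h1) ?_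
    refine Eq.trans ?_ (congrArg (fun x => M.locAct S x _ _) h2.symm)
    simp only [locAct_mk, M.act_nat_right]
    congr 1
    simp only [mul_comm, mul_left_comm]
  act_nat_left f d b a m := by
    obtain ⟨b, s, rfl⟩ := A.loc_exists b
    obtain ⟨d, t, rfl⟩ := A.loc_exists d
    obtain ⟨a, q, rfl⟩ := A.loc_exists_fam a
    obtain ⟨m, r, rfl⟩ := M.loc_exists_fam m
    have h1 := A.loc_mul f d a t q
    have h2 := A.loc_con f b a s q
    refine Eq.trans (congrArg₂ (fun x y => M.locAct S y x _) (M.loc_elim f m r) h1) ?_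
    refine Eq.trans ?_ (congrArg (fun x => M.locAct S _ _ x) h2.symm)
    simp only [locAct_mk, M.act_nat_left]
    congr 1
    simp only [mul_comm, mul_left_comm]
  act_comm b d b' d' m := by
    obtain ⟨b, s, rfl⟩ := A.loc_exists b
    obtain ⟨d, t, rfl⟩ := A.loc_exists d
    obtain ⟨b', s', rfl⟩ := A.loc_exists b'
    obtain ⟨d', t', rfl⟩ := A.loc_exists d'
    obtain ⟨m, r, rfl⟩ := M.loc_exists_fam m
    rw [loc_box, loc_box, loc_box, loc_box]
    simp only [locAct_mk]
    rw [M.act_comm]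
    congr 1
    simp only [mul_comm]

/-- The map `S⁻¹M → S⁻¹N` induced by a map of `A`-sets. -/
noncomputable def locHom {M N : ASet A} (φ : M ⟶ N) : Loc S M.carrier → Loc S N.carrier :=
  Quotient.map' (s₁ := locSetoid S _) (s₂ := locSetoid S _) (fun p => (φ.toFun p.1, p.2)) (by
    rintro ⟨a, s⟩ ⟨b, t⟩ ⟨r, h⟩
    refine ⟨r, ?_⟩
    have h1 := congrArg φ.toFun h
    simpa only [smul_def, φ.map_act] using h1)

theorem locHom_mk {M N : ASet A} (φ : M ⟶ N) (m : M.carrier) (s : S) :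
    locHom S φ (Loc.mk m s) = Loc.mk (φ.toFun m) s := rfl

theorem locHom_act {M N : ASet A} (φ : M ⟶ N) (b d : (A.loc S).obj X)
    (m : X → Loc S M.carrier) :
    locHom S φ ((M.loc S).act b m d) = (N.loc S).act b (fun x => locHom S φ (m x)) d := by
  obtain ⟨b, s, rfl⟩ := A.loc_exists b
  obtain ⟨d, t, rfl⟩ := A.loc_exists d
  obtain ⟨m, r, rfl⟩ := M.loc_exists_fam m
  refine (congrArg (locHom S φ) (M.locAct_mk b d m s r t)).trans ?_
  refine Eq.trans ?_ (N.locAct_mk b d (fun x => φ.toFun (m x)) s r t).symm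
  rw [locHom_mk, φ.map_act]

end Localization

end ASet

/-! ### The spectrum -/

namespace GRing

variable (A : GRing.{u})

/-- Ideals of `A`: sub-`A`-sets of `A_[1]`. -/
structure IsIdeal (I : Set (A.obj Unit)) : Prop where
  zero_mem : A.zero Unit ∈ I
  act_mem {X : Type} [Finite X] (b d : A.obj X) (x : X → A.obj Unit) (hx : ∀ i, x i ∈ I) :
    A.act b x d ∈ I

/-- `+`ideals: ideals generated by their symmetric elements. -/
structure IsPlusIdeal (I : Set (A.obj Unit)) : Prop extends A.IsIdeal I where
  generated (J : Set (A.obj Unit)) (hJ : A.IsIdeal J) (h : ∀ a ∈ I, A.star a = a → a ∈ J) : I ⊆ J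

/-- The `+`primes of `A`: the `+`ideals `𝔭` such that `A⁺_[1] \ 𝔭` is a submonoid. -/
structure PlusPrime where
  carrier : Set (A.obj Unit)
  isPlusIdeal : A.IsPlusIdeal carrier
  one_notMem : A.one ∉ carrier
  mul_notMem (s t : A.Sym) (hs : s.1 ∉ carrier) (ht : t.1 ∉ carrier) : (s * t).1 ∉ carrier

variable {A}

theorem IsIdeal.mul_mem {I : Set (A.obj Unit)} (h : A.IsIdeal I) (s : A.Sym) {t : A.Sym}
    (ht : t.1 ∈ I) : (s * t).1 ∈ I := by
  have h1 := h.act_mem (X := Unit) s.1 A.one (fun _ => t.1) (fun _ => ht)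
  have h2 : A.act s.1 (fun _ : Unit => t.1) A.one = A.rc (A.rs s.1 t.1) A.one := by
    rw [act, rc]
    congr 1
    funext i
    exact A.tr_ptEquiv i _
  rw [h2, con_pt_one, ← sc_eq_rs_unit] at h1
  exact h1

namespace PlusPrime

/-- The submonoid `S_𝔭 = A⁺_[1] \ 𝔭`. -/
def compl (p : PlusPrime A) : Submonoid A.Sym where
  carrier := {s | s.1 ∉ p.carrier}
  one_mem' := p.one_notMem
  mul_mem' hs ht := p.mul_notMem _ _ hs ht

/-- The basic open sets `D⁺(s)`, for symmetric `s`. -/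
def D (s : A.Sym) : Set (PlusPrime A) := {p | s ∈ p.compl}

theorem D_one : D (1 : A.Sym) = Set.univ := Set.eq_univ_of_forall fun p => p.compl.one_mem

theorem mem_D_mul {s t : A.Sym} {p : PlusPrime A} : p ∈ D (s * t) ↔ p ∈ D s ∧ p ∈ D t := by
  constructor
  · intro h
    refine ⟨fun h1 => h ?_, fun h1 => h (p.isPlusIdeal.mul_mem s h1)⟩
    rw [mul_comm]
    exact p.isPlusIdeal.mul_mem t h1
  · rintro ⟨hs, ht⟩
    exact p.compl.mul_mem hs ht

/-- The topology with the sets `D⁺(s)` as a basis. -/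
instance : TopologicalSpace (PlusPrime A) where
  IsOpen U := ∀ p ∈ U, ∃ s : A.Sym, p ∈ D s ∧ D s ⊆ U
  isOpen_univ _ _ := ⟨1, by rw [D_one]; trivial, Set.subset_univ _⟩
  isOpen_inter U V hU hV := by
    rintro p ⟨h1, h2⟩
    obtain ⟨s, hs, hs'⟩ := hU p h1
    obtain ⟨t, ht, ht'⟩ := hV p h2
    exact ⟨s * t, mem_D_mul.2 ⟨hs, ht⟩, fun q hq =>
      ⟨hs' (mem_D_mul.1 hq).1, ht' (mem_D_mul.1 hq).2⟩⟩
  isOpen_sUnion U hU := by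
    rintro p ⟨V, hV, hp⟩
    obtain ⟨s, hs, hs'⟩ := hU V hV p hp
    exact ⟨s, hs, fun q hq => ⟨V, hV, hs' hq⟩⟩

/-- A function `σ` on `U` with `σ(𝔭) ∈ S_𝔭⁻¹E` is locally constant if every point of `U` has a
neighbourhood `D⁺(s) ⊆ U` on which `σ(𝔮) = m / s` for a fixed `m ∈ E`. -/
def IsLocConst {E : Type u} [MulAction A.Sym E] (U : Opens (PlusPrime A))
    (σ : ∀ p : U, Loc p.1.compl E) : Prop :=
  ∀ p : U, ∃ (s : A.Sym) (m : E) (h : ∀ q ∈ D s, q ∈ U), p.1 ∈ D s ∧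
    ∀ (q : PlusPrime A) (hq : q ∈ D s), σ ⟨q, h q hq⟩ = Loc.mk m ⟨s, hq⟩

/-- The locally constant sections over `U`. -/
def Sec (E : Type u) [MulAction A.Sym E] (U : Opens (PlusPrime A)) : Type u :=
  {σ : ∀ p : U, Loc p.1.compl E // IsLocConst U σ}

namespace Sec

variable {E : Type u} [MulAction A.Sym E] {U V : Opens (PlusPrime A)}

theorem ext {σ τ : Sec E U} (h : ∀ p, σ.1 p = τ.1 p) : σ = τ := Subtype.ext (funext h)

/-- Restriction of sections. -/
noncomputable def res (h : V ≤ U) (σ : Sec E U) : Sec E V :=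
  ⟨fun p => σ.1 ⟨p.1, h p.2⟩, fun p => by
    obtain ⟨s, m, h1, h2, h3⟩ := σ.2 ⟨p.1, h p.2⟩
    obtain ⟨t, ht, ht'⟩ := V.2 p.1 p.2
    refine ⟨t * s, t • m, fun q hq => ht' (mem_D_mul.1 hq).1, mem_D_mul.2 ⟨ht, h2⟩, fun q hq => ?_⟩
    refine (h3 q (mem_D_mul.1 hq).2).trans (Loc.mk_smul _ _ _ _ ?_).symm
    rfl⟩

/-- The section `𝔭 ↦ m / 1`. -/
noncomputable def const (U : Opens (PlusPrime A)) (m : E) : Sec E U :=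
  ⟨fun _ => Loc.mk m 1, fun p => by
    obtain ⟨t, ht, ht'⟩ := U.2 p.1 p.2
    exact ⟨t, t • m, ht', ht, fun q hq => (Loc.mk_smul _ _ _ _ (by simp)).symm⟩⟩

theorem exists_common {ι : Type} [Finite ι] {E : ι → Type u} [∀ i, MulAction A.Sym (E i)]
    (σ : ∀ i, Sec (E i) U) (p : U) :
    ∃ (s : A.Sym) (m : ∀ i, E i) (h : ∀ q ∈ D s, q ∈ U), p.1 ∈ D s ∧
      ∀ (q : PlusPrime A) (hq : q ∈ D s) (i : ι),
        (σ i).1 ⟨q, h q hq⟩ = Loc.mk (m i) ⟨s, hq⟩ := by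
  classical
  have := Fintype.ofFinite ι
  choose s m h1 h2 h3 using fun i => (σ i).2 p
  obtain ⟨t, ht, ht'⟩ := U.2 p.1 p.2
  choose u hu using fun i => Finset.dvd_prod_of_mem s (Finset.mem_univ i)
  have hs : ∀ i, t * ∏ i, s i = t * u i * s i := fun i => by
    rw [hu i, mul_assoc, mul_comm (u i)]
  refine ⟨t * ∏ i, s i, fun i => (t * u i) • m i, fun q hq => ht' (mem_D_mul.1 hq).1, ?_, ?_⟩
  · exact p.1.compl.mul_mem ht (p.1.compl.prod_mem fun i _ => h2 i)
  · intro q hq i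
    have hq' : q ∈ D (s i) := by
      rw [hs i] at hq
      exact (mem_D_mul.1 hq).2
    exact (h3 i q hq').trans (Loc.mk_smul _ _ _ _ (hs i)).symm

end Sec

end PlusPrime

open PlusPrime

variable (A) (U : Opens (PlusPrime A)) {X Y Z : Type} [Finite X] [Finite Y] [Finite Z]

/-- The operations on the sections of the structure sheaf, defined pointwise. -/
noncomputable def secData : GRingData.{u} where
  obj X _ := Sec (A.obj X) U
  map e σ := ⟨fun p => (A.loc p.1.compl).map e (σ.1 p), fun p => by
    obtain ⟨s, m, h1, h2, h3⟩ := σ.2 p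
    exact ⟨s, A.map e m, h1, h2, fun q hq =>
      congrArg ((A.loc q.compl).map e) (h3 q hq)⟩⟩
  zero X _ := Sec.const U (A.zero X)
  one := Sec.const U A.one
  mul f a b := ⟨fun p => (A.loc p.1.compl).mul f (a.1 p) fun y => (b y).1 p, fun p => by
    obtain ⟨s, m, h1, h2, h3⟩ := a.2 p
    obtain ⟨t, n, h1', h2', h3'⟩ := Sec.exists_common b p
    refine ⟨s * t, A.mul f m n, fun q hq => h1 q (mem_D_mul.1 hq).1, mem_D_mul.2 ⟨h2, h2'⟩,
      fun q hq => ?_⟩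
    simp only [h3 q (mem_D_mul.1 hq).1, h3' q (mem_D_mul.1 hq).2]
    exact A.loc_mul f m n _ _⟩
  con f c b := ⟨fun p => (A.loc p.1.compl).con f (c.1 p) fun y => (b y).1 p, fun p => by
    obtain ⟨s, m, h1, h2, h3⟩ := c.2 p
    obtain ⟨t, n, h1', h2', h3'⟩ := Sec.exists_common b p
    refine ⟨s * t, A.con f m n, fun q hq => h1 q (mem_D_mul.1 hq).1, mem_D_mul.2 ⟨h2, h2'⟩,
      fun q hq => ?_⟩
    simp only [h3 q (mem_D_mul.1 hq).1, h3' q (mem_D_mul.1 hq).2]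
    exact A.loc_con f m n _ _⟩

/-- The generalized ring `𝒪_A(U)`. -/
noncomputable def sec : GRing.{u} where
  toGRingData := A.secData U
  map_refl a := Sec.ext fun p => (A.loc p.1.compl).map_refl _
  map_trans e k a := Sec.ext fun p => (A.loc p.1.compl).map_trans e k _
  map_zero e := Sec.ext fun p => (A.loc p.1.compl).map_zero e
  eq_zero a := Sec.ext fun p => (A.loc p.1.compl).eq_zero _
  mul_tr e k h a b b' hb := Sec.ext fun p => (A.loc p.1.compl).mul_tr e k h _ _ _
    fun y => congrFun (congrArg Subtype.val (hb y)) p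
  con_tr e k h a b b' hb := Sec.ext fun p => (A.loc p.1.compl).con_tr e k h _ _ _
    fun y => congrFun (congrArg Subtype.val (hb y)) p
  assoc g f a b e := Sec.ext fun p => (A.loc p.1.compl).assoc g f _ _ _
  one_mul a := Sec.ext fun p => (A.loc p.1.compl).one_mul _
  con_ones e a b hb := Sec.ext fun p => (A.loc p.1.compl).con_ones e _ _
    fun y x => congrFun (congrArg Subtype.val (hb y x)) p
  mul_ones e a b hb := Sec.ext fun p => (A.loc p.1.compl).mul_ones e _ _
    fun y x => congrFun (congrArg Subtype.val (hb y x)) p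
  left_adj g f d c a := Sec.ext fun p => (A.loc p.1.compl).left_adj g f _ _ _
  right_adj g f d c a := Sec.ext fun p => (A.loc p.1.compl).right_adj g f (d.1 p)
    (fun y => (c y).1 p) (fun z => (a z).1 p)
  left_linear g f d c a := Sec.ext fun p => (A.loc p.1.compl).left_linear g f (d.1 p)
    (fun y => (c y).1 p) (fun z => (a z).1 p)
  right_linear f g d c a a' c' ha hc := Sec.ext fun p =>
    (A.loc p.1.compl).right_linear f g _ _ _ _ _
      (fun x y h => congrFun (congrArg Subtype.val (ha x y h)) p)
      (fun w y h => congrFun (congrArg Subtype.val (hc w y h)) p)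

/-- The canonical homomorphism `A → 𝒪_A(U)`. -/
noncomputable def toSec : A ⟶ A.sec U where
  app X _ a := Sec.const U a
  app_map _ _ := rfl
  app_zero _ _ := rfl
  app_one := rfl
  app_mul f a b := Sec.ext fun p => by
    refine Eq.trans ?_ (A.loc_mul f a b 1 1).symm
    rw [_root_.one_mul]
    rfl
  app_con f a b := Sec.ext fun p => by
    refine Eq.trans ?_ (A.loc_con f a b 1 1).symm
    rw [_root_.one_mul]
    rfl

/-- The affine generalized scheme `spec⁺(A)` with its structure sheaf `𝒪_A`. -/
noncomputable def spec : AlgebraicGeometry.PresheafedSpace GRing.{u} where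
  carrier := TopCat.of (PlusPrime A)
  presheaf :=
    { obj := fun U => A.sec U.unop
      map := fun h => ⟨fun _ _ σ => Sec.res h.unop.le σ, fun _ _ => rfl, fun _ _ => rfl, rfl,
        fun _ _ _ => rfl, fun _ _ _ => rfl⟩
      map_id := fun _ => rfl
      map_comp := fun _ _ => rfl }

end GRing

/-! ### Presheaves of `𝒪_X`-sets -/

open AlgebraicGeometry

/-- Presheaves of `𝒪_X`-sets on a space with a presheaf of generalized rings. -/
structure PreOSet (X : PresheafedSpace GRing.{u}) where
  obj (U : Opens X) : ASet (X.presheaf.obj (op U))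
  res {U V : Opens X} (h : V ≤ U) : (obj U).carrier → (obj V).carrier
  res_zero {U V : Opens X} (h : V ≤ U) : res h (obj U).zero = (obj V).zero
  res_act {U V : Opens X} (h : V ≤ U) {I : Type} [Finite I] (b : (X.presheaf.obj (op U)).obj I)
    (m : I → (obj U).carrier) (d : (X.presheaf.obj (op U)).obj I) :
    res h ((obj U).act b m d) = (obj V).act ((X.presheaf.map (homOfLE h).op).app I b)
      (fun i => res h (m i)) ((X.presheaf.map (homOfLE h).op).app I d)
  res_refl (U : Opens X) (m : (obj U).carrier) : res (le_refl U) m = m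
  res_res {U V W : Opens X} (h : V ≤ U) (h' : W ≤ V) (m : (obj U).carrier) :
    res h' (res h m) = res (h'.trans h) m

namespace PreOSet

variable {X : PresheafedSpace GRing.{u}}

/-- Maps of presheaves of `𝒪_X`-sets. -/
@[ext]
structure Hom (M N : PreOSet X) where
  app (U : Opens X) : M.obj U ⟶ N.obj U
  app_res {U V : Opens X} (h : V ≤ U) (m : (M.obj U).carrier) :
    (app V).toFun (M.res h m) = N.res h ((app U).toFun m)

/-- The category `pre-𝒪_X-Set`. -/
instance : Category (PreOSet X) where
  Hom := Hom
  id M := ⟨fun U => 𝟙 (M.obj U), fun _ _ => rfl⟩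
  comp φ ψ := ⟨fun U => φ.app U ≫ ψ.app U, fun h m => by
    simp only [ASet.comp_toFun, φ.app_res, ψ.app_res]⟩

@[ext]
theorem hom_ext {M N : PreOSet X} (φ ψ : M ⟶ N) (h : ∀ U, φ.app U = ψ.app U) : φ = ψ :=
  Hom.ext (funext h)

instance : Limits.HasZeroMorphisms (PreOSet X) where
  zero M N := ⟨⟨fun U => (0 : M.obj U ⟶ N.obj U), fun h _ => (N.res_zero h).symm⟩⟩
  comp_zero _ _ := rfl
  zero_comp _ _ _ φ := hom_ext _ _ fun U => Limits.zero_comp (f := φ.app U)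

/-- The sheaf condition. -/
def IsSheaf (M : PreOSet X) : Prop :=
  ∀ (ι : Type u) (U : Opens X) (V : ι → Opens X) (hV : ∀ i, V i ≤ U) (_ : U ≤ ⨆ i, V i)
    (m : ∀ i, (M.obj (V i)).carrier),
    (∀ i j, M.res (inf_le_left : V i ⊓ V j ≤ V i) (m i) =
      M.res (inf_le_right : V i ⊓ V j ≤ V j) (m j)) →
    ∃! n : (M.obj U).carrier, ∀ i, M.res (hV i) n = m i

/-- The restriction `M|_Y` along an open immersion `j : Y → X`, with sections `M(j(V))` over
`V ⊆ Y`, on which `𝒪_Y(V)` acts through `𝒪_Y(V) ≅ 𝒪_X(j(V))`. -/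
noncomputable def restrict {X Y : PresheafedSpace GRing.{u}} (j : Y ⟶ X)
    [PresheafedSpace.IsOpenImmersion j] : PreOSet X ⥤ PreOSet Y where
  obj M :=
    { obj := fun V => (ASet.restrictScalars (PresheafedSpace.IsOpenImmersion.invApp j V)).obj
        (M.obj ((PresheafedSpace.IsOpenImmersion.opensFunctor j).obj V))
      res := fun h => M.res ((PresheafedSpace.IsOpenImmersion.opensFunctor j).monotone h)
      res_zero := fun h => M.res_zero _
      res_act := fun {U V} h {I} _ b m d => by
        have hn := PresheafedSpace.IsOpenImmersion.inv_naturality j (homOfLE h).op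
        have hn' := fun b => congrArg (fun φ => GRing.Hom.app φ I b) hn
        refine (M.res_act _ _ _ _).trans ?_
        exact congrArg₂ (fun x y => (M.obj _).act x _ y) (hn' b).symm (hn' d).symm
      res_refl := fun V m => M.res_refl _ m
      res_res := fun h h' m => M.res_res _ _ m }
  map φ := ⟨fun V => (ASet.restrictScalars _).map (φ.app _), fun h m => φ.app_res _ m⟩

end PreOSet

namespace ASet

open GRing.PlusPrime

variable {A : GRing.{u}} (M : ASet A)

theorem sec_elim {Y : Type} (U : Opens (GRing.PlusPrime A)) (p : U)
    (m : Y → Sec M.carrier U) (o : Option Y) :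
    (o.elim (Sec.const U M.zero) m).1 p =
      o.elim (M.loc p.1.compl).zero fun y => (m y).1 p := by
  cases o <;> rfl

/-- The `𝒪_A(U)`-set `M^♮(U)`. -/
noncomputable def sec (U : Opens (GRing.PlusPrime A)) : ASet (A.sec U) where
  carrier := Sec M.carrier U
  zero := Sec.const U M.zero
  act b m d := ⟨fun p => (M.loc p.1.compl).act (b.1 p) (fun x => (m x).1 p) (d.1 p), fun p => by
    obtain ⟨s, b', h1, h2, h3⟩ := b.2 p
    obtain ⟨t, m', h1', h2', h3'⟩ := Sec.exists_common m p
    obtain ⟨r, d', h1'', h2'', h3''⟩ := d.2 p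
    refine ⟨s * t * r, M.act b' m' d', fun q hq => h1'' q (mem_D_mul.1 hq).2,
      mem_D_mul.2 ⟨mem_D_mul.2 ⟨h2, h2'⟩, h2''⟩, fun q hq => ?_⟩
    have hs : q ∈ D s := (mem_D_mul.1 (mem_D_mul.1 hq).1).1
    have ht : q ∈ D t := (mem_D_mul.1 (mem_D_mul.1 hq).1).2
    simp only [h3 q hs, h3' q ht, h3'' q (mem_D_mul.1 hq).2]
    exact M.locAct_mk b' d' m' _ _ _⟩
  act_empty b m d := Sec.ext fun p => (M.loc p.1.compl).act_empty _ _ _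
  act_assoc f b d b' d' m := Sec.ext fun p => (M.loc p.1.compl).act_assoc f _ _ _ _
    fun x => (m x).1 p
  act_unit m := Sec.ext fun p => (M.loc p.1.compl).act_unit _
  act_nat_right f d b a m := Sec.ext fun p => by
    refine Eq.trans ?_ ((M.loc p.1.compl).act_nat_right f (d.1 p) (b.1 p) (fun y => (a y).1 p)
      fun y => (m y).1 p)
    refine congrArg (fun x => (M.loc p.1.compl).act (b.1 p) x _) ?_
    exact funext fun i => M.sec_elim U p m (f i)
  act_nat_left f d b a m := Sec.ext fun p => by
    refine Eq.trans ?_ ((M.loc p.1.compl).act_nat_left f (d.1 p) (b.1 p) (fun y => (a y).1 p)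
      fun y => (m y).1 p)
    refine congrArg (fun x => (M.loc p.1.compl).act _ x (b.1 p)) ?_
    exact funext fun i => M.sec_elim U p m (f i)
  act_comm b d b' d' m := Sec.ext fun p => (M.loc p.1.compl).act_comm (b.1 p) (d.1 p) (b'.1 p)
    (d'.1 p) fun x => (m x).1 p

variable (A)

/-- The functor `M ↦ M^♮` from `A`-sets to presheaves of `𝒪_X`-sets on `X = spec⁺(A)`. -/
noncomputable def natural : ASet A ⥤ PreOSet A.spec where
  obj M :=
    { obj := fun U => M.sec U
      res := fun h σ => Sec.res h σ
      res_zero := fun _ => rfl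
      res_act := fun _ _ _ _ _ _ => rfl
      res_refl := fun _ _ => rfl
      res_res := fun _ _ _ => rfl }
  map {M N} φ :=
    ⟨fun U =>
      { toFun := fun σ => ⟨fun p => locHom p.1.compl φ (σ.1 p), fun p => by
          obtain ⟨s, m, h1, h2, h3⟩ := σ.2 p
          exact ⟨s, φ.toFun m, h1, h2, fun q hq => congrArg (locHom q.compl φ) (h3 q hq)⟩⟩
        map_zero := Sec.ext fun p => congrArg (Loc.mk · 1) φ.map_zero
        map_act := fun b m d => Sec.ext fun p => locHom_act p.1.compl φ _ _ _ },
      fun _ _ => rfl⟩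
  map_id M := by
    refine PreOSet.hom_ext _ _ fun U => hom_ext _ _ fun σ => Sec.ext fun p => ?_
    obtain ⟨m, s, h⟩ := Loc.exists_rep (σ.1 p)
    exact (congrArg (locHom p.1.compl (𝟙 M)) h).trans h.symm
  map_comp {M N K} φ ψ := by
    refine PreOSet.hom_ext _ _ fun U => hom_ext _ _ fun σ => Sec.ext fun p => ?_
    obtain ⟨m, s, h⟩ := Loc.exists_rep (σ.1 p)
    refine (congrArg (locHom p.1.compl (φ ≫ ψ)) h).trans ?_
    exact (congrArg (fun x => locHom p.1.compl ψ (locHom p.1.compl φ x)) h).symm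

/-- The global sections functor `M ↦ M(X)` for `X = spec⁺(A)`, where `A` acts on `M(X)` through
`A → 𝒪_X(X)`. -/
noncomputable def globalSections : PreOSet A.spec ⥤ ASet A where
  obj M := (restrictScalars (A.toSec ⊤)).obj (M.obj ⊤)
  map φ := (restrictScalars (A.toSec ⊤)).map (φ.app ⊤)

end ASet

instance {X Y : PresheafedSpace GRing.{u}} (j : Y ⟶ X) [PresheafedSpace.IsOpenImmersion j] :
    (PreOSet.restrict j).PreservesZeroMorphisms := ⟨fun _ _ => rfl⟩

instance (A : GRing.{u}) : (ASet.globalSections A).PreservesZeroMorphisms := ⟨fun _ _ => rfl⟩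

instance (A : GRing.{u}) : (ASet.natural A).PreservesZeroMorphisms := ⟨fun M N => by
  refine PreOSet.hom_ext _ _ fun U => ASet.hom_ext _ _ fun σ => GRing.PlusPrime.Sec.ext fun p => ?_
  obtain ⟨m, s, h⟩ := Loc.exists_rep (σ.1 p)
  refine (congrArg (ASet.locHom p.1.compl 0) h).trans ?_
  exact Loc.mk_eq_mk.2 ⟨1, by
    have h0 : ASet.Hom.toFun (0 : M ⟶ N) m = N.zero := rfl
    simp only [h0, ASet.smul_zero]⟩⟩

/-! ### Symmetric sequences and symmetric spectra -/

/-- The objects of the category `Σ. = ∐ₙ Σₙ` of finite bijections. -/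
structure SymIndex where
  n : ℕ

/-- The category `Σ. = ∐ₙ Σₙ` of finite bijections. -/
instance : Category SymIndex where
  Hom p q := Fin p.n ≃ Fin q.n
  id p := Equiv.refl (Fin p.n)
  comp σ τ := σ.trans τ

namespace SymIndex

/-- A bijection of finite sets as a morphism of `Σ.`. -/
def hom {p q : ℕ} (σ : Fin p ≃ Fin q) : (⟨p⟩ : SymIndex) ⟶ ⟨q⟩ := σ

/-- The block sum of two bijections. -/
def blockSum {p p' q q' : ℕ} (σ : Fin p ≃ Fin p') (τ : Fin q ≃ Fin q') :
    Fin (p + q) ≃ Fin (p' + q') :=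
  finSumFinEquiv.symm.trans ((σ.sumCongr τ).trans finSumFinEquiv)

end SymIndex

/-- Symmetric sequences of simplicial objects. -/
abbrev SymSeq (C : Type*) [Category C] := SymIndex ⥤ SimplicialObject C

open Simplicial in
/-- The `k`-simplices of the simplicial circle `Δ[1] / ∂Δ[1]` different from the base point: the
non-constant maps `k → [1]`. -/
abbrev CircleCell (k : SimplexCategory) : Type :=
  {f : k ⟶ ⦋1⦌ // ¬ ∃ c, ∀ j, f.toOrderHom j = c}

/-- The `k`-simplices of the sphere `Sᵖ = S¹ ∧ ⋯ ∧ S¹`, with `none` as the base point. -/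
abbrev Sphere (p : ℕ) (k : SimplexCategory) : Type := Option (Fin p → CircleCell k)

namespace Sphere

variable {p q r : ℕ} {k l m : SimplexCategory}

open Classical in
/-- The simplicial operators, coordinatewise; a simplex with a constant coordinate is the base
point. -/
noncomputable def pull (θ : k ⟶ l) (x : Sphere p l) : Sphere p k :=
  x.bind fun x =>
    if h : ∀ i, ¬ ∃ c, ∀ j, (θ ≫ (x i).1).toOrderHom j = c
    then some fun i => ⟨θ ≫ (x i).1, h i⟩ else none

/-- The permutation of the coordinates. -/
def perm (σ : Fin p ≃ Fin q) (x : Sphere p k) : Sphere q k := x.map fun x i => x (σ.symm i)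

/-- The isomorphism `Sᵖ ∧ S^q ≅ S^(p+q)`. -/
def smash (x : Sphere p k) (y : Sphere q k) : Sphere (p + q) k :=
  x.bind fun x => y.map fun y => Fin.append x y

/-- The simplex of `S⁰` different from the base point. -/
def unit (k : SimplexCategory) : Sphere 0 k := some fun i => i.elim0

theorem pull_eq_some (θ : k ⟶ l) (x : Sphere p l) (y : Fin p → CircleCell k) :
    pull θ x = some y ↔ ∃ x', x = some x' ∧ ∀ i, (y i).1 = θ ≫ (x' i).1 := by
  cases x with
  | none => simp [pull]
  | some x =>
    simp only [pull, Option.bind_some, Option.some.injEq, exists_eq_left']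
    constructor
    · intro h i
      split_ifs at h with h'
      simp only [Option.some.injEq] at h
      rw [← h]
    · intro h
      have h' : ∀ i, ¬ ∃ c, ∀ j, (θ ≫ (x i).1).toOrderHom j = c := fun i => by
        rw [← h i]; exact (y i).2
      rw [dif_pos h']
      exact congrArg some (funext fun i => Subtype.ext (h i).symm)

theorem pull_id (x : Sphere p k) : pull (𝟙 k) x = x := by
  refine Option.ext fun y => (pull_eq_some _ _ _).trans ?_
  constructor
  · rintro ⟨x', rfl, h⟩
    exact congrArg some (funext fun i => Subtype.ext ((h i).trans (Category.id_comp _)).symm)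
  · rintro rfl
    exact ⟨y, rfl, fun i => (Category.id_comp _).symm⟩

theorem pull_comp (θ : k ⟶ l) (η : l ⟶ m) (x : Sphere p m) :
    pull (θ ≫ η) x = pull θ (pull η x) := by
  refine Option.ext fun y => (pull_eq_some _ _ _).trans (Iff.trans ?_ (pull_eq_some _ _ _).symm)
  constructor
  · rintro ⟨x', rfl, h⟩
    have h' : ∀ i, ¬ ∃ c, ∀ j, (η ≫ (x' i).1).toOrderHom j = c := by
      rintro i ⟨c, hc⟩
      refine (y i).2 ⟨c, fun j => ?_⟩
      rw [h i, Category.assoc]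
      exact hc (θ.toOrderHom j)
    exact ⟨fun i => ⟨η ≫ (x' i).1, h' i⟩, (pull_eq_some _ _ _).2 ⟨x', rfl, fun _ => rfl⟩,
      fun i => (h i).trans (Category.assoc _ _ _)⟩
  · rintro ⟨z, hz, h⟩
    obtain ⟨x', rfl, h'⟩ := (pull_eq_some _ _ _).1 hz
    exact ⟨x', rfl, fun i => by rw [h i, h' i, Category.assoc]⟩

theorem pull_perm (θ : k ⟶ l) (σ : Fin p ≃ Fin q) (x : Sphere p l) :
    pull θ (perm σ x) = perm σ (pull θ x) := by
  refine Option.ext fun y => (pull_eq_some _ _ _).trans ?_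
  simp only [perm, Option.map_eq_some_iff, pull_eq_some]
  constructor
  · rintro ⟨_, ⟨x', rfl, rfl⟩, h⟩
    refine ⟨fun i => y (σ i), ⟨x', rfl, fun i => ?_⟩, funext fun i => ?_⟩
    · refine (h (σ i)).trans ?_
      simp only [Equiv.symm_apply_apply]
    · simp only [Equiv.apply_symm_apply]
  · rintro ⟨y', ⟨x', rfl, h⟩, rfl⟩
    exact ⟨_, ⟨x', rfl, rfl⟩, fun i => h _⟩

end Sphere

/-- The sphere spectrum `S.`, a symmetric sequence of pointed simplicial sets. -/
noncomputable def sphere : SymSeq Pointed.{0} where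
  obj p :=
    { obj := fun k => ⟨Sphere p.n k.unop, none⟩
      map := fun θ => ⟨Sphere.pull θ.unop, rfl⟩
      map_id := fun k => Pointed.Hom.ext (funext fun x => Sphere.pull_id x)
      map_comp := fun θ η => Pointed.Hom.ext (funext fun x =>
        Sphere.pull_comp η.unop θ.unop x) }
  map {p q} σ :=
    { app := fun k => ⟨fun x => Sphere.perm (p := p.n) (q := q.n) σ x, rfl⟩
      naturality := fun k l θ => Pointed.Hom.ext (funext fun x =>
        (Sphere.pull_perm θ.unop (p := p.n) (q := q.n) σ x).symm) }
  map_id p := NatTrans.ext (funext fun k => Pointed.Hom.ext (funext fun x => by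
    cases x <;> rfl))
  map_comp σ τ := NatTrans.ext (funext fun k => Pointed.Hom.ext (funext fun x => by
    cases x <;> rfl))

/-- Symmetric spectra: symmetric sequences `M` with an associative, unital and
`Σ_p × Σ_q`-equivariant action `Sᵖ ∧ M^q → M^(p+q)`. The degree `k` part of `Sᵖ ∧ M^q` is the
coproduct of copies of `M^q_k` indexed by the `k`-simplices of `Sᵖ` different from the base point,
so that such an action consists of maps `M^q_k → M^(p+q)_k` indexed by the simplices of `Sᵖ`, with
the zero map at the base point. -/
structure SymSpec (C : Type*) [Category C] [Limits.HasZeroMorphisms C] where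
  seq : SymSeq C
  act {p q : ℕ} {k : SimplexCategory} (x : ((sphere.obj ⟨p⟩).obj (op k)).X) :
    (seq.obj ⟨q⟩).obj (op k) ⟶ (seq.obj ⟨p + q⟩).obj (op k)
  act_point (p q : ℕ) (k : SimplexCategory) :
    act (q := q) ((sphere.obj ⟨p⟩).obj (op k)).point = 0
  act_simplicial {p q : ℕ} {k l : SimplexCategory} (θ : k ⟶ l)
    (x : ((sphere.obj ⟨p⟩).obj (op l)).X) :
    act (q := q) x ≫ (seq.obj ⟨p + q⟩).map θ.op =
      (seq.obj ⟨q⟩).map θ.op ≫ act (((sphere.obj ⟨p⟩).map θ.op).toFun x)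
  act_equivariant {p p' q q' : ℕ} {k : SimplexCategory} (σ : Fin p ≃ Fin p') (τ : Fin q ≃ Fin q')
    (x : ((sphere.obj ⟨p⟩).obj (op k)).X) :
    act x ≫ (seq.map (SymIndex.hom (SymIndex.blockSum σ τ))).app (op k) =
      (seq.map (SymIndex.hom τ)).app (op k) ≫
        act (((sphere.map (SymIndex.hom σ)).app (op k)).toFun x)
  act_unit (q : ℕ) (k : SimplexCategory) :
    act (Sphere.unit k) = (seq.map (SymIndex.hom (finCongr (Nat.zero_add q).symm))).app (op k)
  act_assoc {p q r : ℕ} {k : SimplexCategory} (x : ((sphere.obj ⟨p⟩).obj (op k)).X)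
    (y : ((sphere.obj ⟨q⟩).obj (op k)).X) :
    act (q := r) y ≫ act x =
      act (Sphere.smash x y) ≫ (seq.map (SymIndex.hom (finCongr (Nat.add_assoc p q r)))).app (op k)

namespace SymSpec

section

variable {C : Type*} [Category C] [Limits.HasZeroMorphisms C]

/-- Maps of symmetric spectra: the maps of symmetric sequences that preserve the action. -/
@[ext]
structure Hom (M N : SymSpec C) where
  toSeq : M.seq ⟶ N.seq
  comm {p q : ℕ} {k : SimplexCategory} (x : ((sphere.obj ⟨p⟩).obj (op k)).X) :
    M.act x ≫ (toSeq.app ⟨p + q⟩).app (op k) = (toSeq.app ⟨q⟩).app (op k) ≫ N.act x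

/-- The category of symmetric spectra. -/
instance : Category (SymSpec C) where
  Hom := Hom
  id M := ⟨𝟙 M.seq, fun x => by
    simp only [NatTrans.id_app, Category.comp_id, Category.id_comp]⟩
  comp φ ψ := ⟨φ.toSeq ≫ ψ.toSeq, fun x => by
    simp only [NatTrans.comp_app, Category.assoc, ← ψ.comm, reassoc_of% φ.comm x]⟩
  id_comp φ := Hom.ext (Category.id_comp _)
  comp_id φ := Hom.ext (Category.comp_id _)
  assoc φ ψ χ := Hom.ext (Category.assoc _ _ _)

end

/-- The functor on symmetric spectra induced by a functor that preserves zero maps. -/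
def mapSpec {C D : Type*} [Category C] [Limits.HasZeroMorphisms C] [Category D]
    [Limits.HasZeroMorphisms D] (F : C ⥤ D) [F.PreservesZeroMorphisms] :
    SymSpec C ⥤ SymSpec D where
  obj M :=
    { seq := M.seq ⋙ (SimplicialObject.whiskering C D).obj F
      act := fun x => F.map (M.act x)
      act_point := fun p q k => (congrArg F.map (M.act_point p q k)).trans (F.map_zero _ _)
      act_simplicial := fun θ x =>
        (F.map_comp _ _).symm.trans ((congrArg F.map (M.act_simplicial θ x)).trans (F.map_comp _ _))
      act_equivariant := fun σ τ x =>
        (F.map_comp _ _).symm.trans ((congrArg F.map (M.act_equivariant σ τ x)).trans (F.map_comp _ _))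
      act_unit := fun q k => congrArg F.map (M.act_unit q k)
      act_assoc := fun x y =>
        (F.map_comp _ _).symm.trans ((congrArg F.map (M.act_assoc x y)).trans (F.map_comp _ _)) }
  map φ := ⟨Functor.whiskerRight φ.toSeq _, fun x =>
    (F.map_comp _ _).symm.trans ((congrArg F.map (φ.comm x)).trans (F.map_comp _ _))⟩
  map_id M := Hom.ext (Functor.whiskerRight_id _)
  map_comp φ ψ := Hom.ext (Functor.whiskerRight_comp _ _ _)

end SymSpec

/-! ### Quasi-coherence -/

/-- `P` holds on the members of a covering of `X` by open affines `spec⁺(B)`. -/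
def HasAffineCover (X : PresheafedSpace GRing.{u})
    (P : ∀ (B : GRing.{u}) (j : B.spec ⟶ X) [PresheafedSpace.IsOpenImmersion j], Prop) : Prop :=
  ∀ x : X, ∃ (B : GRing.{u}) (j : B.spec ⟶ X) (_ : PresheafedSpace.IsOpenImmersion j),
    B.IsComm ∧ x ∈ Set.range j.base ∧ P B j

/-- The prolongation of a functor to symmetric sequences of simplicial objects. -/
abbrev mapSeq {C D : Type*} [Category C] [Category D] (F : C ⥤ D) : SymSeq C ⥤ SymSeq D :=
  (Functor.whiskeringRight SymIndex _ _).obj ((SimplicialObject.whiskering C D).obj F)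

section QuasiCoherent

variable (X : PresheafedSpace GRing.{u})

/-- Quasi-coherent `𝒪_X`-sets. -/
def qcSet : ObjectProperty (PreOSet X) := fun M =>
  M.IsSheaf ∧ HasAffineCover X fun B j _ =>
    ∃ N : ASet B, Nonempty ((PreOSet.restrict j).obj M ≅ (ASet.natural B).obj N)

/-- Quasi-coherent simplicial `𝒪_X`-sets. -/
def qcSimplicial : ObjectProperty (SimplicialObject (PreOSet X)) := fun M =>
  (∀ k, (M.obj k).IsSheaf) ∧ HasAffineCover X fun B j _ =>
    ∃ N : SimplicialObject (ASet B),
      Nonempty (((SimplicialObject.whiskering _ _).obj (PreOSet.restrict j)).obj M ≅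
        ((SimplicialObject.whiskering _ _).obj (ASet.natural B)).obj N)

/-- Quasi-coherent symmetric sequences of simplicial `𝒪_X`-sets. -/
def qcSymSeq : ObjectProperty (SymSeq (PreOSet X)) := fun M =>
  (∀ n k, ((M.obj n).obj k).IsSheaf) ∧ HasAffineCover X fun B j _ =>
    ∃ N : SymSeq (ASet B),
      Nonempty ((mapSeq (PreOSet.restrict j)).obj M ≅ (mapSeq (ASet.natural B)).obj N)

/-- Quasi-coherent `S_{𝒪_X}`-modules. -/
def qcSymSpec : ObjectProperty (SymSpec (PreOSet X)) := fun M =>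
  (∀ n k, ((M.seq.obj n).obj k).IsSheaf) ∧ HasAffineCover X fun B j _ =>
    ∃ N : SymSpec (ASet B),
      Nonempty ((SymSpec.mapSpec (PreOSet.restrict j)).obj M ≅
        (SymSpec.mapSpec (ASet.natural B)).obj N)

end QuasiCoherent

/-! ### Ideals and primes -/

/-! The argument is the classical one for quasi-coherent modules on an affine scheme, carried out
without addition. Wherever commutative algebra writes a power of `b` as a sum `∑ cᵢ sᵢ`, the proof
considers the set of all `a` in `A_[1]` with a suitable property, checks that this set is an ideal
containing the `sᵢ`, and concludes that it contains a power of `b`. That conclusion,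
`exists_pow_mem`, rests on a Zorn construction of `+`primes (`exists_plusPrime`), which also makes
every `D⁺(b)` quasi-compact.

For an `A`-set `N` this gives two facts. Elements with equal images in all localizations at points
of `D⁺(b)` agree after multiplication by a power of `b` (`ASet.exists_pow_smul_eq`), and every
section of `N^♮` over `D⁺(b)` is a single fraction `m / b ^ n` (`ASet.exists_eq_mk`). With `b = 1`
they show that `N` is the set of global sections of `N^♮`.

Conversely, let `F` be quasi-coherent on `X = spec⁺(A)`. The main point is that `F(D⁺(f))` is the
localization of `F(X)` at the powers of `f`: sections that agree on `D⁺(f)` agree after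
multiplication by a power of `f`, and sections over `D⁺(f)` extend to `X` after such a
multiplication. Both are checked in charts, where `f` becomes a fraction `c / b` of symmetric
elements and the two facts above apply, and are then carried to `X` by finite coverings and the
sheaf axiom. A section `n` of `F` near `p` thus satisfies `s • n = m` for some global `m` and some
`s` outside of `p`, and `n ↦ m / s` is an isomorphism from `F` to `F(X)^♮` (`toSections`).

The unit and counit isomorphisms are natural, and both functors preserve zero maps, so they can be
applied in each degree and level. A quasi-coherent simplicial object, symmetric sequence or spectrum
is quasi-coherent in each degree and level, and `M^♮` is quasi-coherent by means of the identity
chart; `exists_equivalence` turns this into the four equivalences. -/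

theorem ASet.act_act {A : GRing.{u}} (M : ASet A) {X : Type} [Finite X] (b d : A.obj X)
    (x : X → A.obj Unit) (m : M.carrier) :
    M.act (A.act b x d) (fun _ => m) A.one =
      M.act b (fun i => M.act (x i) (fun _ => m) A.one) d := by
  -- Naturality along `X → [1]` removes the contraction by `d`, and associativity along the identity
  -- of `X`, with units on the right, removes the multiplication by the family `x`. Thus `a ↦ ⟨a, m,
  -- 1⟩` respects the action, which is what makes conditions on `a` such as `⟨a, m, 1⟩ = ⟨a, m', 1⟩`
  -- define ideals.
  have h := M.act_nat_right (toPt X) A.one (A.mul some b fun i => A.pt ⟨i, rfl⟩ (x i))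
    (fun i => A.tr (ptEquiv X i) d) (fun _ => m)
  rw [A.one_mul] at h
  refine h.symm.trans ?_
  have h' := M.act_assoc some b d (fun i => A.pt ⟨i, rfl⟩ (x i)) (fun i => A.pt ⟨i, rfl⟩ A.one)
    (fun _ => m)
  have h1 : A.mul some d (fun i => A.pt ⟨i, rfl⟩ A.one) = d := A.mul_pt_one d
  rw [h1] at h'
  refine h'.trans ?_
  congr 1
  funext i
  have h3 : ∀ t : A.obj Unit, A.pt (X := fib (some : X → Option X) i) ⟨i, rfl⟩ t =
      A.tr (GRing.someEquiv i).symm t := fun t =>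
    (A.tr_unit (GRing.someEquiv i).symm t).symm
  rw [h3, h3, M.act_tr]

namespace GRing

variable {A : GRing.{u}}

theorem sc_act (s : A.obj Unit) {X : Type} [Finite X] (b d : A.obj X) (x : X → A.obj Unit) :
    A.sc s (A.act b x d) = A.act b (fun i => A.sc s (x i)) d := by
  unfold act
  rw [← con_sc_left, ← mul_sc_right]
  congr 2
  funext i
  exact (A.map_sc _ _ _).symm

/-- The colon ideal of `J` by `s`: multiplication by a scalar commutes with the action on `A_[1]`.
It supplies the larger ideal in the maximality argument for primes. -/
theorem IsIdeal.preimage {J : Set (A.obj Unit)} (hJ : A.IsIdeal J) (s : A.obj Unit) :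
    A.IsIdeal {a | A.sc s a ∈ J} where
  zero_mem := by
    change A.sc s (A.zero Unit) ∈ J
    rw [sc_zero]
    exact hJ.zero_mem
  act_mem b d x hx := by
    change A.sc s (A.act b x d) ∈ J
    rw [sc_act]
    exact hJ.act_mem b d _ hx

theorem IsIdeal.sc_mem {J : Set (A.obj Unit)} (hJ : A.IsIdeal J) (s : A.obj Unit) {t : A.obj Unit}
    (ht : t ∈ J) : A.sc s t ∈ J := by
  have h1 := hJ.act_mem (X := Unit) s A.one (fun _ => t) (fun _ => ht)
  have h2 : A.act s (fun _ : Unit => t) A.one = A.rc (A.rs s t) A.one := by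
    rw [act, rc]
    congr 1
    funext i
    exact A.tr_ptEquiv i _
  rwa [h2, con_pt_one, ← sc_eq_rs_unit] at h1

/-- An action takes only finitely many arguments from the ideal, so by directedness they lie in one
member of the family. -/
theorem IsIdeal.sUnion {c : Set (Set (A.obj Unit))} (hc : DirectedOn (· ⊆ ·) c)
    (hne : c.Nonempty) (h : ∀ J ∈ c, A.IsIdeal J) : A.IsIdeal (⋃₀ c) where
  zero_mem := by
    obtain ⟨J, hJ⟩ := hne
    exact ⟨J, hJ, (h J hJ).zero_mem⟩
  act_mem {X} _ b d x hx := by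
    choose J hJ hxJ using hx
    classical
    have := Fintype.ofFinite X
    obtain ⟨K, hK, hle⟩ := hc.exists_mem_subset_of_finset_subset_biUnion (s := Finset.univ.image x)
      hne (by
        intro a ha
        obtain ⟨i, -, rfl⟩ := Finset.mem_image.1 ha
        exact Set.mem_biUnion (hJ i) (hxJ i))
    exact ⟨K, hK, (h K hK).act_mem b d x fun i => hle (by simp)⟩

/-- The ideal generated by a set. -/
def idealSpan (G : Set (A.obj Unit)) : Set (A.obj Unit) :=
  {a | ∀ J, A.IsIdeal J → G ⊆ J → a ∈ J}

theorem isIdeal_idealSpan (G : Set (A.obj Unit)) : A.IsIdeal (idealSpan G) where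
  zero_mem _ hJ _ := hJ.zero_mem
  act_mem b d x hx J hJ hG := hJ.act_mem b d x fun i => hx i J hJ hG

theorem subset_idealSpan (G : Set (A.obj Unit)) : G ⊆ idealSpan G := fun _ ha _ _ hG => hG ha

theorem idealSpan_mono {G G' : Set (A.obj Unit)} (h : G ⊆ G') : idealSpan G ⊆ idealSpan G' :=
  fun _ ha J hJ hG => ha J hJ (h.trans hG)

/-- An ideal that contains no power of `b` is contained, as far as symmetric elements are concerned,
in a `+`prime not containing `b`. -/
theorem exists_plusPrime {K : Set (A.obj Unit)} (hK : A.IsIdeal K) (b : A.Sym)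
    (hb : ∀ n : ℕ, (b ^ n).1 ∉ K) :
    ∃ p : PlusPrime A, p ∈ PlusPrime.D b ∧ ∀ s : A.Sym, s.1 ∈ K → s.1 ∈ p.carrier := by
  obtain ⟨J, hKJ, hJ⟩ := zorn_subset_nonempty
    {J : Set (A.obj Unit) | A.IsIdeal J ∧ ∀ n : ℕ, (b ^ n).1 ∉ J} (by
      intro c hc hchain hne
      refine ⟨⋃₀ c, ⟨IsIdeal.sUnion hchain.directedOn hne fun J hJ => (hc hJ).1, ?_⟩,
        fun J hJ => Set.subset_sUnion_of_mem hJ⟩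
      rintro n ⟨J, hJ, h⟩
      exact (hc hJ).2 n h) K ⟨hK, hb⟩
  -- If `t * s` is in `J` and `s` is not, the colon ideal of `J` by `t` is strictly larger than `J`,
  -- so by maximality it contains a power of `b`.
  have hmax : ∀ s t : A.Sym, s.1 ∉ J → (t * s).1 ∈ J → ∃ n : ℕ, (t * b ^ n).1 ∈ J := by
    intro s t hs hst
    by_contra! h
    have := hJ.eq_of_subset (t := {a | A.sc t.1 a ∈ J}) ⟨hJ.prop.1.preimage t.1, h⟩
      fun a ha => hJ.prop.1.sc_mem t.1 ha
    exact hs (this ▸ hst)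
  -- `J` need not be generated by symmetric elements. The ideal `P` generated by those of `J` has
  -- the same symmetric elements as `J`, and primality, the avoidance of `b` and the containment to
  -- be shown concern only these.
  let P := idealSpan {a | a ∈ J ∧ A.star a = a}
  have hPJ : P ⊆ J := fun a ha => ha J hJ.prop.1 fun _ h => h.1
  have hmem : ∀ s : A.Sym, s.1 ∈ P ↔ s.1 ∈ J := fun s =>
    ⟨fun h => hPJ h, fun h => subset_idealSpan _ ⟨h, s.2⟩⟩
  refine ⟨⟨P, ⟨isIdeal_idealSpan _, ?_⟩, ?_, ?_⟩, ?_, ?_⟩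
  · intro I hI h a ha
    exact ha I hI fun s hs => h s (subset_idealSpan _ hs) hs.2
  · intro h
    exact hJ.prop.2 0 (by rw [pow_zero]; exact hPJ h)
  · intro s t hs ht hst
    rw [hmem] at hs ht hst
    -- Two uses of maximality replace first `t`, then `s`, by a power of `b`, so that a power of `b`
    -- would lie in `J`.
    obtain ⟨n, hn⟩ := hmax t s ht hst
    obtain ⟨m, hm⟩ := hmax s (b ^ n) hs (by rwa [mul_comm])
    rw [← pow_add] at hm
    exact hJ.prop.2 _ hm
  · intro h
    exact hJ.prop.2 1 (by simpa using hPJ h)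
  · intro s hs
    exact (hmem s).2 (hKJ hs)

/-- The elements that lie in the span of some finite part of `G` form an ideal, since each action
involves finitely many elements; this ideal contains `G`, hence the whole span. -/
theorem exists_finset_idealSpan {G : Set (A.obj Unit)} {a : A.obj Unit} (ha : a ∈ idealSpan G) :
    ∃ F : Set (A.obj Unit), F ⊆ G ∧ F.Finite ∧ a ∈ idealSpan F := by
  refine ha {a | ∃ F : Set (A.obj Unit), F ⊆ G ∧ F.Finite ∧ a ∈ idealSpan F} ⟨?_, ?_⟩ ?_
  · exact ⟨∅, Set.empty_subset _, Set.finite_empty, (isIdeal_idealSpan _).zero_mem⟩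
  · intro X _ b d x hx
    choose F hF hfin hxF using hx
    exact ⟨⋃ i, F i, Set.iUnion_subset hF, Set.finite_iUnion hfin,
      (isIdeal_idealSpan _).act_mem b d x fun i => idealSpan_mono (Set.subset_iUnion F i) (hxF i)⟩
  · intro g hg
    exact ⟨{g}, by simpa using hg, Set.finite_singleton g, subset_idealSpan _ rfl⟩

/-! ### The Nullstellensatz and quasi-compactness of the basic open sets -/

namespace PlusPrime

theorem isOpen_D (s : A.Sym) : IsOpen (D s) := fun _ hp => ⟨s, hp, subset_rfl⟩

/-- The basic open set `D⁺(s)`. -/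
def Dop (s : A.Sym) : Opens (PlusPrime A) := ⟨D s, isOpen_D s⟩

theorem mem_Dop_mul {s t : A.Sym} {p : PlusPrime A} : p ∈ Dop (s * t) ↔ p ∈ Dop s ∧ p ∈ Dop t :=
  mem_D_mul

theorem Dop_mul (s t : A.Sym) : Dop (s * t) = Dop s ⊓ Dop t := by
  ext p
  exact mem_D_mul

theorem Dop_one : Dop (1 : A.Sym) = ⊤ := by
  ext p
  exact iff_of_true p.compl.one_mem trivial

theorem mem_Dop_of_dvd {s t : A.Sym} (h : s ∣ t) {p : PlusPrime A} (hp : p ∈ Dop t) :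
    p ∈ Dop s := by
  obtain ⟨r, rfl⟩ := h
  exact (mem_Dop_mul.1 hp).1

theorem exists_Dop {U : Opens (PlusPrime A)} {p : PlusPrime A} (hp : p ∈ U) :
    ∃ s : A.Sym, p ∈ Dop s ∧ Dop s ≤ U := U.2 p hp

/-- If the symmetric elements `s i` lie in no common `+`prime of `D⁺(b)`, then a power of `b` is in
every ideal that contains all of them. -/
theorem exists_pow_mem {ι : Type*} (b : A.Sym) (s : ι → A.Sym)
    (h : ∀ p ∈ Dop b, ∃ i, p ∈ Dop (s i)) {K : Set (A.obj Unit)} (hK : A.IsIdeal K)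
    (hs : ∀ i, (s i).1 ∈ K) : ∃ n : ℕ, (b ^ n).1 ∈ K := by
  by_contra! hb
  obtain ⟨p, hp, hKp⟩ := exists_plusPrime hK b hb
  obtain ⟨i, hi⟩ := h p hp
  exact hi (hKp _ (hs i))

/-- After refining a covering by basic open sets `D⁺(s p)`, a power of `b` lies in the ideal
generated by the `s p`, hence in the ideal generated by finitely many of them; these already give a
covering. -/
theorem isCompact_D (b : A.Sym) : IsCompact (D b) := by
  classical
  refine isCompact_of_finite_subcover fun {ι} U hU hcov => ?_
  have h : ∀ p : D b, ∃ (i : ι) (s : A.Sym), p.1 ∈ Dop s ∧ D s ⊆ U i := by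
    intro p
    obtain ⟨i, hi⟩ := Set.mem_iUnion.1 (hcov p.2)
    obtain ⟨s, hs⟩ := hU i p.1 hi
    exact ⟨i, s, hs⟩
  choose i s hs hsU using h
  obtain ⟨n, hn⟩ := exists_pow_mem b s (fun p hp => ⟨⟨p, hp⟩, hs _⟩)
    (isIdeal_idealSpan (Set.range fun p => (s p).1)) fun p => subset_idealSpan _ ⟨p, rfl⟩
  obtain ⟨F, hF, hfin, hn⟩ := exists_finset_idealSpan hn
  choose g hg using hF
  have := hfin.to_subtype
  have := Fintype.ofFinite F
  refine ⟨Finset.univ.image fun a : F => i (g a.2), fun q hq => ?_⟩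
  by_contra hq'
  -- If `q` lay in none of the chosen sets, it would contain the finite set `F`, hence `b ^ n`,
  -- although `b` is outside of `q`.
  refine q.compl.pow_mem hq n (hn _ q.isPlusIdeal.toIsIdeal fun a ha => ?_)
  by_contra haq
  refine hq' (Set.mem_biUnion (Finset.mem_coe.2 (Finset.mem_image.2 ⟨⟨a, ha⟩, Finset.mem_univ _, rfl⟩))
    (hsU _ ?_))
  change (s (g ha)).1 ∉ q.carrier
  rwa [show (s (g ha)).1 = a from hg ha]

end PlusPrime

end GRing

/-! ### Sections of `M^♮` over basic open sets -/

namespace ASet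

open GRing GRing.PlusPrime

variable {A : GRing.{u}} (N : ASet A)

/-- The zero of `A_[1]` is the contraction along `∅ → [1]` of the only element of `A_∅`, so its
action is an action over `∅`, which gives the base point. It places zero in the ideals used below.
-/
theorem zero_act (m : N.carrier) : N.act (A.zero Unit) (fun _ => m) A.one = N.zero := by
  have h := N.act_nat_right (X := Empty) (Y := Unit) (fun x => x.elim) A.one (A.zero _)
    (fun _ => A.zero _) (fun _ => m)
  rw [N.act_empty] at h
  have h' : A.con (X := Empty) (Y := Unit) (fun x => x.elim) (A.zero _) (fun _ => A.zero _) =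
      A.zero Unit := by
    obtain ⟨v, hv⟩ := A.exists_isOnes (⊥ : Empty ≃. Unit)
    rw [← A.map_zero (⊥ : Empty ≃. Unit), ← A.con_ones _ _ _ hv]
    refine A.con_congr (funext fun x => x.elim) _ _ _ fun y => ?_
    have : IsEmpty (fib (⊥ : Empty ≃. Unit) y) := ⟨fun x => x.1.elim⟩
    rw [A.eq_zero (v y)]
    exact (A.map_zero _).symm
  rw [← h']
  exact h.symm

/-- The `a` with `a m = a m'` form an ideal `K`. The hypothesis supplies, for each point of `D⁺(b)`,
a symmetric element of `K` outside of that point, so `K` contains a power of `b`. -/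
theorem exists_pow_smul_eq {b : A.Sym} {m m' : N.carrier}
    (h : ∀ p ∈ Dop b, ∃ r ∈ p.compl, r • m = r • m') : ∃ n : ℕ, b ^ n • m = b ^ n • m' := by
  choose r hr hm using h
  refine exists_pow_mem (K := {a | N.act a (fun _ => m) A.one = N.act a (fun _ => m') A.one})
    b (fun p : Dop b => r p.1 p.2) (fun p hp => ⟨⟨p, hp⟩, hr p hp⟩) ⟨?_, ?_⟩ fun p => hm p.1 p.2
  · change _ = _
    rw [zero_act, zero_act]
  · intro X _ b d x hx
    change _ = _
    rw [act_act, act_act]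
    exact congrArg (fun f => N.act b f d) (funext hx)

/-- By quasi-compactness the section is given by finitely many fractions `m p / s p`. They are first
rewritten so that their compatibility holds exactly in `N`, and a common numerator over a power of
`b` then comes from an ideal membership that replaces the usual partition of unity. -/
theorem exists_eq_mk {b : A.Sym} (σ : Sec N.carrier (Dop b)) :
    ∃ (n : ℕ) (m : N.carrier), ∀ p (hp : p ∈ Dop b),
      σ.1 ⟨p, hp⟩ = Loc.mk m ⟨b ^ n, p.compl.pow_mem hp n⟩ := by
  choose s m h1 h2 h3 using σ.2
  obtain ⟨T, hT⟩ := (isCompact_D b).elim_finite_subcover (fun p => D (s p))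
    (fun p => isOpen_D _) fun p hp => Set.mem_iUnion.2 ⟨⟨p, hp⟩, h2 ⟨p, hp⟩⟩
  have hpq : ∀ p q, ∃ n : ℕ, (s p * s q) ^ n • s q • m p = (s p * s q) ^ n • s p • m q := by
    intro p q
    refine exists_pow_smul_eq N fun x hx => ?_
    obtain ⟨hp, hq⟩ := mem_Dop_mul.1 hx
    obtain ⟨r, hr⟩ := Loc.mk_eq_mk.1 ((h3 p x hp).symm.trans (h3 q x hq))
    exact ⟨r.1, r.2, hr⟩
  choose n hn using hpq
  let k := (T ×ˢ T).sup fun x => n x.1 x.2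
  have hk : ∀ p ∈ T, ∀ q ∈ T, s q ^ (k + 1) • s p ^ k • m p = s p ^ (k + 1) • s q ^ k • m q := by
    intro p hp q hq
    have hle : n p q ≤ k :=
      Finset.le_sup (f := fun x => n x.1 x.2) (Finset.mem_product.2 ⟨hp, hq⟩ : (p, q) ∈ T ×ˢ T)
    obtain ⟨l, hl⟩ := Nat.exists_eq_add_of_le hle
    have h := congrArg (fun x => (s p * s q) ^ l • x) (hn p q)
    simp only [smul_smul] at h ⊢
    convert h using 2
    · rw [← mul_assoc, ← pow_add, add_comm l, ← hl, mul_pow, pow_succ]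
      simp only [mul_comm, mul_left_comm]
    · rw [← mul_assoc, ← pow_add, add_comm l, ← hl, mul_pow, pow_succ]
      simp only [mul_comm, mul_assoc]
  -- `K` consists of the `a` for which `a` times the section has a numerator `y` in `N`. Such
  -- numerators can be combined by the action, so `K` is an ideal; it contains `s p ^ (k + 1)` with
  -- numerator `s p ^ k • m p`, hence some `b ^ l`, and the section is `y / b ^ l`.
  obtain ⟨l, y, hy⟩ := exists_pow_mem
    (K := {a | ∃ y : N.carrier, ∀ p ∈ T, s p ^ (k + 1) • y = N.act a (fun _ => s p ^ k • m p) A.one})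
    b (fun p : T => s p.1 ^ (k + 1)) (by
      intro p hp
      obtain ⟨q, hq, hpq⟩ := Set.mem_iUnion₂.1 (hT hp)
      exact ⟨⟨q, hq⟩, p.compl.pow_mem hpq _⟩)
    ⟨⟨N.zero, fun p hp => by
        rw [N.smul_zero, zero_act]⟩, by
      intro X _ b d x hx
      choose y hy using hx
      refine ⟨N.act b y d, fun p hp => ?_⟩
      rw [act_act, ← act_smul_mid]
      exact congrArg (fun f => N.act b f d) (funext fun i => hy i p hp)⟩
    fun p => ⟨s p.1 ^ k • m p.1, fun q hq => hk p.1 p.2 q hq⟩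
  refine ⟨l, y, fun p hp => ?_⟩
  obtain ⟨q, hq, hpq⟩ := Set.mem_iUnion₂.1 (hT hp)
  refine (h3 q p hpq).trans (Loc.mk_eq_mk.2 ⟨⟨s q ^ k, p.compl.pow_mem hpq k⟩, ?_⟩)
  have h := hy q hq
  change s q ^ k • b ^ l • m q = s q ^ k • s q • y
  rw [smul_smul _ _ y, ← pow_succ, h, smul_comm]
  rfl

end ASet

/-! ### Presheaves of `𝒪_X`-sets on `spec⁺(A)` as presheaves of `A`-sets -/

theorem ASet.Hom.map_smul {A : GRing.{u}} {M N : ASet A} (φ : M ⟶ N) (s : A.Sym) (m : M.carrier) :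
    φ.toFun (s • m) = s • φ.toFun m := φ.map_act _ _ _

namespace GRing

variable {A B : GRing.{u}}

theorem Hom.app_sc (φ : A ⟶ B) (s t : A.obj Unit) :
    φ.app Unit (A.sc s t) = B.sc (φ.app Unit s) (φ.app Unit t) := by
  refine (φ.app_mul _ _ _).trans ?_
  congr 1
  funext i
  exact φ.app_map _ _

theorem Hom.app_star (φ : A ⟶ B) (s : A.obj Unit) :
    φ.app Unit (A.star s) = B.star (φ.app Unit s) := by
  refine (φ.app_con _ _ _).trans ?_
  unfold star
  congr 1
  · exact φ.app_one
  · funext i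
    exact φ.app_map _ _

/-- The map of symmetric elements induced by a homomorphism. -/
def symMap (φ : A ⟶ B) : A.Sym → B.Sym := fun s => ⟨φ.app Unit s.1, by rw [← φ.app_star, s.2]⟩

/-! ### Fractions as sections, and invertibility at a point -/

namespace PlusPrime

/-- The section `𝔭 ↦ m / s` over an open subset of `D⁺(s)`. -/
noncomputable def Sec.frac {E : Type u} [MulAction A.Sym E] {U : Opens (PlusPrime A)} (m : E)
    (s : A.Sym) (h : U ≤ Dop s) : Sec E U :=
  ⟨fun p => Loc.mk m ⟨s, h p.2⟩, fun p => by
    obtain ⟨t, ht, ht'⟩ := exists_Dop p.2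
    exact ⟨t * s, t • m, fun q hq => ht' (mem_D_mul.1 hq).1, mem_D_mul.2 ⟨ht, h p.2⟩,
      fun q hq => (Loc.mk_smul _ _ _ _ rfl).symm⟩⟩

theorem loc_sc (S : Submonoid A.Sym) {X : Type} [Finite X] (a : A.obj Unit) (b : A.obj X)
    (s t : S) :
    (A.loc S).sc (Loc.mk a s : Loc S (A.obj Unit)) (Loc.mk b t : Loc S (A.obj X)) =
      (Loc.mk (A.sc a b) (s * t) : Loc S (A.obj X)) :=
  A.loc_mul (toPt X) a (fun i => A.tr (ptEquiv X i) b) s t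

theorem loc_star (S : Submonoid A.Sym) (a : A.obj Unit) (s : S) :
    (A.loc S).star (Loc.mk a s : Loc S (A.obj Unit)) =
      (Loc.mk (A.star a) s : Loc S (A.obj Unit)) := by
  refine (A.loc_con (toPt Unit) A.one (fun i => A.tr (ptEquiv Unit i) a) 1 s).trans ?_
  rw [_root_.one_mul]
  rfl

/-- The symmetric section `𝔭 ↦ m / s`. -/
noncomputable def symFrac {U : Opens (PlusPrime A)} (m s : A.Sym) (h : U ≤ Dop s) :
    (A.sec U).Sym :=
  ⟨Sec.frac m.1 s h, Sec.ext fun p => by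
    refine (loc_star p.1.compl m.1 ⟨s, h p.2⟩).trans ?_
    rw [m.2]
    rfl⟩

theorem symFrac_mul_symMap {U : Opens (PlusPrime A)} (s : A.Sym) (h : U ≤ Dop s) :
    symFrac 1 s h * symMap (A.toSec U) s = 1 :=
  Subtype.ext (Sec.ext fun p => by
    refine (loc_sc p.1.compl A.one s.1 ⟨s, h p.2⟩ 1).trans ?_
    refine Loc.mk_eq_mk.2 ⟨1, ?_⟩
    rw [_root_.mul_one]
    change (1 : A.Sym) • (1 : A.Sym) • A.sc A.one s.1 = (1 : A.Sym) • A.sc s.1 A.one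
    rw [one_smul, one_smul, one_smul, sc_comm])

/-- A symmetric element whose fraction is invertible is outside of the prime. -/
theorem mem_compl_of_sc_eq_one {p : PlusPrime A} {m : A.Sym} {s : p.compl}
    {v : Loc p.compl (A.obj Unit)}
    (h : (A.loc p.compl).sc (Loc.mk m.1 s : Loc p.compl (A.obj Unit)) v =
      (Loc.mk A.one 1 : Loc p.compl (A.obj Unit))) : m ∈ p.compl := by
  obtain ⟨a, t, rfl⟩ := Loc.exists_rep v
  rw [loc_sc] at h
  obtain ⟨r, hr⟩ := Loc.mk_eq_mk.1 h
  intro hm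
  -- The equation `(m / s) (a / t) = 1` means `r m a = r s t`. If `m` were in the prime, the left
  -- side would be too, but `r`, `s` and `t` are outside of it.
  have h1 : (r.1 * (s * t).1 * 1).1 ∈ p.carrier := by
    have h2 : r.1 • (1 : p.compl).1 • A.sc m.1 a ∈ p.carrier := by
      have hid := p.isPlusIdeal.toIsIdeal
      refine hid.sc_mem _ (hid.sc_mem _ ?_)
      rw [sc_comm]
      exact hid.sc_mem _ hm
    rw [hr, smul_smul] at h2
    exact h2
  exact p.compl.mul_mem (p.compl.mul_mem r.2 (s * t).2) p.compl.one_mem h1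

end PlusPrime

end GRing

open GRing GRing.PlusPrime

theorem ASet.sec_smul {A : GRing.{u}} (N : ASet A) {U : Opens (PlusPrime A)} (s : (A.sec U).Sym)
    (σ : (N.sec U).carrier) (p : U) {c : A.Sym} {b t : p.1.compl} {m : N.carrier}
    (hs : s.1.1 p = Loc.mk c.1 b) (hσ : σ.1 p = Loc.mk m t) :
    (s • σ).1 p = Loc.mk (c • m) (b * t) := by
  change N.locAct p.1.compl (s.1.1 p) (fun _ => σ.1 p) (Loc.mk A.one 1) = _
  rw [hs, hσ]
  refine (N.locAct_mk (X := Unit) c.1 A.one (fun _ => m) b t 1).trans ?_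
  rw [mul_one]
  rfl

namespace PreOSet

variable {A : GRing.{u}} (F : PreOSet A.spec)

/-- The sections over `U`, as an `A`-set. -/
noncomputable def secs (U : Opens (PlusPrime A)) : ASet A :=
  (ASet.restrictScalars (A.toSec U)).obj (F.obj U)

/-- The restriction maps are maps of `A`-sets. -/
noncomputable def secsRes {U V : Opens (PlusPrime A)} (h : V ≤ U) : F.secs U ⟶ F.secs V :=
  ⟨F.res h, F.res_zero h, fun b m d => F.res_act h _ m _⟩

/-- The sections over `U`, as an `𝒪_A(U)`-set. -/
abbrev osecs (U : Opens (PlusPrime A)) : ASet (A.sec U) := F.obj U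

variable {F}

theorem secsRes_refl (U : Opens (PlusPrime A)) (m : (F.secs U).carrier) :
    (F.secsRes (le_refl U)).toFun m = m := F.res_refl U m

theorem secsRes_secsRes {U V W : Opens (PlusPrime A)} (h : V ≤ U) (h' : W ≤ V)
    (m : (F.secs U).carrier) :
    (F.secsRes h').toFun ((F.secsRes h).toFun m) = (F.secsRes (h'.trans h)).toFun m :=
  F.res_res h h' m

/-- Serves for open sets that are equal without being so by definition: the restrictions in the two
directions are mutually inverse. -/
theorem secsRes_injective {U V : Opens (PlusPrime A)} (h : V ≤ U) (h' : U ≤ V) :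
    Function.Injective (F.secsRes h).toFun := by
  intro m m' hm
  have := congrArg (F.secsRes h').toFun hm
  rwa [secsRes_secsRes, secsRes_secsRes, secsRes_refl, secsRes_refl] at this

/-- Over a subset of `D⁺(s)` the fraction `1 / s` is a section of the structure sheaf, and it undoes
the multiplication by `s`. -/
theorem smul_injective {U : Opens (PlusPrime A)} {s : A.Sym} (h : U ≤ Dop s)
    {m m' : (F.secs U).carrier} (hm : s • m = s • m') : m = m' := by
  have h1 : ∀ n : (F.osecs U).carrier, symFrac 1 s h • symMap (A.toSec U) s • n = n := fun n => by
    rw [smul_smul, symFrac_mul_symMap, one_smul]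
  exact (h1 m).symm.trans ((congrArg (fun x : (F.osecs U).carrier => symFrac 1 s h • x) hm).trans
    (h1 m'))

theorem exists_smul_eq {U : Opens (PlusPrime A)} {s : A.Sym} (h : U ≤ Dop s)
    (m : (F.secs U).carrier) : ∃ n : (F.secs U).carrier, s • n = m := by
  -- The same set carries the action of symmetric elements of `A` and that of symmetric sections
  -- over `U`; the annotation selects the latter, where `1 / s` lives.
  refine ⟨HSMul.hSMul (β := (F.osecs U).carrier) (symFrac 1 s h) m, ?_⟩
  have h1 : ∀ n : (F.osecs U).carrier, symMap (A.toSec U) s • symFrac 1 s h • n = n := fun n => by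
    rw [smul_smul, mul_comm, symFrac_mul_symMap, one_smul]
  exact h1 m

/-- Sections over `V` that agree on `V ∩ D⁺(f)` agree after multiplication by a power of `f`. -/
def Sep (F : PreOSet A.spec) (f : A.Sym) (V : Opens (PlusPrime A)) : Prop :=
  -- `W` stands for the intersection and is given by inequalities, so that `D⁺(f)` or the image of
  -- an open set under a chart can take its place without transport along an equality.
  ∀ (W : Opens (PlusPrime A)) (hW : W ≤ V) (_ : V ⊓ Dop f ≤ W) (τ τ' : (F.secs V).carrier),
    (F.secsRes hW).toFun τ = (F.secsRes hW).toFun τ' → ∃ n : ℕ, f ^ n • τ = f ^ n • τ'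

/-- Sections over `V ∩ D⁺(f)` extend to `V` after multiplication by a power of `f`. -/
def Ext (F : PreOSet A.spec) (f : A.Sym) (V : Opens (PlusPrime A)) : Prop :=
  ∀ (W : Opens (PlusPrime A)) (hW : W ≤ V) (_ : W ≤ Dop f) (_ : V ⊓ Dop f ≤ W)
    (σ : (F.secs W).carrier), ∃ (n : ℕ) (τ : (F.secs V).carrier),
      (F.secsRes hW).toFun τ = f ^ n • σ

/-- Separatedness, for coverings indexed by the points. -/
theorem IsSheaf.eq_of_locally (hF : F.IsSheaf) {U : Opens (PlusPrime A)}
    {m m' : (F.secs U).carrier}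
    (h : ∀ p ∈ U, ∃ (V : Opens (PlusPrime A)) (hV : V ≤ U), p ∈ V ∧
      (F.secsRes hV).toFun m = (F.secsRes hV).toFun m') : m = m' := by
  choose V hV hp h using h
  -- The points of `U` index the covering; they form a type in the universe that the sheaf condition
  -- requires.
  obtain ⟨n, -, hn⟩ := hF U U (fun p => V p.1 p.2) (fun p => hV p.1 p.2)
    (fun p hpU => Opens.mem_iSup.2 ⟨⟨p, hpU⟩, hp p hpU⟩)
    (fun p => (F.secsRes (hV p.1 p.2)).toFun m)
    (fun p q => (F.res_res _ _ _).trans (F.res_res _ _ _).symm)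
  exact (hn m fun p => rfl).trans (hn m' fun p => (h p.1 p.2).symm).symm

theorem IsSheaf.exists_glue (hF : F.IsSheaf) {ι : Type u} {U : Opens (PlusPrime A)}
    {V : ι → Opens (PlusPrime A)} (hV : ∀ i, V i ≤ U) (hU : ∀ p ∈ U, ∃ i, p ∈ V i)
    (m : ∀ i, (F.secs (V i)).carrier)
    (hm : ∀ i j, (F.secsRes (inf_le_left : V i ⊓ V j ≤ V i)).toFun (m i) =
      (F.secsRes (inf_le_right : V i ⊓ V j ≤ V j)).toFun (m j)) :
    ∃ n : (F.secs U).carrier, ∀ i, (F.secsRes (hV i)).toFun n = m i := by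
  obtain ⟨n, hn, -⟩ := hF ι U V hV (fun p hp => Opens.mem_iSup.2 (hU p hp)) m hm
  exact ⟨n, hn⟩

end PreOSet

/-! ### Affine charts -/

section Chart

open PresheafedSpace

variable {A B : GRing.{u}} (j : B.spec ⟶ A.spec) [PresheafedSpace.IsOpenImmersion j]

/-- The image of an open set under an open immersion of affine generalized schemes. -/
noncomputable def imageOpen (V : Opens (PlusPrime B)) : Opens (PlusPrime A) :=
  (PresheafedSpace.IsOpenImmersion.opensFunctor j).obj V

/-- An open immersion of affine generalized schemes on points. -/
noncomputable def basePt (q : PlusPrime B) : PlusPrime A := j.base q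

theorem basePt_injective : Function.Injective (basePt j) :=
  (PresheafedSpace.IsOpenImmersion.base_open (f := j)).injective

theorem continuous_basePt : Continuous (basePt j) :=
  (PresheafedSpace.IsOpenImmersion.base_open (f := j)).continuous

theorem mem_imageOpen {V : Opens (PlusPrime B)} {p : PlusPrime A} :
    p ∈ imageOpen j V ↔ ∃ q ∈ V, basePt j q = p := Iff.rfl

theorem basePt_mem_imageOpen {V : Opens (PlusPrime B)} {q : PlusPrime B} :
    basePt j q ∈ imageOpen j V ↔ q ∈ V := by
  rw [mem_imageOpen]
  constructor
  · rintro ⟨q', hq', h⟩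
    rwa [← basePt_injective j h]
  · exact fun h => ⟨q, h, rfl⟩

theorem imageOpen_mono {V V' : Opens (PlusPrime B)} (h : V ≤ V') :
    imageOpen j V ≤ imageOpen j V' :=
  (PresheafedSpace.IsOpenImmersion.opensFunctor j).monotone h

/-- The homomorphism `A → 𝒪_B(V)`. -/
noncomputable def pullSec (V : Opens (PlusPrime B)) : A ⟶ B.sec V :=
  A.toSec ⊤ ≫ j.c.app (op ⊤) ≫
    B.spec.presheaf.map (homOfLE (show V ≤ (Opens.map j.base).obj ⊤ from fun _ _ => trivial)).op

/-- Under `𝒪_B(V) ≅ 𝒪_A(j(V))` the pullback of an element of `A` corresponds to its constant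
section. Hence an element of `A` acts on the sections of `F` over `j(V)` as its pullback acts in the
chart. -/
theorem pullSec_invApp (V : Opens (PlusPrime B)) :
    pullSec j V ≫ PresheafedSpace.IsOpenImmersion.invApp j V = A.toSec (imageOpen j V) := by
  have h1 := PresheafedSpace.IsOpenImmersion.inv_naturality j
    (homOfLE (show V ≤ (Opens.map j.base).obj ⊤ from fun _ _ => trivial)).op
  have h2 := PresheafedSpace.IsOpenImmersion.app_invApp j ⊤
  refine Hom.ext (funext fun X => funext fun _ => funext fun a => ?_)
  refine (congrArg (fun φ => GRing.Hom.app φ X ((j.c.app (op ⊤)).app X (Sec.const ⊤ a))) h1).trans ?_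
  exact congrArg (fun x => (A.spec.presheaf.map ((PresheafedSpace.IsOpenImmersion.opensFunctor j).op.map
      (homOfLE (show V ≤ (Opens.map j.base).obj ⊤ from fun _ _ => trivial)).op)).app X x)
    (congrArg (fun φ => GRing.Hom.app φ X (Sec.const ⊤ a)) h2)

/-- The pullback of `f` is the fraction `c / b` on `D⁺(b)`. -/
def PullEq (f : A.Sym) (c b : B.Sym) : Prop :=
  ∀ (V : Opens (PlusPrime B)) (q : V) (hq : q.1 ∈ Dop b),
    ((pullSec j V).app Unit f.1).1 q = Loc.mk c.1 ⟨b, hq⟩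

variable {j}

/-- Expanding the fraction by `r` shrinks its domain to `D⁺(r * b)`, which can thus be placed inside
a given neighbourhood. -/
theorem PullEq.mul {f : A.Sym} {c b : B.Sym} (h : PullEq j f c b) (r : B.Sym) :
    PullEq j f (r * c) (r * b) := fun V q hq => by
  rw [h V q (mem_Dop_mul.1 hq).2]
  exact (Loc.mk_smul (E := B.obj Unit) c.1 _ _ r rfl).symm

variable (j)

/-- The pullback of `f` is locally a fraction by the definition of the structure sheaf; the work is
to make its numerator symmetric, since only symmetric elements define basic open sets and act on
localizations. -/
theorem exists_pullEq (f : A.Sym) (q : PlusPrime B) :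
    ∃ b c : B.Sym, q ∈ Dop b ∧ PullEq j f c b := by
  let φ := (pullSec j ⊤).app Unit f.1
  obtain ⟨b, c, hle, hqb, hbc⟩ := φ.2 ⟨q, trivial⟩
  have hstar : (B.loc q.compl).star (φ.1 ⟨q, trivial⟩) = φ.1 ⟨q, trivial⟩ :=
    congrFun (congrArg Subtype.val (symMap (pullSec j ⊤) f).2) ⟨q, trivial⟩
  rw [hbc q hqb, loc_star] at hstar
  obtain ⟨r, hr⟩ := Loc.mk_eq_mk.1 hstar
  -- The fraction `c / b` is fixed by the involution, which gives `r b cᵗ = r b c`. So `r b c` is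
  -- symmetric although `c` need not be, and it becomes the numerator over `r b b`.
  have hc : B.star (r.1 • b • c) = r.1 • b • c := by
    refine (B.star_sc _ _).trans ((congrArg₂ B.sc r.1.2 ((B.star_sc _ _).trans
      (congrArg₂ B.sc b.2 rfl))).trans hr)
  refine ⟨r.1 * b * b, ⟨_, hc⟩, q.compl.mul_mem (q.compl.mul_mem r.2 hqb) hqb, fun V x hx => ?_⟩
  have hxb : x.1 ∈ D b := (mem_Dop_mul.1 hx).2
  refine (hbc x.1 hxb).trans ?_
  refine (Loc.mk_smul c (⟨b, hxb⟩ : x.1.compl) ⟨r.1 * b * b, hx⟩ (r.1 * b) rfl).symm.trans ?_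
  rw [mul_smul]

variable {j}

/-- A map of presheafed spaces carries no locality condition on stalks, so `D⁺(f)` has to be
recognized in the chart through invertibility: transport along `𝒪_B(V) ≅ 𝒪_A(j(V))` gives one
direction and pullback along `j` the other. -/
theorem PullEq.mem_iff {f : A.Sym} {c b : B.Sym} (h : PullEq j f c b) {q : PlusPrime B}
    (hq : q ∈ Dop b) : q ∈ Dop c ↔ basePt j q ∈ Dop f := by
  constructor
  · intro hqc
    let V : Opens (PlusPrime B) := Dop b ⊓ Dop c
    have hb : V ≤ Dop b := inf_le_left
    have hc : V ≤ Dop c := inf_le_right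
    -- On `D⁺(b) ∩ D⁺(c)` the pullback `c / b` has the inverse `b / c`. Carried to `𝒪_A(j(V))`, this
    -- inverts `f` at the image of `q`.
    have h1 : (B.sec V).sc ((pullSec j V).app Unit f.1) (symFrac b c hc).1 = (B.sec V).one :=
      Sec.ext fun p => by
        refine (congrArg (fun x => (B.loc p.1.compl).sc x (Loc.mk b.1 ⟨c, hc p.2⟩))
          (h V p (hb p.2))).trans ?_
        refine (loc_sc p.1.compl c.1 b.1 ⟨b, hb p.2⟩ ⟨c, hc p.2⟩).trans ?_
        refine Loc.mk_eq_mk.2 ⟨1, ?_⟩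
        change (1 : B.Sym) • (1 : B.Sym) • (c * b).1 = (1 : B.Sym) • (b * c) • B.one
        rw [one_smul, one_smul, one_smul, mul_comm c b]
        exact (B.one_sc _).symm.trans (B.sc_comm _ _)
    have h2 := congrArg ((PresheafedSpace.IsOpenImmersion.invApp j V).app Unit) h1
    have h3 : (PresheafedSpace.IsOpenImmersion.invApp j V).app Unit
        ((pullSec j V).app Unit f.1) = Sec.const (imageOpen j V) f.1 :=
      congrArg (fun φ : A ⟶ A.sec (imageOpen j V) => φ.app Unit f.1) (pullSec_invApp j V)
    have h4 := (Hom.app_sc (A := B.sec V) (B := A.sec (imageOpen j V))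
      (PresheafedSpace.IsOpenImmersion.invApp j V) ((pullSec j V).app Unit f.1)
      (symFrac b c hc).1).symm.trans (h2.trans (Hom.app_one (A := B.sec V) (B := A.sec (imageOpen j V)) _))
    rw [h3] at h4
    exact mem_compl_of_sc_eq_one (congrFun (congrArg Subtype.val h4)
      ⟨basePt j q, (basePt_mem_imageOpen j).2 ⟨hq, hqc⟩⟩)
  · intro hf
    let V : Opens (PlusPrime B) := (Opens.map j.base).obj (Dop f)
    let φ : A.sec (Dop f) ⟶ B.sec V := j.c.app (op (Dop f))
    -- `f` is invertible over `D⁺(f)`, so its pullback, which is `c / b` at `q`, is invertible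
    -- there, and `c` is outside of `q`.
    have h1 : (A.sec (Dop f)).sc (symMap (A.toSec (Dop f)) f).1 (symFrac 1 f le_rfl).1 =
        (A.sec (Dop f)).one :=
      ((A.sec (Dop f)).sc_comm _ _).trans (congrArg Subtype.val (symFrac_mul_symMap f le_rfl))
    have h2 := (φ.app_sc _ _).symm.trans ((congrArg (φ.app Unit) h1).trans φ.app_one)
    have h3 : φ.app Unit (symMap (A.toSec (Dop f)) f).1 = (pullSec j V).app Unit f.1 :=
      congrArg (fun ψ : A.sec ⊤ ⟶ B.sec V => ψ.app Unit (Sec.const ⊤ f.1))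
        (j.c.naturality (homOfLE le_top : Dop f ⟶ ⊤).op)
    rw [h3] at h2
    have h4 := congrFun (congrArg Subtype.val h2) ⟨q, hf⟩
    refine mem_compl_of_sc_eq_one (s := ⟨b, hq⟩)
      (v := (φ.app Unit (symFrac 1 f le_rfl).1).1 ⟨q, hf⟩) (Eq.trans ?_ h4)
    exact congrArg (fun x => (B.loc q.compl).sc x _) (h V ⟨q, hf⟩ hq).symm

end Chart

/-! ### Separation and extension of sections inside one chart -/

section ChartSections

variable {A B : GRing.{u}} {F : PreOSet A.spec} {j : B.spec ⟶ A.spec}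
  [PresheafedSpace.IsOpenImmersion j] {N : ASet B}
  (e : (PreOSet.restrict j).obj F ≅ (ASet.natural B).obj N)

/-- The sections of `F` over `j(V)` as sections of `N^♮`. -/
noncomputable def chart (V : Opens (PlusPrime B)) (m : (F.secs (imageOpen j V)).carrier) :
    Sec N.carrier V :=
  (e.hom.app V).toFun m

theorem chart_injective (V : Opens (PlusPrime B)) : Function.Injective (chart e V) := by
  refine Function.LeftInverse.injective (g := (e.inv.app V).toFun) fun m => ?_
  exact congrArg (fun φ : (PreOSet.restrict j).obj F ⟶ (PreOSet.restrict j).obj F =>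
    (PreOSet.Hom.app φ V).toFun m) e.hom_inv_id

theorem chart_surjective (V : Opens (PlusPrime B)) : Function.Surjective (chart e V) := by
  refine Function.RightInverse.surjective (g := (e.inv.app V).toFun) fun m => ?_
  exact congrArg (fun φ : (ASet.natural B).obj N ⟶ (ASet.natural B).obj N =>
    (PreOSet.Hom.app φ V).toFun m) e.inv_hom_id

theorem chart_res {V W : Opens (PlusPrime B)} (h : W ≤ V)
    (m : (F.secs (imageOpen j V)).carrier) :
    chart e W ((F.secsRes (imageOpen_mono j h)).toFun m) = Sec.res h (chart e V m) :=
  e.hom.app_res h m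

/-- The chart is linear over `𝒪_B(V)`, and `f` acts there through its pullback, whose value at `q`
is `c / b`. -/
theorem chart_smul {V : Opens (PlusPrime B)} {f : A.Sym} {c b : B.Sym} (h : PullEq j f c b)
    (m : (F.secs (imageOpen j V)).carrier) (q : V) (hq : q.1 ∈ Dop b) {x : N.carrier}
    {t : q.1.compl} (hx : (chart e V m).1 q = Loc.mk x t) :
    (chart e V (f • m)).1 q = Loc.mk (c • x) (⟨b, hq⟩ * t) := by
  have h1 := (e.hom.app V).map_act (X := Unit) (symMap (pullSec j V) f).1 (fun _ => m)
    (B.sec V).one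
  have h3 : (PresheafedSpace.IsOpenImmersion.invApp j V).app Unit
      ((pullSec j V).app Unit f.1) = Sec.const (imageOpen j V) f.1 :=
    congrArg (fun φ : A ⟶ A.sec (imageOpen j V) => φ.app Unit f.1) (pullSec_invApp j V)
  have h4 := Hom.app_one (A := B.sec V) (B := A.sec (imageOpen j V))
    (PresheafedSpace.IsOpenImmersion.invApp j V)
  have h5 : chart e V (f • m) =
      HSMul.hSMul (β := (N.sec V).carrier) (symMap (pullSec j V) f) (chart e V m) :=
    (congrArg₂ (fun b d => (e.hom.app V).toFun
      (ASet.act (A := A.sec (imageOpen j V)) (F.obj (imageOpen j V)) (X := Unit) b (fun _ => m) d))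
      h3.symm h4.symm).trans h1
  rw [h5]
  exact N.sec_smul (symMap (pullSec j V) f) (chart e V m) q (h V q hq) hx

theorem chart_pow_smul {V : Opens (PlusPrime B)} {f : A.Sym} {c b : B.Sym} (h : PullEq j f c b)
    (m : (F.secs (imageOpen j V)).carrier) (q : V) (hq : q.1 ∈ Dop b) {x : N.carrier}
    {t : q.1.compl} (hx : (chart e V m).1 q = Loc.mk x t) (n : ℕ) :
    (chart e V (f ^ n • m)).1 q = Loc.mk (c ^ n • x) (⟨b, hq⟩ ^ n * t) := by
  induction n with
  | zero => simpa using hx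
  | succ n ih =>
    rw [pow_succ', pow_succ', pow_succ', mul_smul, mul_smul, mul_assoc]
    exact chart_smul e h _ q hq ih

/-- In the chart the part of `j(D⁺(b))` inside `D⁺(f)` is `j(D⁺(b * c))`. Two sections `m / b ^ n`
and `m' / b ^ n'` that agree there have cross-multiplied numerators that agree after multiplication
by some `(b * c) ^ k`; since `b` is invertible on `D⁺(b)`, the factor `c ^ k`, that is `f ^ k`,
suffices. -/
theorem sep_imageOpen_Dop
    (e : (PreOSet.restrict j).obj F ≅ (ASet.natural B).obj N) {f : A.Sym} {c b : B.Sym} (h : PullEq j f c b) :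
    F.Sep f (imageOpen j (Dop b)) := by
  intro W hW hW' τ τ' hτ
  obtain ⟨n, m, hm⟩ := N.exists_eq_mk (chart e _ τ)
  obtain ⟨n', m', hm'⟩ := N.exists_eq_mk (chart e _ τ')
  have hbc : Dop (b * c) ≤ Dop b := fun q hq => (mem_Dop_mul.1 hq).1
  have hle : imageOpen j (Dop (b * c)) ≤ W := by
    rintro p ⟨q, hq, rfl⟩
    obtain ⟨hqb, hqc⟩ := mem_Dop_mul.1 hq
    exact hW' ⟨⟨q, hqb, rfl⟩, (h.mem_iff hqb).1 hqc⟩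
  have h1 := congrArg (F.secsRes hle).toFun hτ
  rw [PreOSet.secsRes_secsRes, PreOSet.secsRes_secsRes] at h1
  have h2 : Sec.res hbc (chart e _ τ) = Sec.res hbc (chart e _ τ') := by
    rw [← chart_res, ← chart_res]
    exact congrArg _ h1
  obtain ⟨k, hk⟩ := N.exists_pow_smul_eq (b := b * c) (m := b ^ n' • m) (m' := b ^ n • m') (by
    intro q hq
    have h3 := congrFun (congrArg Subtype.val h2) ⟨q, hq⟩
    obtain ⟨r, hr⟩ := Loc.mk_eq_mk.1 ((hm q (hbc hq)).symm.trans (h3.trans (hm' q (hbc hq))))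
    exact ⟨r.1, r.2, hr⟩)
  refine ⟨k, chart_injective e _ (Sec.ext fun q => ?_)⟩
  rw [chart_pow_smul e h τ q q.2 (hm q.1 q.2), chart_pow_smul e h τ' q q.2 (hm' q.1 q.2)]
  refine Loc.mk_eq_mk.2 ⟨1, congrArg _ ?_⟩
  simp only [Submonoid.coe_mul, SubmonoidClass.coe_pow, smul_smul, mul_pow] at hk ⊢
  convert hk using 2
  · simp only [mul_comm, mul_left_comm]
  · simp only [mul_comm, mul_left_comm]

/-- A section over `j(D⁺(b * c))` is a fraction `m / (b * c) ^ n`, and multiplication by `f ^ n = (c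
/ b) ^ n` cancels `c` from the denominator. -/
theorem ext_imageOpen_Dop
    (e : (PreOSet.restrict j).obj F ≅ (ASet.natural B).obj N) {f : A.Sym} {c b : B.Sym} (h : PullEq j f c b) :
    F.Ext f (imageOpen j (Dop b)) := by
  intro W hW hWf hW' σ
  have hbc : Dop (b * c) ≤ Dop b := fun q hq => (mem_Dop_mul.1 hq).1
  have hle : imageOpen j (Dop (b * c)) ≤ W := by
    rintro p ⟨q, hq, rfl⟩
    obtain ⟨hqb, hqc⟩ := mem_Dop_mul.1 hq
    exact hW' ⟨⟨q, hqb, rfl⟩, (h.mem_iff hqb).1 hqc⟩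
  have hge : W ≤ imageOpen j (Dop (b * c)) := by
    intro p hp
    obtain ⟨q, hq, rfl⟩ := hW hp
    exact ⟨q, mem_Dop_mul.2 ⟨hq, (h.mem_iff hq).2 (hWf hp)⟩, rfl⟩
  obtain ⟨n, m, hm⟩ := N.exists_eq_mk (chart e _ ((F.secsRes hle).toFun σ))
  -- One factor `b ^ n` comes from the denominator of the section, the other from `f ^ n = c ^ n / b
  -- ^ n`.
  have hpow : Dop b ≤ Dop (b ^ (n + n)) := fun q hq => q.compl.pow_mem hq _
  obtain ⟨τ, hτ⟩ := chart_surjective e (Dop b) (Sec.frac m (b ^ (n + n)) hpow)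
  refine ⟨n, τ, PreOSet.secsRes_injective hle hge (chart_injective e _ (Sec.ext fun q => ?_))⟩
  rw [PreOSet.secsRes_secsRes, ASet.Hom.map_smul,
    chart_pow_smul e h _ q (hbc q.2) (hm q.1 q.2)]
  refine (congrFun (congrArg Subtype.val (chart_res e hbc τ)) q).trans ?_
  rw [hτ]
  refine Loc.mk_eq_mk.2 ⟨1, congrArg _ ?_⟩
  simp only [Submonoid.coe_mul, SubmonoidClass.coe_pow, smul_smul, mul_pow, pow_add]
  congr 1
  simp only [mul_comm, mul_left_comm]

end ChartSections

/-! ### Sections of quasi-coherent `𝒪_X`-sets over basic open sets -/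

namespace PreOSet

variable {A : GRing.{u}} {F : PreOSet A.spec}

theorem exists_sep (hF : qcSet A.spec F) (f : A.Sym) {V : Opens (PlusPrime A)} {p : PlusPrime A}
    (hp : p ∈ V) : ∃ W ≤ V, p ∈ W ∧ F.Sep f W := by
  obtain ⟨B, j, _, -, ⟨q, rfl⟩, N, ⟨e⟩⟩ := hF.2 p
  obtain ⟨b, c, hqb, hbc⟩ := exists_pullEq j f q
  obtain ⟨r, hqr, hr⟩ := exists_Dop
    (U := ⟨basePt j ⁻¹' V, V.isOpen.preimage (continuous_basePt j)⟩) (p := q) hp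
  refine ⟨imageOpen j (Dop (r * b)), ?_, ⟨q, mem_Dop_mul.2 ⟨hqr, hqb⟩, rfl⟩,
    sep_imageOpen_Dop e (hbc.mul r)⟩
  rintro _ ⟨x, hx, rfl⟩
  exact hr (mem_Dop_mul.1 hx).1

/-- Separation holds near each point by a chart. Finitely many such neighbourhoods cover `V`, the
largest of their exponents serves for all, and equality is local. -/
theorem sep_of_isCompact (hF : qcSet A.spec F) (f : A.Sym) {V : Opens (PlusPrime A)}
    (hV : IsCompact (V : Set (PlusPrime A))) : F.Sep f V := by
  intro W hW hW' τ τ' hτ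
  have h : ∀ p : V, ∃ (U : Opens (PlusPrime A)) (hU : U ≤ V) (n : ℕ), p.1 ∈ U ∧
      f ^ n • (F.secsRes hU).toFun τ = f ^ n • (F.secsRes hU).toFun τ' := by
    intro p
    obtain ⟨U, hU, hpU, hs⟩ := exists_sep hF f p.2
    have h1 := congrArg (F.secsRes (inf_le_right : U ⊓ W ≤ W)).toFun hτ
    rw [secsRes_secsRes, secsRes_secsRes] at h1
    obtain ⟨n, hn⟩ := hs (U ⊓ W) inf_le_left
      (fun x hx => ⟨hx.1, hW' ⟨hU hx.1, hx.2⟩⟩) ((F.secsRes hU).toFun τ) ((F.secsRes hU).toFun τ')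
      (by rwa [secsRes_secsRes, secsRes_secsRes])
    exact ⟨U, hU, n, hpU, hn⟩
  choose U hU n hpU hn using h
  obtain ⟨T, hT⟩ := hV.elim_finite_subcover (fun p => (U p : Set (PlusPrime A)))
    (fun p => (U p).isOpen) fun p hp => Set.mem_iUnion.2 ⟨⟨p, hp⟩, hpU ⟨p, hp⟩⟩
  refine ⟨T.sup n, hF.1.eq_of_locally fun p hp => ?_⟩
  obtain ⟨t, ht, hpt⟩ := Set.mem_iUnion₂.1 (hT hp)
  refine ⟨U t, hU t, hpt, ?_⟩
  obtain ⟨l, hl⟩ := Nat.exists_eq_add_of_le' (Finset.le_sup (f := n) ht)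
  rw [ASet.Hom.map_smul, ASet.Hom.map_smul, hl, pow_add, mul_smul, mul_smul, hn t]

/-- Local extensions of `f ^ n • σ` are brought to one exponent; on overlaps they agree after a
further power of `f`, and then they glue. `P` is a supply of small open sets with extension on each
and separation on pairwise intersections; it is chosen in two different ways below. -/
theorem ext_of_cover (hF : F.IsSheaf) (f : A.Sym) {V : Opens (PlusPrime A)}
    (hV : IsCompact (V : Set (PlusPrime A))) (P : Opens (PlusPrime A) → Prop)
    (hP : ∀ p ∈ V, ∃ W ≤ V, p ∈ W ∧ P W) (hext : ∀ W, P W → F.Ext f W)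
    (hsep : ∀ W W', P W → P W' → F.Sep f (W ⊓ W')) : F.Ext f V := by
  intro W hW hWf hW' σ
  choose U hU hpU hPU using hP
  obtain ⟨T, hT⟩ := hV.elim_finite_subcover (fun p : V => (U p.1 p.2 : Set (PlusPrime A)))
    (fun p => (U p.1 p.2).isOpen) fun p hp => Set.mem_iUnion.2 ⟨⟨p, hp⟩, hpU p hp⟩
  have h1 : ∀ p : V, ∃ (n : ℕ) (τ : (F.secs (U p.1 p.2)).carrier),
      (F.secsRes (inf_le_left : U p.1 p.2 ⊓ W ≤ _)).toFun τ =
        f ^ n • (F.secsRes (inf_le_right : U p.1 p.2 ⊓ W ≤ W)).toFun σ := fun p =>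
    hext _ (hPU p.1 p.2) _ _ (inf_le_right.trans hWf)
      (fun x hx => ⟨hx.1, hW' ⟨hU _ _ hx.1, hx.2⟩⟩) _
  choose n τ hτ using h1
  have h2 : ∀ t : T, ∃ τ' : (F.secs (U t.1.1 t.1.2)).carrier,
      (F.secsRes (inf_le_left : U t.1.1 t.1.2 ⊓ W ≤ _)).toFun τ' =
        f ^ T.sup n • (F.secsRes (inf_le_right : U t.1.1 t.1.2 ⊓ W ≤ W)).toFun σ := by
    intro t
    obtain ⟨l, hl⟩ := Nat.exists_eq_add_of_le' (Finset.le_sup (f := n) t.2)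
    exact ⟨f ^ l • τ t, by rw [ASet.Hom.map_smul, hτ, hl, pow_add, mul_smul]⟩
  choose τ' hτ' using h2
  have h3 : ∀ s t : T, ∃ k : ℕ,
      f ^ k • (F.secsRes (inf_le_left : U s.1.1 s.1.2 ⊓ U t.1.1 t.1.2 ≤ _)).toFun (τ' s) =
        f ^ k • (F.secsRes (inf_le_right : U s.1.1 s.1.2 ⊓ U t.1.1 t.1.2 ≤ _)).toFun (τ' t) := by
    intro s t
    refine hsep _ _ (hPU _ _) (hPU _ _) (U s.1.1 s.1.2 ⊓ U t.1.1 t.1.2 ⊓ W) inf_le_left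
      (fun x hx => ⟨hx.1, hW' ⟨hU _ _ hx.1.1, hx.2⟩⟩) _ _ ?_
    have hs := congrArg (F.secsRes (show U s.1.1 s.1.2 ⊓ U t.1.1 t.1.2 ⊓ W ≤ U s.1.1 s.1.2 ⊓ W from
      inf_le_inf_right _ inf_le_left)).toFun (hτ' s)
    have ht := congrArg (F.secsRes (show U s.1.1 s.1.2 ⊓ U t.1.1 t.1.2 ⊓ W ≤ U t.1.1 t.1.2 ⊓ W from
      inf_le_inf_right _ inf_le_right)).toFun (hτ' t)
    rw [secsRes_secsRes, ASet.Hom.map_smul, secsRes_secsRes] at hs ht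
    rw [secsRes_secsRes, secsRes_secsRes, hs, ht]
  choose k hk using h3
  let K := (Finset.univ : Finset (T × T)).sup fun x => k x.1 x.2
  obtain ⟨y, hy⟩ := hF.exists_glue (V := fun t : T => U t.1.1 t.1.2) (fun t => hU _ _)
    (fun p hp => by
      obtain ⟨t, ht, hpt⟩ := Set.mem_iUnion₂.1 (hT hp)
      exact ⟨⟨t, ht⟩, hpt⟩)
    (fun t => f ^ K • τ' t) (fun s t => by
      obtain ⟨l, hl⟩ := Nat.exists_eq_add_of_le'
        (Finset.le_sup (f := fun x : T × T => k x.1 x.2) (Finset.mem_univ (s, t)))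
      rw [ASet.Hom.map_smul, ASet.Hom.map_smul, show K = l + k s t from hl, pow_add, mul_smul,
        mul_smul, hk])
  -- `T.sup n` is the exponent of the local extensions, and `K` is the additional one that makes
  -- them agree on overlaps.
  refine ⟨K + T.sup n, y, hF.eq_of_locally fun p hp => ?_⟩
  obtain ⟨t, ht, hpt⟩ := Set.mem_iUnion₂.1 (hT (hW hp))
  refine ⟨U t.1 t.2 ⊓ W, inf_le_right, ⟨hpt, hp⟩, ?_⟩
  have h5 := congrArg (F.secsRes (inf_le_left : U t.1 t.2 ⊓ W ≤ _)).toFun (hy ⟨t, ht⟩)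
  rw [secsRes_secsRes, ASet.Hom.map_smul, hτ' ⟨t, ht⟩] at h5
  rw [secsRes_secsRes, ASet.Hom.map_smul, pow_add, mul_smul]
  exact h5

/-- All members of the covering come from one chart, where the intersection of `j(D⁺(b))` and
`j(D⁺(b'))` is `j(D⁺(b * b'))`, so separation on it is already known. -/
theorem ext_Dop_of_le_imageOpen (hF : qcSet A.spec F) (f g : A.Sym) {B : GRing.{u}}
    (j : B.spec ⟶ A.spec) [PresheafedSpace.IsOpenImmersion j] {N : ASet B}
    (e : (PreOSet.restrict j).obj F ≅ (ASet.natural B).obj N)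
    (hg : Dop g ≤ imageOpen j ⊤) : F.Ext f (Dop g) := by
  refine ext_of_cover hF.1 f (isCompact_D g)
    (fun W => ∃ b c : B.Sym, PullEq j f c b ∧ W = imageOpen j (Dop b)) ?_ ?_ ?_
  · intro p hp
    obtain ⟨q, -, rfl⟩ := hg hp
    obtain ⟨b, c, hqb, hbc⟩ := exists_pullEq j f q
    obtain ⟨r, hqr, hr⟩ := exists_Dop
      (U := ⟨basePt j ⁻¹' D g, (isOpen_D g).preimage (continuous_basePt j)⟩) (p := q) hp
    refine ⟨imageOpen j (Dop (r * b)), ?_, ⟨q, mem_Dop_mul.2 ⟨hqr, hqb⟩, rfl⟩, _, _, hbc.mul r, rfl⟩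
    rintro _ ⟨x, hx, rfl⟩
    exact hr (mem_Dop_mul.1 hx).1
  · rintro _ ⟨b, c, hbc, rfl⟩
    exact ext_imageOpen_Dop e hbc
  · rintro _ _ ⟨b, c, hbc, rfl⟩ ⟨b', c', hbc', rfl⟩
    have h : imageOpen j (Dop b) ⊓ imageOpen j (Dop b') = imageOpen j (Dop (b * b')) := by
      ext p
      constructor
      · rintro ⟨⟨q, hq, rfl⟩, h'⟩
        exact ⟨q, mem_Dop_mul.2 ⟨hq, (basePt_mem_imageOpen j).1 h'⟩, rfl⟩
      · rintro ⟨q, hq, rfl⟩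
        exact ⟨⟨q, (mem_Dop_mul.1 hq).1, rfl⟩, ⟨q, (mem_Dop_mul.1 hq).2, rfl⟩⟩
    rw [h]
    exact sep_imageOpen_Dop e (hbc'.mul b)

/-- The covering consists of basic open sets `D⁺(h)` of `X`, each inside some chart. Images from
different charts have no controlled intersection, whereas `D⁺(h) ∩ D⁺(h') = D⁺(h * h')` is
quasi-compact and so satisfies separation; this is the reason for the intermediate case of a single
chart. -/
theorem ext_Dop (hF : qcSet A.spec F) (f g : A.Sym) : F.Ext f (Dop g) := by
  refine ext_of_cover hF.1 f (isCompact_D g)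
    (fun W => ∃ h : A.Sym, F.Ext f (Dop h) ∧ W = Dop h) ?_ ?_ ?_
  · intro p hp
    obtain ⟨B, j, _, -, ⟨q, rfl⟩, N, ⟨e⟩⟩ := hF.2 p
    obtain ⟨h, hph, hh⟩ := exists_Dop (U := imageOpen j ⊤ ⊓ Dop g) (p := basePt j q)
      ⟨⟨q, trivial, rfl⟩, hp⟩
    exact ⟨Dop h, hh.trans inf_le_right, hph, h,
      ext_Dop_of_le_imageOpen hF f h j e (hh.trans inf_le_left), rfl⟩
  · rintro _ ⟨h, hh, rfl⟩
    exact hh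
  · rintro _ _ ⟨h, -, rfl⟩ ⟨h', -, rfl⟩
    rw [← Dop_mul]
    exact sep_of_isCompact hF f (isCompact_D _)

theorem exists_pow_smul_eq_of_res_eq (hF : qcSet A.spec F) {f : A.Sym}
    {τ τ' : (F.secs ⊤).carrier}
    (h : (F.secsRes (le_top : Dop f ≤ ⊤)).toFun τ = (F.secsRes le_top).toFun τ') :
    ∃ n : ℕ, f ^ n • τ = f ^ n • τ' := by
  refine sep_of_isCompact hF f ?_ (Dop f) le_top inf_le_right τ τ' h
  rw [← Dop_one]
  exact isCompact_D 1

/-- Extension for `X = D⁺(1)`. With the previous lemma it identifies `F(D⁺(f))` with the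
localization of `F(X)` at the powers of `f`. -/
theorem exists_res_eq_pow_smul (hF : qcSet A.spec F) {f : A.Sym} (σ : (F.secs (Dop f)).carrier) :
    ∃ (n : ℕ) (τ : (F.secs ⊤).carrier),
      (F.secsRes (le_top : Dop f ≤ ⊤)).toFun τ = f ^ n • σ := by
  have h := ext_Dop hF f 1
  rw [Dop_one] at h
  exact h (Dop f) le_top le_rfl inf_le_right σ

end PreOSet

/-! ### The comparison of a quasi-coherent `𝒪_X`-set with the sheaf of its global sections -/

namespace PreOSet

variable {A : GRing.{u}} {F : PreOSet A.spec}

theorem exists_frac (hF : qcSet A.spec F) {U : Opens (PlusPrime A)} (n : (F.secs U).carrier)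
    {p : PlusPrime A} (hp : p ∈ U) :
    ∃ (s : A.Sym) (m : (F.secs ⊤).carrier) (h : Dop s ≤ U), p ∈ Dop s ∧
      (F.secsRes le_top).toFun m = s • (F.secsRes h).toFun n := by
  obtain ⟨t, hpt, ht⟩ := exists_Dop hp
  obtain ⟨k, τ, hτ⟩ := exists_res_eq_pow_smul hF ((F.secsRes ht).toFun n)
  have hle : Dop (t ^ (k + 1)) ≤ Dop t := fun q hq => by
    rw [pow_succ] at hq
    exact (mem_Dop_mul.1 hq).2
  -- The extra factor `t` makes the exponent positive, so that `D⁺(t ^ (k + 1))` lies in `D⁺(t)`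
  -- also when `k = 0`.
  refine ⟨t ^ (k + 1), t • τ, hle.trans ht, p.compl.pow_mem hpt _, ?_⟩
  have h := congrArg (F.secsRes hle).toFun hτ
  rw [secsRes_secsRes, ASet.Hom.map_smul, secsRes_secsRes] at h
  rw [ASet.Hom.map_smul, h]
  exact (smul_smul _ _ _).trans (congrArg (· • _) (pow_succ' t k).symm)

/-- Near `p` both `s' • m` and `s • m'` restrict to `s s' • n`, so they agree globally after
multiplication by a power of some `t` outside of `p`. The value `m / s` at `p` therefore does not
depend on the choices. -/
theorem frac_eq (hF : qcSet A.spec F) {U : Opens (PlusPrime A)} {n : (F.secs U).carrier}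
    {p : PlusPrime A} {W W' : Opens (PlusPrime A)} (hW : W ≤ U) (hW' : W' ≤ U) (hp : p ∈ W)
    (hp' : p ∈ W') {s s' : p.compl} {m m' : (F.secs ⊤).carrier}
    (h : (F.secsRes le_top).toFun m = s.1 • (F.secsRes hW).toFun n)
    (h' : (F.secsRes le_top).toFun m' = s'.1 • (F.secsRes hW').toFun n) :
    (Loc.mk m s : Loc p.compl (F.secs ⊤).carrier) = Loc.mk m' s' := by
  obtain ⟨t, hpt, ht⟩ := exists_Dop (U := W ⊓ W') ⟨hp, hp'⟩
  have h1 := congrArg (F.secsRes (ht.trans inf_le_left)).toFun h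
  have h1' := congrArg (F.secsRes (ht.trans inf_le_right)).toFun h'
  rw [secsRes_secsRes, ASet.Hom.map_smul, secsRes_secsRes] at h1 h1'
  obtain ⟨k, hk⟩ := exists_pow_smul_eq_of_res_eq hF (f := t) (τ := s'.1 • m) (τ' := s.1 • m') (by
    rw [ASet.Hom.map_smul, ASet.Hom.map_smul, h1, h1', smul_smul, smul_smul, mul_comm])
  exact Loc.mk_eq_mk.2 ⟨⟨t ^ k, p.compl.pow_mem hpt k⟩, hk⟩

/-- The section of `F(X)^♮` with value `m / s` where `s • n = m`. -/
noncomputable def toSections (hF : qcSet A.spec F) (U : Opens (PlusPrime A))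
    (n : (F.secs U).carrier) : Sec (F.secs ⊤).carrier U :=
  ⟨fun p => Loc.mk (exists_frac hF n p.2).choose_spec.choose ⟨(exists_frac hF n p.2).choose,
      (exists_frac hF n p.2).choose_spec.choose_spec.choose_spec.1⟩, fun p => by
    obtain ⟨s, m, h, hp, hm⟩ := exists_frac hF n p.2
    -- One pair `(s, m)` represents `n` at every point of `D⁺(s)`, whatever pairs were chosen there;
    -- this is local constancy.
    exact ⟨s, m, h, hp, fun q hq => frac_eq hF
      (exists_frac hF n (h hq)).choose_spec.choose_spec.choose h
      (exists_frac hF n (h hq)).choose_spec.choose_spec.choose_spec.1 hq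
      (exists_frac hF n (h hq)).choose_spec.choose_spec.choose_spec.2 hm⟩⟩

theorem toSections_eq (hF : qcSet A.spec F) {U : Opens (PlusPrime A)} {n : (F.secs U).carrier}
    (p : U) {W : Opens (PlusPrime A)} (hW : W ≤ U) (hp : p.1 ∈ W) {s : p.1.compl}
    {m : (F.secs ⊤).carrier} (h : (F.secsRes le_top).toFun m = s.1 • (F.secsRes hW).toFun n) :
    (toSections hF U n).1 p = Loc.mk m s :=
  frac_eq hF (exists_frac hF n p.2).choose_spec.choose_spec.choose hW
    (exists_frac hF n p.2).choose_spec.choose_spec.choose_spec.1 hp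
    (exists_frac hF n p.2).choose_spec.choose_spec.choose_spec.2 h

theorem toSections_res (hF : qcSet A.spec F) {U V : Opens (PlusPrime A)} (h : V ≤ U)
    (n : (F.secs U).carrier) :
    toSections hF V ((F.secsRes h).toFun n) = Sec.res h (toSections hF U n) :=
  Sec.ext fun p => by
    obtain ⟨s, m, hs, hp, hm⟩ := exists_frac hF ((F.secsRes h).toFun n) p.2
    rw [toSections_eq hF p hs hp (s := ⟨s, hp⟩) hm]
    rw [secsRes_secsRes] at hm
    exact (toSections_eq hF ⟨p.1, h p.2⟩ (hs.trans h) hp (s := ⟨s, hp⟩) hm).symm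

/-- Equal fractions `m / s = m' / s'` at `p` give `r s s' • n = r s s' • n'` on `D⁺(r * (s * s'))`,
where the factor is invertible; so the sections agree near each point. -/
theorem toSections_injective (hF : qcSet A.spec F) (U : Opens (PlusPrime A)) :
    Function.Injective (toSections hF U) := by
  intro n n' h
  refine hF.1.eq_of_locally fun p hp => ?_
  obtain ⟨s, m, hs, hps, hm⟩ := exists_frac hF n hp
  obtain ⟨s', m', hs', hps', hm'⟩ := exists_frac hF n' hp
  have h1 := congrFun (congrArg Subtype.val h) ⟨p, hp⟩
  rw [toSections_eq hF ⟨p, hp⟩ hs hps (s := ⟨s, hps⟩) hm,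
    toSections_eq hF ⟨p, hp⟩ hs' hps' (s := ⟨s', hps'⟩) hm'] at h1
  obtain ⟨r, hr⟩ := Loc.mk_eq_mk.1 h1
  have hle : Dop (r.1 * (s * s')) ≤ Dop s := fun q hq => (mem_Dop_mul.1 (mem_Dop_mul.1 hq).2).1
  have hle' : Dop (r.1 * (s * s')) ≤ Dop s' := fun q hq => (mem_Dop_mul.1 (mem_Dop_mul.1 hq).2).2
  refine ⟨Dop (r.1 * (s * s')), hle.trans hs, p.compl.mul_mem r.2 (p.compl.mul_mem hps hps'),
    smul_injective le_rfl ?_⟩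
  have h2 := congrArg (F.secsRes (le_top : Dop (r.1 * (s * s')) ≤ ⊤)).toFun hr
  have h3 := congrArg (F.secsRes hle).toFun hm
  have h3' := congrArg (F.secsRes hle').toFun hm'
  simp only [secsRes_secsRes, ASet.Hom.map_smul] at h2 h3 h3'
  rw [h3, h3', smul_smul, smul_smul, smul_smul, smul_smul] at h2
  have h4 : r.1 * s' * s = r.1 * (s * s') := by rw [mul_assoc, mul_comm s]
  exact ((congrArg (· • _) h4).symm.trans h2).trans (congrArg (· • _) (mul_assoc _ _ _))

/-- A local fraction `m / s` is the image of the section of `F` over `D⁺(s)` obtained by dividing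
`m` by `s`. By injectivity these sections agree on overlaps, and they glue. -/
theorem toSections_surjective (hF : qcSet A.spec F) (U : Opens (PlusPrime A)) :
    Function.Surjective (toSections hF U) := by
  intro σ
  choose s m hs hps hm using σ.2
  choose n hn using fun p : U => exists_smul_eq (F := F) (le_refl (Dop (s p)))
    ((F.secsRes le_top).toFun (m p))
  have hval : ∀ (p : U) {V : Opens (PlusPrime A)} (hV : V ≤ Dop (s p)) (q : V),
      (toSections hF V ((F.secsRes hV).toFun (n p))).1 q = σ.1 ⟨q.1, hs p q.1 (hV q.2)⟩ := by
    intro p V hV q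
    refine (toSections_eq hF q le_rfl q.2 (s := ⟨s p, hV q.2⟩) (m := m p) ?_).trans
      (hm p q.1 (hV q.2)).symm
    have h := congrArg (F.secsRes hV).toFun (hn p)
    rw [secsRes_secsRes, ASet.Hom.map_smul] at h
    rw [secsRes_refl]
    exact h.symm
  obtain ⟨y, hy⟩ := hF.1.exists_glue (V := fun p : U => Dop (s p)) hs
    (fun p hp => ⟨⟨p, hp⟩, hps ⟨p, hp⟩⟩) n
    (fun p q => toSections_injective hF _ (Sec.ext fun x => (hval p _ x).trans (hval q _ x).symm))
  refine ⟨y, Sec.ext fun p => ?_⟩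
  have h := hval p (le_refl (Dop (s p))) ⟨p, hps p⟩
  rw [secsRes_refl, ← hy p] at h
  exact (congrFun (congrArg Subtype.val (toSections_res hF (show Dop (s p) ≤ U from hs p) y))
    ⟨p, hps p⟩).symm.trans h

theorem toSections_zero (hF : qcSet A.spec F) (U : Opens (PlusPrime A)) :
    toSections hF U (F.secs U).zero = Sec.const U (F.secs ⊤).zero :=
  Sec.ext fun p => toSections_eq hF p le_rfl p.2 (s := 1) (by
    rw [ASet.Hom.map_zero, ASet.Hom.map_zero, ASet.smul_zero])

/-- Linearity is over the structure sheaf and not only over `A`. Near `p` the coefficients are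
fractions, so clearing denominators reduces the claim to the action of `A` on global sections. -/
theorem toSections_act (hF : qcSet A.spec F) (U : Opens (PlusPrime A)) {X : Type} [Finite X]
    (b d : (A.sec U).obj X) (n : X → (F.secs U).carrier) :
    toSections hF U ((F.osecs U).act b n d) =
      ((F.secs ⊤).sec U).act b (fun x => toSections hF U (n x)) d := by
  classical
  have := Fintype.ofFinite X
  refine Sec.ext fun p => ?_
  obtain ⟨s, b', h1, h2, h3⟩ := b.2 p
  obtain ⟨r, d', h1', h2', h3'⟩ := d.2 p
  choose t m ht hpt hm using fun x => exists_frac hF (n x) p.2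
  -- The finitely many arguments get the common denominator `∏ x, t x`, with cofactors `v x`.
  choose v hv using fun x => Finset.dvd_prod_of_mem t (Finset.mem_univ x)
  have hT : p.1 ∈ Dop (∏ x, t x) := p.1.compl.prod_mem fun x _ => hpt x
  let W : Opens (PlusPrime A) := Dop s ⊓ Dop (∏ x, t x) ⊓ Dop r
  have hW : W ≤ U := (inf_le_left.trans inf_le_left).trans h1
  have hWt : ∀ x, W ≤ Dop (t x) := fun x q hq => mem_Dop_of_dvd ⟨v x, hv x⟩ hq.1.2
  have hval : ∀ x, (toSections hF U (n x)).1 p = Loc.mk (v x • m x) ⟨∏ x, t x, hT⟩ := fun x => by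
    rw [toSections_eq hF p (ht x) (hpt x) (s := ⟨t x, hpt x⟩) (hm x)]
    exact (Loc.mk_smul _ _ _ _ ((hv x).trans (mul_comm _ _))).symm
  -- A coefficient that is `c / g` on `D⁺(g)` becomes the constant section `c` on `W` when
  -- multiplied by `g`.
  have hsec : ∀ (a : (A.sec U).obj X) (c : A.obj X) (g : A.Sym) (hg : W ≤ Dop g) (h : ∀ q ∈ D g, q ∈ U),
      (∀ (q : PlusPrime A) (hq : q ∈ D g), a.1 ⟨q, h q hq⟩ = Loc.mk c ⟨g, hq⟩) →
      Sec.const W c =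
        HSMul.hSMul (β := (A.sec W).obj X) (symMap (A.toSec W) g) (Sec.res hW a) := by
    intro a c g hg h ha
    refine Sec.ext fun q => ?_
    refine Eq.trans ?_ (congrArg (fun x => (A.loc q.1.compl).sc (Loc.mk g.1 1) x)
      (ha q.1 (hg q.2))).symm
    refine Eq.trans ?_ (loc_sc q.1.compl g.1 c 1 ⟨g, hg q.2⟩).symm
    exact (Loc.mk_smul c _ _ g (by simp)).symm
  -- The product of all denominators times the element is the restriction of a global section, which
  -- is exactly the data that determine its value under `toSections`.
  have hfr : (F.secsRes (le_top : W ≤ ⊤)).toFun ((F.secs ⊤).act b' (fun x => v x • m x) d') =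
      (s * (∏ x, t x) * r) • (F.secsRes hW).toFun ((F.osecs U).act b n d) := by
    have hb := hsec b b' s (inf_le_left.trans inf_le_left) h1 h3
    have hd := hsec d d' r inf_le_right h1' h3'
    have hn : ∀ x, (F.secsRes (le_top : W ≤ ⊤)).toFun (v x • m x) =
        (∏ x, t x) • (F.secsRes hW).toFun (n x) := fun x => by
      have h := congrArg (F.secsRes (hWt x)).toFun (hm x)
      rw [secsRes_secsRes, ASet.Hom.map_smul, secsRes_secsRes] at h
      rw [ASet.Hom.map_smul, h]
      exact (smul_smul _ _ _).trans (congrArg (· • _) ((mul_comm _ _).trans (hv x).symm))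
    refine ((F.secsRes (le_top : W ≤ ⊤)).map_act _ _ _).trans ?_
    rw [mul_smul, mul_smul]
    refine (congr (congrArg₂ (fun b m => (F.osecs W).act b m) hb (funext hn)) hd).trans ?_
    refine ((F.osecs W).act_smul_left _ _ _ _).trans (congrArg (symMap (A.toSec W) s • ·) ?_)
    refine ((F.osecs W).act_smul_mid (symMap (A.toSec W) (∏ x, t x)) _ _ _).trans
      (congrArg (symMap (A.toSec W) (∏ x, t x) • ·) ?_)
    refine ((F.osecs W).act_smul_right _ _ _ _).trans (congrArg (symMap (A.toSec W) r • ·) ?_)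
    exact (F.res_act hW b n d).symm
  rw [toSections_eq hF p hW ⟨⟨h2, hT⟩, h2'⟩
    (s := ⟨s, h2⟩ * ⟨∏ x, t x, hT⟩ * ⟨r, h2'⟩) hfr]
  refine ((F.secs ⊤).locAct_mk b' d' (fun x => v x • m x) _ _ _).symm.trans ?_
  exact congr (congrArg₂ ((F.secs ⊤).locAct p.1.compl) (h3 p.1 h2).symm
    (funext fun x => (hval x).symm)) (h3' p.1 h2').symm

end PreOSet

/-! ### The sheaf property and the global sections of `M^♮` -/

namespace PreOSet

variable {X : PresheafedSpace GRing.{u}} {M N : PreOSet X}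

/-- A bijective map of presheaves of `𝒪_X`-sets is an isomorphism. -/
noncomputable def isoOfBijective (φ : M ⟶ N)
    (h : ∀ U, Function.Bijective (φ.app U).toFun) : M ≅ N where
  hom := φ
  inv :=
    { app := fun U =>
        { toFun := (Equiv.ofBijective _ (h U)).symm
          map_zero := (Equiv.ofBijective _ (h U)).injective (by
            rw [Equiv.apply_symm_apply]
            exact (φ.app U).map_zero.symm)
          map_act := fun b m d => (Equiv.ofBijective _ (h U)).injective (by
            rw [Equiv.apply_symm_apply]
            refine Eq.trans ?_ ((φ.app U).map_act b _ d).symm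
            congr 1
            exact funext fun x => ((Equiv.ofBijective _ (h U)).apply_symm_apply (m x)).symm) }
      app_res := fun {U V} hVU m => (Equiv.ofBijective _ (h V)).injective (by
        rw [Equiv.apply_symm_apply]
        refine Eq.trans ?_ (φ.app_res hVU _).symm
        congr 1
        exact ((Equiv.ofBijective _ (h U)).apply_symm_apply m).symm) }
  hom_inv_id := hom_ext _ _ fun U => ASet.hom_ext _ _ fun m =>
    (Equiv.ofBijective _ (h U)).symm_apply_apply m
  inv_hom_id := hom_ext _ _ fun U => ASet.hom_ext _ _ fun m =>
    (Equiv.ofBijective _ (h U)).apply_symm_apply m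

/-- A map commutes with restriction and with scalars of `A`, so it sends data `s • n = m` for `n` to
such data for its image, with the same `s`. -/
theorem toSections_naturality {A : GRing.{u}} {F F' : PreOSet A.spec} (hF : qcSet A.spec F)
    (hF' : qcSet A.spec F') (φ : F ⟶ F') (U : Opens (PlusPrime A)) (n : (F.secs U).carrier) :
    toSections hF' U ((φ.app U).toFun n) =
      ((((ASet.natural A).map ((ASet.globalSections A).map φ)).app U).toFun
        (toSections hF U n) : Sec (F'.secs ⊤).carrier U) := by
  refine Sec.ext fun p => ?_
  obtain ⟨s, m, hs, hps, hm⟩ := exists_frac hF n p.2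
  let ψ : ∀ V : Opens (PlusPrime A), F.secs V ⟶ F'.secs V := fun V =>
    (ASet.restrictScalars (A.toSec V)).map (φ.app V)
  have hψ : ∀ {V W : Opens (PlusPrime A)} (h : W ≤ V) (x : (F.secs V).carrier),
      (ψ W).toFun ((F.secsRes h).toFun x) = (F'.secsRes h).toFun ((ψ V).toFun x) :=
    fun h x => φ.app_res h x
  have h := congrArg (ψ (Dop s)).toFun hm
  rw [ASet.Hom.map_smul, hψ, hψ] at h
  refine (toSections_eq hF' p hs hps (s := ⟨s, hps⟩) h).trans ?_
  exact (congrArg (ASet.locHom p.1.compl (ψ ⊤))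
    (toSections_eq hF p hs hps (s := ⟨s, hps⟩) hm)).symm

/-- The restriction along the identity. -/
noncomputable def restrictIdIso (X : PresheafedSpace GRing.{u}) :
    restrict (𝟙 X) ≅ 𝟭 (PreOSet X) :=
  -- The image of `U` under the identity equals `U` only propositionally, so the comparison map is
  -- restriction along the inequality; `hinv` says that it undoes the identification of structure
  -- sections.
  have himg : ∀ U : Opens X,
      (PresheafedSpace.IsOpenImmersion.opensFunctor (𝟙 X)).obj U = U := fun U =>
    Opens.ext (Set.image_id _)
  have hinv : ∀ (U : Opens X) (I : Type) [Finite I] (b : (X.presheaf.obj (op U)).obj I),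
      (X.presheaf.map (homOfLE (himg U).ge).op).app I
        ((PresheafedSpace.IsOpenImmersion.invApp (𝟙 X) U).app I b) = b := fun U I _ b => by
    have h := congrArg (fun ψ => GRing.Hom.app ψ I b)
      (PresheafedSpace.IsOpenImmersion.invApp_app (𝟙 X) U)
    rw [PresheafedSpace.id_c_app, X.presheaf.map_id] at h
    refine (congrArg ((X.presheaf.map (homOfLE (himg U).ge).op).app I) h).trans ?_
    refine (congrArg (fun ψ => GRing.Hom.app ψ I b) (X.presheaf.map_comp _ _)).symm.trans ?_
    exact congrArg (fun ψ => GRing.Hom.app ψ I b) (X.presheaf.map_id (op U))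
  NatIso.ofComponents (fun M => isoOfBijective
    { app := fun U =>
        { toFun := M.res (himg U).ge
          map_zero := M.res_zero _
          map_act := fun b m d => by
            refine (M.res_act (himg U).ge _ m _).trans ?_
            rw [hinv, hinv]
            rfl }
      app_res := fun h m => (M.res_res _ _ _).trans (M.res_res _ _ _).symm }
    fun U => Function.bijective_iff_has_inverse.2 ⟨M.res (himg U).le,
      fun m => (M.res_res _ _ _).trans (M.res_refl _ _),
      fun m => (M.res_res _ _ _).trans (M.res_refl _ _)⟩)
    fun φ => hom_ext _ _ fun U => ASet.hom_ext _ _ fun m => (φ.app_res _ _).symm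

end PreOSet

/-! ### The unit and the counit of the equivalence -/

namespace ASet

variable {A : GRing.{u}}

/-- Sections are functions subject to a local condition, so compatible ones glue pointwise; the
chosen index at a point does not matter because the values agree on intersections. -/
theorem isSheaf_natural (M : ASet A) : ((natural A).obj M).IsSheaf := by
  intro ι U V hV hU m hm
  have hU' : ∀ p : U, ∃ i, p.1 ∈ V i := fun p => Opens.mem_iSup.1 (hU p.2)
  choose i hi using hU'
  have hmem : ∀ (k l : ι) (p : PlusPrime A) (hk : p ∈ V k) (hl : p ∈ V l),
      (m k).1 ⟨p, hk⟩ = (m l).1 ⟨p, hl⟩ := fun k l p hk hl =>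
    congrFun (congrArg Subtype.val (hm k l)) ⟨p, hk, hl⟩
  refine ⟨⟨fun p => (m (i p)).1 ⟨p.1, hi p⟩, fun p => ?_⟩, fun k => Sec.ext fun p => hmem _ _ _ _ _,
    fun n hn => Sec.ext fun p => congrFun (congrArg Subtype.val (hn (i p))) ⟨p.1, hi p⟩⟩
  obtain ⟨s, x, h1, h2, h3⟩ := (m (i p)).2 ⟨p.1, hi p⟩
  exact ⟨s, x, fun q hq => hV _ (h1 q hq), h2, fun q hq => (hmem (i ⟨q, hV _ (h1 q hq)⟩) (i p) q (hi _) (h1 q hq)).trans (h3 q hq)⟩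

/-- The map from an `A`-set to the global sections of its sheaf. -/
noncomputable def toGlobal (M : ASet A) : M ⟶ (globalSections A).obj ((natural A).obj M) where
  toFun m := Sec.const ⊤ m
  map_zero := rfl
  map_act b m d := Sec.ext fun p => by
    refine Eq.trans ?_ (M.locAct_mk b d m 1 1 1).symm
    rw [mul_one, mul_one]
    rfl

/-- The case `b = 1` of `exists_pow_smul_eq` and `exists_eq_mk`, where all powers of `b` are
trivial. -/
theorem toGlobal_bijective (M : ASet A) : Function.Bijective (toGlobal M).toFun := by
  constructor
  · intro m m' h
    obtain ⟨n, hn⟩ := M.exists_pow_smul_eq (b := 1) (m := m) (m' := m') fun p hp => by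
      obtain ⟨r, hr⟩ := Loc.mk_eq_mk.1 (congrFun (congrArg Subtype.val h) ⟨p, trivial⟩)
      exact ⟨r.1, r.2, by simpa using hr⟩
    simpa using hn
  · intro σ
    obtain ⟨n, m, hm⟩ := M.exists_eq_mk (b := 1) (Sec.res le_top σ)
    refine ⟨m, Sec.ext fun p => ((hm p.1 p.1.compl.one_mem).trans ?_).symm⟩
    congr 1
    exact Subtype.ext (one_pow n)

/-- A bijective map of `A`-sets is an isomorphism. -/
noncomputable def isoOfBijective {M N : ASet A} (φ : M ⟶ N) (h : Function.Bijective φ.toFun) :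
    M ≅ N where
  hom := φ
  inv :=
    { toFun := (Equiv.ofBijective _ h).symm
      map_zero := (Equiv.ofBijective _ h).injective (by
        rw [Equiv.apply_symm_apply]
        exact φ.map_zero.symm)
      map_act := fun b m d => (Equiv.ofBijective _ h).injective (by
        rw [Equiv.apply_symm_apply]
        refine Eq.trans ?_ (φ.map_act b _ d).symm
        congr 1
        exact funext fun x => ((Equiv.ofBijective _ h).apply_symm_apply (m x)).symm) }
  hom_inv_id := hom_ext _ _ fun m => (Equiv.ofBijective _ h).symm_apply_apply m
  inv_hom_id := hom_ext _ _ fun m => (Equiv.ofBijective _ h).apply_symm_apply m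

/-- An `A`-set is the set of global sections of its sheaf. -/
noncomputable def unitIso (A : GRing.{u}) : 𝟭 (ASet A) ≅ natural A ⋙ globalSections A :=
  NatIso.ofComponents (fun M => isoOfBijective (toGlobal M) (toGlobal_bijective M))
    fun φ => hom_ext _ _ fun _ => rfl

/-- A quasi-coherent `𝒪_X`-set is the sheaf of its global sections. -/
noncomputable def counitIso (A : GRing.{u}) :
    (qcSet A.spec).ι ≅ (qcSet A.spec).ι ⋙ globalSections A ⋙ natural A :=
  NatIso.ofComponents (fun F => PreOSet.isoOfBijective
    { app := fun U =>
        { toFun := PreOSet.toSections F.2 U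
          map_zero := PreOSet.toSections_zero F.2 U
          map_act := fun b m d => PreOSet.toSections_act F.2 U b d m }
      app_res := fun h m => PreOSet.toSections_res F.2 h m }
    fun U => ⟨PreOSet.toSections_injective F.2 U, PreOSet.toSections_surjective F.2 U⟩)
    fun {F F'} φ => PreOSet.hom_ext _ _ fun U => hom_ext _ _ fun n =>
      PreOSet.toSections_naturality F.2 F'.2 φ.hom U n

end ASet

/-! ### Equivalences with full subcategories, and their prolongations -/

section Prolongation

universe v₁ v₂ v₃ w₁ w₂ w₃

variable {C : Type w₁} [Category.{v₁} C] {D : Type w₂} [Category.{v₂} D]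
  {J : Type w₃} [Category.{v₃} J]

/-- The objects of a functor category with values in `P`. -/
def pointwise (J : Type w₃) [Category.{v₃} J] (P : ObjectProperty D) : ObjectProperty (J ⥤ D) :=
  fun M => ∀ k, P (M.obj k)

/-- `P` is a class on which the counit is known to be invertible, and `Q` may be smaller, provided
that `F` takes values in it. This fits quasi-coherence in all degrees at once, with common charts,
inside degreewise quasi-coherence. No triangle identity is needed, since a unit can always be
adjusted. -/
theorem exists_equivalence {F : C ⥤ D} {G : D ⥤ C} {P Q : ObjectProperty D}
    (η : 𝟭 C ≅ F ⋙ G) (ε : P.ι ≅ P.ι ⋙ G ⋙ F) (hQ : Q ≤ P) (hF : ∀ M, Q (F.obj M)) :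
    ∃ e : C ≌ Q.FullSubcategory,
      Nonempty (e.functor ⋙ Q.ι ≅ F) ∧ Nonempty (e.inverse ≅ Q.ι ⋙ G) :=
  ⟨CategoryTheory.Equivalence.mk (Q.lift F hF) (Q.ι ⋙ G) η
    (NatIso.ofComponents (fun M => Q.isoMk (ε.app ⟨M.obj, hQ _ M.property⟩).symm) fun {M N} φ => by
      apply ObjectProperty.hom_ext
      exact ε.inv.naturality
        (ObjectProperty.homMk φ.hom : (⟨M.obj, hQ _ M.property⟩ : P.FullSubcategory) ⟶
          ⟨N.obj, hQ _ N.property⟩)),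
    ⟨Q.liftCompιIso F hF⟩, ⟨Iso.refl _⟩⟩

/-- The prolongation of a unit isomorphism to functor categories. -/
def pointwiseUnit (J : Type w₃) [Category.{v₃} J] {F : C ⥤ D} {G : D ⥤ C} (η : 𝟭 C ≅ F ⋙ G) :
    𝟭 (J ⥤ C) ≅ (Functor.whiskeringRight J C D).obj F ⋙ (Functor.whiskeringRight J D C).obj G :=
  NatIso.ofComponents (fun M => NatIso.ofComponents (fun k => η.app (M.obj k))
    fun f => η.hom.naturality (M.map f))
    fun φ => NatTrans.ext (funext fun k => η.hom.naturality (φ.app k))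

/-- The prolongation of a counit isomorphism to functor categories. -/
def pointwiseCounit (J : Type w₃) [Category.{v₃} J] {F : C ⥤ D} {G : D ⥤ C}
    {P : ObjectProperty D} (ε : P.ι ≅ P.ι ⋙ G ⋙ F) :
    (pointwise J P).ι ≅ (pointwise J P).ι ⋙
      (Functor.whiskeringRight J D C).obj G ⋙ (Functor.whiskeringRight J C D).obj F :=
  NatIso.ofComponents
    (fun M => NatIso.ofComponents (fun k => ε.app ⟨M.obj.obj k, M.property k⟩)
      fun {k l} f => ε.hom.naturality
        (ObjectProperty.homMk (M.obj.map f) :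
          (⟨M.obj.obj k, M.property k⟩ : P.FullSubcategory) ⟶ ⟨M.obj.obj l, M.property l⟩))
    fun {M N} φ => NatTrans.ext (funext fun k => ε.hom.naturality
      (ObjectProperty.homMk (φ.hom.app k) :
        (⟨M.obj.obj k, M.property k⟩ : P.FullSubcategory) ⟶ ⟨N.obj.obj k, N.property k⟩))

end Prolongation

/-! ### Prolongation to symmetric spectra -/

namespace SymSpec

universe v₁ v₂ w₁ w₂

variable {C : Type w₁} [Category.{v₁} C] [Limits.HasZeroMorphisms C]
  {D : Type w₂} [Category.{v₂} D] [Limits.HasZeroMorphisms D]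

/-- An isomorphism of symmetric sequences that preserves the action is an isomorphism of symmetric
spectra. -/
def isoMk {M N : SymSpec C} (e : M.seq ≅ N.seq)
    (h : ∀ {p q : ℕ} {k : SimplexCategory} (x : ((sphere.obj ⟨p⟩).obj (op k)).X),
      M.act x ≫ (e.hom.app ⟨p + q⟩).app (op k) = (e.hom.app ⟨q⟩).app (op k) ≫ N.act x) : M ≅ N where
  hom := ⟨e.hom, h⟩
  -- The inverse preserves the action: the relation for `e.hom` is composed with `e.inv` on both
  -- sides.
  inv := ⟨e.inv, fun {p q k} x => by
    have h1 : ∀ n : SymIndex,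
        (e.inv.app n).app (op k) ≫ (e.hom.app n).app (op k) = 𝟙 ((N.seq.obj n).obj (op k)) :=
      fun n => congrArg (fun φ : N.seq ⟶ N.seq => (φ.app n).app (op k)) e.inv_hom_id
    have h2 : ∀ n : SymIndex,
        (e.hom.app n).app (op k) ≫ (e.inv.app n).app (op k) = 𝟙 ((M.seq.obj n).obj (op k)) :=
      fun n => congrArg (fun φ : M.seq ⟶ M.seq => (φ.app n).app (op k)) e.hom_inv_id
    calc N.act x ≫ (e.inv.app ⟨p + q⟩).app (op k)
        = (e.inv.app ⟨q⟩).app (op k) ≫ ((e.hom.app ⟨q⟩).app (op k) ≫ N.act x) ≫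
            (e.inv.app ⟨p + q⟩).app (op k) := by
          rw [Category.assoc, ← Category.assoc (_ : _ ⟶ _) ((e.hom.app ⟨q⟩).app (op k)), h1,
            Category.id_comp]
      _ = (e.inv.app ⟨q⟩).app (op k) ≫ M.act x := by
          rw [← h x, Category.assoc, h2, Category.comp_id]⟩
  hom_inv_id := Hom.ext e.hom_inv_id
  inv_hom_id := Hom.ext e.inv_hom_id

/-- The prolongation of an isomorphism of functors to symmetric spectra. -/
def mapSpecIso {F G : C ⥤ D} [F.PreservesZeroMorphisms] [G.PreservesZeroMorphisms] (e : F ≅ G) :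
    mapSpec F ≅ mapSpec G :=
  NatIso.ofComponents (fun M => isoMk
    (NatIso.ofComponents (fun n => NatIso.ofComponents (fun k => e.app ((M.seq.obj n).obj k))
      fun f => e.hom.naturality _) fun f => NatTrans.ext (funext fun k => e.hom.naturality _))
    fun x => e.hom.naturality (M.act x))
    fun φ => Hom.ext (NatTrans.ext (funext fun n => NatTrans.ext (funext fun k =>
      e.hom.naturality _)))

/-- The symmetric spectra with values in `P`. -/
def levelwise (P : ObjectProperty D) : ObjectProperty (SymSpec D) :=
  fun M => ∀ n k, P ((M.seq.obj n).obj k)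

/-- The prolongation of a unit isomorphism to symmetric spectra. -/
def mapSpecUnit {F : C ⥤ D} {G : D ⥤ C} [F.PreservesZeroMorphisms] [G.PreservesZeroMorphisms]
    (η : 𝟭 C ≅ F ⋙ G) : 𝟭 (SymSpec C) ≅ mapSpec F ⋙ mapSpec G :=
  NatIso.ofComponents (fun M => isoMk
    (NatIso.ofComponents (fun n => NatIso.ofComponents (fun k => η.app ((M.seq.obj n).obj k))
      fun f => η.hom.naturality _) fun f => NatTrans.ext (funext fun k => η.hom.naturality _))
    fun x => η.hom.naturality (M.act x))
    fun φ => Hom.ext (NatTrans.ext (funext fun n => NatTrans.ext (funext fun k =>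
      η.hom.naturality _)))

/-- The prolongation of a counit isomorphism to symmetric spectra. -/
def mapSpecCounit {F : C ⥤ D} {G : D ⥤ C} [F.PreservesZeroMorphisms] [G.PreservesZeroMorphisms]
    {P : ObjectProperty D} (ε : P.ι ≅ P.ι ⋙ G ⋙ F) :
    (levelwise P).ι ≅ (levelwise P).ι ⋙ mapSpec G ⋙ mapSpec F :=
  -- The structure maps of a spectrum are maps of `D` between objects with `P`; this restates
  -- naturality of the counit for them, without the wrapping of the full subcategory.
  have hε : ∀ {X Y : D} (hX : P X) (hY : P Y) (f : X ⟶ Y),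
      f ≫ ε.hom.app ⟨Y, hY⟩ = ε.hom.app ⟨X, hX⟩ ≫ F.map (G.map f) := fun {X Y} hX hY f =>
    ε.hom.naturality (ObjectProperty.homMk f : (⟨X, hX⟩ : P.FullSubcategory) ⟶ ⟨Y, hY⟩)
  NatIso.ofComponents (fun M => isoMk
    (NatIso.ofComponents
      (fun n => NatIso.ofComponents (fun k => ε.app ⟨(M.obj.seq.obj n).obj k, M.property n k⟩)
        fun f => hε _ _ _) fun f => NatTrans.ext (funext fun k => hε _ _ _))
    fun x => hε _ _ _)
    fun φ => Hom.ext (NatTrans.ext (funext fun n => NatTrans.ext (funext fun k =>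
      hε _ _ _)))

end SymSpec

/-! ### Quasi-coherence of the sheaves `M^♮` -/

section Natural

variable {A : GRing.{u}}

/-- The restriction of `M^♮` along the identity. -/
noncomputable def naturalRestrictIdIso (A : GRing.{u}) :
    ASet.natural A ⋙ PreOSet.restrict (𝟙 A.spec) ≅ ASet.natural A :=
  Functor.isoWhiskerLeft (ASet.natural A) (PreOSet.restrictIdIso A.spec)

/-- Commutativity of `A` makes `spec⁺(A)` itself an admissible chart, and the identity alone covers.
-/
theorem hasAffineCover_of_id (hA : A.IsComm)
    {P : ∀ (B : GRing.{u}) (j : B.spec ⟶ A.spec) [PresheafedSpace.IsOpenImmersion j], Prop}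
    (h : P A (𝟙 A.spec)) : HasAffineCover A.spec P :=
  fun x => ⟨A, 𝟙 A.spec, inferInstance, hA, ⟨x, rfl⟩, h⟩

theorem qcSet_natural (hA : A.IsComm) (M : ASet A) : qcSet A.spec ((ASet.natural A).obj M) :=
  ⟨M.isSheaf_natural, hasAffineCover_of_id hA ⟨M, ⟨(naturalRestrictIdIso A).app M⟩⟩⟩

theorem qcSimplicial_natural (hA : A.IsComm) (M : SimplicialObject (ASet A)) :
    qcSimplicial A.spec (((SimplicialObject.whiskering _ _).obj (ASet.natural A)).obj M) :=
  ⟨fun k => (M.obj k).isSheaf_natural, hasAffineCover_of_id hA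
    ⟨M, ⟨((SimplicialObject.whiskering _ _).mapIso (naturalRestrictIdIso A)).app M⟩⟩⟩

theorem qcSymSeq_natural (hA : A.IsComm) (M : SymSeq (ASet A)) :
    qcSymSeq A.spec ((mapSeq (ASet.natural A)).obj M) :=
  ⟨fun n k => ((M.obj n).obj k).isSheaf_natural, hasAffineCover_of_id hA
    ⟨M, ⟨((Functor.whiskeringRight SymIndex _ _).mapIso
      ((SimplicialObject.whiskering _ _).mapIso (naturalRestrictIdIso A))).app M⟩⟩⟩

theorem qcSymSpec_natural (hA : A.IsComm) (M : SymSpec (ASet A)) :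
    qcSymSpec A.spec ((SymSpec.mapSpec (ASet.natural A)).obj M) :=
  ⟨fun n k => ((M.seq.obj n).obj k).isSheaf_natural, hasAffineCover_of_id hA
    ⟨M, ⟨(SymSpec.mapSpecIso (naturalRestrictIdIso A)).app M⟩⟩⟩

theorem HasAffineCover.mono {X : PresheafedSpace GRing.{u}}
    {P Q : ∀ (B : GRing.{u}) (j : B.spec ⟶ X) [PresheafedSpace.IsOpenImmersion j], Prop}
    (h : HasAffineCover X P)
    (hPQ : ∀ (B : GRing.{u}) (j : B.spec ⟶ X) [PresheafedSpace.IsOpenImmersion j], P B j → Q B j) :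
    HasAffineCover X Q := fun x => by
  obtain ⟨B, j, hj, hB, hx, hP⟩ := h x
  exact ⟨B, j, hj, hB, hx, hPQ B j hP⟩

/-- A chart for the whole simplicial object is a chart in each degree. -/
theorem qcSimplicial_le (X : PresheafedSpace GRing.{u}) :
    qcSimplicial X ≤ pointwise SimplexCategoryᵒᵖ (qcSet X) := fun _ hM k =>
  ⟨hM.1 k, hM.2.mono fun _ _ _ ⟨N, ⟨e⟩⟩ => ⟨N.obj k, ⟨e.app k⟩⟩⟩

theorem qcSymSeq_le (X : PresheafedSpace GRing.{u}) :
    qcSymSeq X ≤ pointwise SymIndex (pointwise SimplexCategoryᵒᵖ (qcSet X)) := fun _ hM n k =>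
  ⟨hM.1 n k, hM.2.mono fun _ _ _ ⟨N, ⟨e⟩⟩ => ⟨(N.obj n).obj k, ⟨(e.app n).app k⟩⟩⟩

/-- The components of an isomorphism of symmetric spectra. -/
def SymSpec.appIso {C : Type*} [Category C] [Limits.HasZeroMorphisms C] {M N : SymSpec C}
    (e : M ≅ N) (n : SymIndex) (k : SimplexCategoryᵒᵖ) :
    (M.seq.obj n).obj k ≅ (N.seq.obj n).obj k where
  hom := (e.hom.toSeq.app n).app k
  inv := (e.inv.toSeq.app n).app k
  hom_inv_id := congrArg (fun φ : M ⟶ M => (φ.toSeq.app n).app k) e.hom_inv_id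
  inv_hom_id := congrArg (fun φ : N ⟶ N => (φ.toSeq.app n).app k) e.inv_hom_id

theorem qcSymSpec_le (X : PresheafedSpace GRing.{u}) :
    qcSymSpec X ≤ SymSpec.levelwise (qcSet X) := fun _ hM n k =>
  ⟨hM.1 n k, hM.2.mono fun _ _ _ ⟨N, ⟨e⟩⟩ => ⟨(N.seq.obj n).obj k, ⟨SymSpec.appIso e n k⟩⟩⟩

end Natural

theorem mainTheorem6 (A : GRing.{u}) (hA : A.IsComm) :
    (∃ e : ASet A ≌ (qcSet A.spec).FullSubcategory,
      Nonempty (e.functor ⋙ (qcSet A.spec).ι ≅ ASet.natural A) ∧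
      Nonempty (e.inverse ≅ (qcSet A.spec).ι ⋙ ASet.globalSections A)) ∧
    (∃ e : SimplicialObject (ASet A) ≌ (qcSimplicial A.spec).FullSubcategory,
      Nonempty (e.functor ⋙ (qcSimplicial A.spec).ι ≅
        (SimplicialObject.whiskering _ _).obj (ASet.natural A)) ∧
      Nonempty (e.inverse ≅ (qcSimplicial A.spec).ι ⋙
        (SimplicialObject.whiskering _ _).obj (ASet.globalSections A))) ∧
    (∃ e : SymSeq (ASet A) ≌ (qcSymSeq A.spec).FullSubcategory,
      Nonempty (e.functor ⋙ (qcSymSeq A.spec).ι ≅ mapSeq (ASet.natural A)) ∧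
      Nonempty (e.inverse ≅ (qcSymSeq A.spec).ι ⋙ mapSeq (ASet.globalSections A))) ∧
    (∃ e : SymSpec (ASet A) ≌ (qcSymSpec A.spec).FullSubcategory,
      Nonempty (e.functor ⋙ (qcSymSpec A.spec).ι ≅ SymSpec.mapSpec (ASet.natural A)) ∧
      Nonempty (e.inverse ≅ (qcSymSpec A.spec).ι ⋙
        SymSpec.mapSpec (ASet.globalSections A))) := by
  -- Each case feeds `exists_equivalence` with the prolonged unit and counit, the inclusion into
  -- objectwise quasi-coherence and the quasi-coherence of `M^♮`.
  refine ⟨?_, ?_, ?_, ?_⟩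
  · exact exists_equivalence (ASet.unitIso A) (ASet.counitIso A) le_rfl (qcSet_natural hA)
  · exact exists_equivalence (pointwiseUnit SimplexCategoryᵒᵖ (ASet.unitIso A))
      (pointwiseCounit SimplexCategoryᵒᵖ (ASet.counitIso A)) (qcSimplicial_le A.spec)
      (qcSimplicial_natural hA)
  · exact exists_equivalence
      (pointwiseUnit SymIndex (pointwiseUnit SimplexCategoryᵒᵖ (ASet.unitIso A)))
      (pointwiseCounit SymIndex (pointwiseCounit SimplexCategoryᵒᵖ (ASet.counitIso A)))
      (qcSymSeq_le A.spec) (qcSymSeq_natural hA)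
  · exact exists_equivalence (SymSpec.mapSpecUnit (ASet.unitIso A))
      (SymSpec.mapSpecCounit (ASet.counitIso A)) (qcSymSpec_le A.spec) (qcSymSpec_natural hA)
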